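/- **Setting.** Let $r\ge 1$ be an integer and $\mathcal U\subset\mathbb R^2$ a bounded open neighbourhood of the origin. Let $\mathfrak X$ be the Banach space of $C^r$ vector fields on $\mathcal U$ whose derivatives up to order $r$ extend continuously to $\overline{\mathcal U}$, with the $C^r$-norm, and let $\Omega=\mathfrak X\times\mathfrak X$. An element $Z=(X,Y)\in\Omega$ is regarded as the piecewise smooth vector field equal to $X$ where $x_1x_2>0$ and to $Y$ where $x_1x_2<0$, with switching set $\Sigma=\{x_1x_2=0\}=\Sigma_1\cup\Sigma_2$, $\Sigma_i=\{x_i=0\}$. Put $\det Z=X_1Y_2-X_2Y_1$. *Trajectories.* On $\Sigma_i$ the crossing region is $\{X_iY_i>0\}$; with $j\ne i$, the sliding region is the set of points of $\Sigma_i$ with $x_jX_i<0<x_jY_i$, and the escaping region the set with $x_jY_i<0<x_jX_i$. There the sliding vector field is $Z_i^s=(Y_iX_j-X_iY_j)/(Y_i-X_i)$. Trajectories of $Z$ (on open time intervals) follow $X$ and $Y$ off $\Sigma$, are concatenated at crossing points, and follow $Z_i^s$ in the sliding and escaping regions, into which trajectories of $X$ and $Y$ are not continued. A tangency point ($X_iY_i=0$)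 other than the origin is passed along the common limit of the trajectories through the points of $\Sigma_i$ on its two sides if there is one, and is a trajectory by itself otherwise. The origin is a trajectory by itself if both $\Sigma_1$ and $\Sigma_2$ have sliding or escaping points arbitrarily close to it; it is passed along $Z_i^s$ if only $\Sigma_i$ does and it is in the closure of the crossing region of the other axis; it is passed along the trajectory of $X$ in $x_1x_2\ge0$ or of $Y$ in $x_1x_2\le 0$ through it if it is in the closure of the crossing regions of both axes and of no sliding or escaping region; and it is a trajectory by itself in the remaining degenerate cases. *Equivalences.* $Z,\tilde Z\in\Omega$ are *locally $\Sigma$-equivalent* if there are connected open neighbourhoods $\mathcal U_0,\tilde{\mathcal U}_0\subset\mathcal U$ of the origin and an orientation preserving homeomorphism $h:\mathcal U_0\to\tilde{\mathcal U}_0$ with $h(0)=0$ that maps $\Sigma\cap\mathcal U_0$ onto $\Sigma\cap\tilde{\mathcal U}_0$ and the trajectories of $Z$ in $\mathcal U_0$ onto the trajectories of $\tilde Z$ in $\tilde{\mathcal U}_0$, preserving the sense of time. An *$m$-parameter unfolding* of $Z$ ($m\ge1$) is a smooth map $\delta\in(-\delta_0,\delta_0)^m\mapsto Z_\delta\in\Omega$,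 $\delta_0>0$, with $Z_0=Z$. Two unfoldings $Z_\delta$, $\tilde Z_{\tilde \delta}$ are *locally weak equivalent* if there is a homeomorphism $\mu$ between neighbourhoods of $0$ in their parameter spaces, $\mu(0)=0$, such that $Z_\delta$ and $\tilde Z_{\mu(\delta)}$ are locally $\Sigma$-equivalent for each $\delta$ in the domain of $\mu$ (the neighbourhoods of the origin in the plane may depend on $\delta$). An unfolding $Z_\delta$ of $Z$ is *versal* if for every unfolding $Z'_\alpha$ of $Z$, with any number of parameters, there is a continuous map $\mu$ from a neighbourhood of $0$ in the parameter space of $Z'_\alpha$ to the parameter space of $Z_\delta$, $\mu(0)=0$, such that $Z'_\alpha$ and $Z_{\mu(\alpha)}$ are locally $\Sigma$-equivalent for each $\alpha$ in that neighbourhood. Let $\Xi_1^1\subset\Omega$ be the set of double pseudo-equilibria: all $Z$ with $X_i(0)Y_i(0)<0$ and $\frac{\partial}{\partial x_i}\det Z(0)\neq0$ for $i=1,2$, and $\det Z(0)=0$. **Proposition.** Let $Z=(X,Y)\in\Xi_1^1$, and put $a=\operatorname{sgn}X_1(0)$, $b=\operatorname{sgn}X_2(0)$, $c_1=\operatorname{sgn}\frac{\partial}{\partial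 x_2}\det Z(0)$, $c_2=\operatorname{sgn}\frac{\partial}{\partial x_1}\det Z(0)$. Consider the family $$\tilde Z_\alpha=\begin{cases}\tilde X_\alpha(x_1,x_2)=(a-b\,c_2x_1,\; b+a\alpha), & x_1x_2>0,\\ \tilde Y(x_1,x_2)=(-a,\; -b+a\,c_1x_2), & x_1x_2<0,\end{cases}\qquad \alpha\in\mathbb R.$$ 1. $\tilde Z_0\in\Xi_1^1$, and $\tilde Z_\alpha$ is a one-parameter unfolding of $\tilde Z_0$. 2. Every versal one-parameter unfolding $Z_\delta$ of $Z$ is locally weak equivalent to the family $\tilde Z_\alpha$. 3. Every one-parameter unfolding $Z_\delta$ of $Z$ that is transverse to $\Xi_1^1$ at $Z$, that is, with $\frac{d}{d\delta}\big|_{\delta=0}\det Z_\delta(0)\ne0$, is versal. -/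

import Mathlib

open Set Filter Topology
open scoped ContDiff

noncomputable section

namespace CrossFilippov

/-! ### The space `Ω` of piecewise smooth vector fields switching on `x₁ x₂ = 0`

The coordinates `x₁, x₂` of the plane are `p 0, p 1`; for an index `i`, the other index is `1 - i`. -/

/-- The Euclidean plane. -/
abbrev Plane : Type := EuclideanSpace ℝ (Fin 2)

/-- The point with coordinates `(x₁, x₂)`. -/
def pt (x₁ x₂ : ℝ) : Plane := !₂[x₁, x₂]

/-- A bounded open neighbourhood of the origin of the plane. -/
structure BoundedNhd where
  carrier : Set Plane
  isOpen : IsOpen carrier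
  isBounded : Bornology.IsBounded carrier
  zero_mem : (0 : Plane) ∈ carrier

instance instCompactSpaceClosure (U : BoundedNhd) : CompactSpace (closure U.carrier) :=
  isCompact_iff_compactSpace.mp U.isBounded.isCompact_closure

/-- Families of continuous maps on the compact closure of `U`, the `k`-th one with values in the
`k`-linear maps, `k = 0, …, r`; the norm is the maximum of the sup norms. -/
abbrev JetSpace (r : ℕ) (U : BoundedNhd) : Type :=
  (k : Fin (r + 1)) →
    C(closure U.carrier, ContinuousMultilinearMap ℝ (fun _ : Fin (k : ℕ) => Plane) Plane)

/-- The norm just described (Mathlib's instance, recorded here to help instance search). -/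
instance instSeminormedJetSpace (r : ℕ) (U : BoundedNhd) : SeminormedAddCommGroup (JetSpace r U) :=
  NormedAddCommGroup.toSeminormedAddCommGroup

/-- The space `𝔛ʳ(U)` of vector fields of class `Cʳ` on `U` whose derivatives up to order `r` extend
continuously to the (compact) closure of `U`, with the `Cʳ`-norm. A field is stored through its
derivatives of order `0, …, r`, which determine it and are determined by it. -/
def VectorField (r : ℕ) (U : BoundedNhd) : Submodule ℝ (JetSpace r U) where
  carrier := {J | ∃ F : Plane → Plane, ContDiffOn ℝ r F U.carrier ∧
    ∀ (k : Fin (r + 1)) (p : closure U.carrier), (p : Plane) ∈ U.carrier →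
      J k p = iteratedFDeriv ℝ k F p}
  zero_mem' := by
    refine ⟨fun _ => 0, contDiffOn_const, fun k p _ => ?_⟩
    have h : iteratedFDeriv ℝ (k : ℕ) (fun _ : Plane => (0 : Plane)) = 0 :=
      iteratedFDeriv_fun_zero
    rw [h]
    rfl
  add_mem' := by
    rintro J K ⟨F, hF, hJ⟩ ⟨G, hG, hK⟩
    refine ⟨F + G, hF.add hG, fun k p hp => ?_⟩
    have hk : ((k : ℕ) : WithTop ℕ∞) ≤ (r : WithTop ℕ∞) := by
      exact_mod_cast Nat.lt_succ_iff.mp k.2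
    have hU := U.isOpen.mem_nhds hp
    rw [iteratedFDeriv_add_apply ((hF.contDiffAt hU).of_le hk) ((hG.contDiffAt hU).of_le hk),
      ← hJ k p hp, ← hK k p hp]
    rfl
  smul_mem' := by
    rintro c J ⟨F, hF, hJ⟩
    refine ⟨c • F, hF.const_smul c, fun k p hp => ?_⟩
    have hk : ((k : ℕ) : WithTop ℕ∞) ≤ (r : WithTop ℕ∞) := by
      exact_mod_cast Nat.lt_succ_iff.mp k.2
    have hU := U.isOpen.mem_nhds hp
    rw [iteratedFDeriv_const_smul_apply ((hF.contDiffAt hU).of_le hk), ← hJ k p hp]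
    rfl

/-- `Ω = 𝔛ʳ(U) × 𝔛ʳ(U)`: the pair `Z = (X, Y)` stands for the piecewise smooth vector field that is
`X` where `x₁ x₂ > 0` and `Y` where `x₁ x₂ < 0`. -/
abbrev Omega (r : ℕ) (U : BoundedNhd) : Type := VectorField r U × VectorField r U

open scoped Classical in
/-- The value of a vector field at a point of the closure of `U` (`0` elsewhere). -/
def evalField {r : ℕ} {U : BoundedNhd} (V : VectorField r U) (p : Plane) : Plane :=
  if h : p ∈ closure U.carrier then (V : JetSpace r U) 0 ⟨p, h⟩ (fun _ => 0) else 0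

/-- The vector field given on `U` by a map that is `Cʳ` on the whole plane. -/
def VectorField.ofContDiff {r : ℕ} (U : BoundedNhd) (F : Plane → Plane) (hF : ContDiff ℝ r F) :
    VectorField r U :=
  ⟨fun k =>
    { toFun := fun p => iteratedFDeriv ℝ (k : ℕ) F p
      continuous_toFun := (hF.continuous_iteratedFDeriv
        (by exact_mod_cast Nat.lt_succ_iff.mp k.2)).comp continuous_subtype_val },
    F, hF.contDiffOn, fun _ _ _ => rfl⟩

theorem evalField_ofContDiff {r : ℕ} (U : BoundedNhd) (F : Plane → Plane)
    (hF : ContDiff ℝ r F) {p : Plane} (hp : p ∈ closure U.carrier) :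
    evalField (VectorField.ofContDiff U F hF) p = F p := by
  rw [evalField, dif_pos hp]
  exact iteratedFDeriv_zero_apply (𝕜 := ℝ) (f := F) (x := p) (fun _ => 0)

section Field

variable {r : ℕ} {U : BoundedNhd}

/-- The component `X` of `Z = (X, Y)`. -/
def fieldX (Z : Omega r U) (p : Plane) : Plane := evalField Z.1 p

/-- The component `Y` of `Z = (X, Y)`. -/
def fieldY (Z : Omega r U) (p : Plane) : Plane := evalField Z.2 p

/-- `det Z = X₁ Y₂ - X₂ Y₁`. -/
def detZ (Z : Omega r U) (p : Plane) : ℝ :=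
  fieldX Z p 0 * fieldY Z p 1 - fieldX Z p 1 * fieldY Z p 0

/-- The partial derivative `∂ det Z / ∂ x_j` at the origin. -/
def partialDet (Z : Omega r U) (j : Fin 2) : ℝ :=
  fderiv ℝ (detZ Z) 0 (EuclideanSpace.single j 1)

/-- The class `Ξ₁¹` of double pseudo-equilibria: `Xᵢ Yᵢ (0) < 0`, `det Z (0) = 0` and
`∂ det Z / ∂ xᵢ (0) ≠ 0` for `i = 1, 2`. -/
def DoublePseudoEquilibrium (Z : Omega r U) : Prop :=
  (∀ i, fieldX Z 0 i * fieldY Z 0 i < 0) ∧ detZ Z 0 = 0 ∧ ∀ j, partialDet Z j ≠ 0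

/-! ### The switching set and its regions -/

/-- `Σᵢ`, the part of `xᵢ = 0` in `U`. -/
def axis (U : BoundedNhd) (i : Fin 2) : Set Plane := {p | p ∈ U.carrier ∧ p i = 0}

/-- The switching set `Σ`, given by `x₁ x₂ = 0`. -/
def switching (U : BoundedNhd) : Set Plane := {p | p ∈ U.carrier ∧ p 0 * p 1 = 0}

/-- The crossing region `Σᵢᶜ`. -/
def crossing (Z : Omega r U) (i : Fin 2) : Set Plane :=
  {p | p ∈ axis U i ∧ 0 < fieldX Z p i * fieldY Z p i}

/-- The sliding region `Σᵢˢ`. -/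
def sliding (Z : Omega r U) (i : Fin 2) : Set Plane :=
  {p | p ∈ axis U i ∧ ((0 < p (1 - i) ∧ fieldX Z p i < 0 ∧ 0 < fieldY Z p i) ∨
    (p (1 - i) < 0 ∧ 0 < fieldX Z p i ∧ fieldY Z p i < 0))}

/-- The escaping region `Σᵢᵉ`. -/
def escaping (Z : Omega r U) (i : Fin 2) : Set Plane :=
  {p | p ∈ axis U i ∧ ((0 < p (1 - i) ∧ 0 < fieldX Z p i ∧ fieldY Z p i < 0) ∨
    (p (1 - i) < 0 ∧ fieldX Z p i < 0 ∧ 0 < fieldY Z p i))}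

/-- `Σᵢˢ ∪ Σᵢᵉ`. -/
def slideEsc (Z : Omega r U) (i : Fin 2) : Set Plane := sliding Z i ∪ escaping Z i

/-- The tangency points of `Σᵢ` other than the origin. -/
def tangency (Z : Omega r U) (i : Fin 2) : Set Plane :=
  {p | p ∈ axis U i ∧ p ≠ 0 ∧ fieldX Z p i * fieldY Z p i = 0}

/-- The sliding vector field `Zᵢˢ` as a planar vector: on `Σᵢ` its `i`-th coordinate is `0` and the
other one is `(Yᵢ Xⱼ - Xᵢ Yⱼ) / (Yᵢ - Xᵢ)`, `j ≠ i`. -/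
def slidingField (Z : Omega r U) (i : Fin 2) (p : Plane) : Plane :=
  (fieldY Z p i - fieldX Z p i)⁻¹ • (fieldY Z p i • fieldX Z p - fieldX Z p i • fieldY Z p)

/-! ### Trajectories -/

/-- The rules for a trajectory `γ`, defined on an open interval `I` of times, away from tangency
points and from the origin: it follows `X` where `x₁ x₂ > 0`, follows `Y` where `x₁ x₂ < 0`, is a
concatenation of such pieces at crossing points, and follows the sliding vector field in the sliding
and escaping regions (so trajectories of `X` and `Y` are not continued into these regions). -/
structure BasicRules (Z : Omega r U) (I : Set ℝ) (γ : ℝ → Plane) : Prop where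
  isOpen : IsOpen I
  ordConnected : I.OrdConnected
  mapsTo : MapsTo γ I U.carrier
  continuousOn : ContinuousOn γ I
  followX : ∀ t ∈ I, 0 < γ t 0 * γ t 1 → HasDerivAt γ (fieldX Z (γ t)) t
  followY : ∀ t ∈ I, γ t 0 * γ t 1 < 0 → HasDerivAt γ (fieldY Z (γ t)) t
  cross : ∀ t ∈ I, ∀ i, γ t ≠ 0 → γ t ∈ crossing Z i → ∀ᶠ s in 𝓝[≠] t, γ s ∉ switching U
  slide : ∀ t ∈ I, ∀ i, γ t ∈ slideEsc Z i →
    HasDerivAt γ (slidingField Z i (γ t)) t ∧ ∀ᶠ s in 𝓝 t, γ s ∈ axis U i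

/-- A trajectory that meets neither a tangency point nor the origin. -/
def IsBasicTrajectory (Z : Omega r U) (I : Set ℝ) (γ : ℝ → Plane) : Prop :=
  BasicRules Z I γ ∧ ∀ t ∈ I, γ t ≠ 0 ∧ ∀ i, γ t ∉ tangency Z i

/-- Near the time `t`, the curve `γ` passes through the tangency point `γ t` of `Σᵢ` as the common
limit of the trajectories through the points `q` of `Σᵢ` on both sides of `γ t`, as `q → γ t`. -/
def PassesAsLimit (Z : Omega r U) (i : Fin 2) (γ : ℝ → Plane) (t : ℝ) : Prop :=
  ∃ τ > 0, ContinuousAt γ t ∧ IsBasicTrajectory Z (Ioo (t - τ) t) γ ∧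
    IsBasicTrajectory Z (Ioo t (t + τ)) γ ∧
    (∀ᶠ q in 𝓝[axis U i \ {γ t}] (γ t), q ∉ tangency Z i) ∧
    ∀ ε > 0, ∀ᶠ q in 𝓝[axis U i \ {γ t}] (γ t), ∀ (J : Set ℝ) (η : ℝ → Plane),
      IsBasicTrajectory Z J η → 0 ∈ J → J ⊆ Ioo (-τ) τ → η 0 = q →
        ∀ s ∈ J, dist (η s) (γ (t + s)) < ε

/-- A tangency point is regular if the trajectories from both sides have a common limit. -/
def IsRegularTangency (Z : Omega r U) (i : Fin 2) (p : Plane) : Prop :=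
  ∃ (γ : ℝ → Plane) (t : ℝ), γ t = p ∧ PassesAsLimit Z i γ t

/-- The origin is in the closure of the sliding and escaping regions of `Σᵢ`. -/
def SlidesAtOrigin (Z : Omega r U) (i : Fin 2) : Prop := (0 : Plane) ∈ closure (slideEsc Z i)

/-- The origin is in the closure of the crossing region of `Σᵢ`. -/
def CrossesAtOrigin (Z : Omega r U) (i : Fin 2) : Prop := (0 : Plane) ∈ closure (crossing Z i)

/-- Near the time `t`, `γ` is a trajectory of `X` in `x₁ x₂ ≥ 0`, or a trajectory of `Y` in
`x₁ x₂ ≤ 0`. -/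
def FollowsXOrY (Z : Omega r U) (γ : ℝ → Plane) (t : ℝ) : Prop :=
  (∀ᶠ s in 𝓝 t, 0 ≤ γ s 0 * γ s 1 ∧ HasDerivAt γ (fieldX Z (γ s)) s) ∨
  (∀ᶠ s in 𝓝 t, γ s 0 * γ s 1 ≤ 0 ∧ HasDerivAt γ (fieldY Z (γ s)) s)

/-- `γ` is a trajectory of `Z` on the open time interval `I`. To the basic rules it adds:
a regular tangency point is passed along the limit trajectory, and a singular tangency point is a
trajectory by itself; the origin is a trajectory by itself if both axes have sliding or escaping
points arbitrarily close to it, it is passed along the sliding vector field of `Σᵢ` if only `Σᵢ` has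
such points and `Σⱼ` is crossing, and along `X` or `Y` if both axes are crossing near it (in the
remaining degenerate tangencies at the origin, it is a trajectory by itself). -/
structure IsTrajectory (Z : Omega r U) (I : Set ℝ) (γ : ℝ → Plane) : Prop
    extends BasicRules Z I γ where
  regularTangency : ∀ t ∈ I, ∀ i, γ t ∈ tangency Z i → IsRegularTangency Z i (γ t) →
    PassesAsLimit Z i γ t
  singularTangency : ∀ t ∈ I, ∀ i, γ t ∈ tangency Z i → ¬ IsRegularTangency Z i (γ t) →
    ∀ s ∈ I, γ s = γ t
  originSlide : ∀ t ∈ I, γ t = 0 → ∀ i, SlidesAtOrigin Z i → ¬ SlidesAtOrigin Z (1 - i) →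
    CrossesAtOrigin Z (1 - i) →
      HasDerivAt γ (slidingField Z i 0) t ∧ ∀ᶠ s in 𝓝 t, γ s ∈ axis U i
  originCross : ∀ t ∈ I, γ t = 0 → (∀ i, ¬ SlidesAtOrigin Z i) → (∀ i, CrossesAtOrigin Z i) →
    FollowsXOrY Z γ t
  originFixed : ∀ t ∈ I, γ t = 0 →
    (¬ ∃ i, SlidesAtOrigin Z i ∧ ¬ SlidesAtOrigin Z (1 - i) ∧ CrossesAtOrigin Z (1 - i)) →
    (¬ ∀ i, ¬ SlidesAtOrigin Z i ∧ CrossesAtOrigin Z i) →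
    ∀ s ∈ I, γ s = 0

/-! ### Local `Σ`-equivalence -/

/-- `h` has local degree `+1` at its fixed point `0`: the image of a small circle around the origin,
run counterclockwise, winds exactly once counterclockwise around the origin. For a homeomorphism
between connected open sets this says that it preserves the orientation of the plane. -/
def PreservesOrientation (h : OpenPartialHomeomorph Plane Plane) : Prop :=
  ∃ ρ > 0, Metric.closedBall (0 : Plane) ρ ⊆ h.source ∧
    ∃ θ : ℝ → ℝ, Continuous θ ∧ θ (2 * Real.pi) = θ 0 + 2 * Real.pi ∧
      ∀ t, h (pt (ρ * Real.cos t) (ρ * Real.sin t)) =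
        ‖h (pt (ρ * Real.cos t) (ρ * Real.sin t))‖ • pt (Real.cos (θ t)) (Real.sin (θ t))

/-- `h` maps every trajectory of `Z` in its source, up to an increasing change of time, to a
trajectory of `Z'`. -/
def MapsTrajectories (Z Z' : Omega r U) (h : OpenPartialHomeomorph Plane Plane) : Prop :=
  ∀ (I : Set ℝ) (γ : ℝ → Plane), IsTrajectory Z I γ → MapsTo γ I h.source →
    ∃ (J : Set ℝ) (σ : ℝ → ℝ), StrictMonoOn σ J ∧ σ '' J = I ∧
      IsTrajectory Z' J (fun s => h (γ (σ s)))

/-- Local `Σ`-equivalence of `Z` and `Z'` at the origin: an orientation preserving homeomorphism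
between (connected, open) neighbourhoods of the origin that maps `Σ` onto `Σ` and the trajectories
of `Z` onto those of `Z'`, with their sense of time. -/
def LocallySigmaEquivalent (Z Z' : Omega r U) : Prop :=
  ∃ h : OpenPartialHomeomorph Plane Plane,
    h.source ⊆ U.carrier ∧ h.target ⊆ U.carrier ∧ IsConnected h.source ∧
    (0 : Plane) ∈ h.source ∧ h 0 = 0 ∧ PreservesOrientation h ∧
    (∀ p ∈ h.source, h p ∈ switching U ↔ p ∈ switching U) ∧
    MapsTrajectories Z Z' h ∧ MapsTrajectories Z' Z h.symm

/-! ### Unfoldings -/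

/-- `γ` is an `m`-parameter unfolding of `Z`: a smooth map from a cube `(-δ₀, δ₀)ᵐ`, `m ≥ 1`, to the
Banach space `Ω` with `γ 0 = Z`. -/
def IsUnfolding {m : ℕ} (Z : Omega r U) (γ : (Fin m → ℝ) → Omega r U) : Prop :=
  1 ≤ m ∧ γ 0 = Z ∧ ∃ δ₀ > 0, ContDiffOn ℝ ∞ γ {δ | ∀ i, δ i ∈ Ioo (-δ₀) δ₀}

/-- Local weak equivalence of unfoldings: there is a homeomorphism `μ` between neighbourhoods of `0`
in the parameter spaces, `μ 0 = 0`, such that `γ δ` and `γ' (μ δ)` are locally `Σ`-equivalent for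
each `δ`. -/
def LocallyWeakEquivalent {m m' : ℕ} (γ : (Fin m → ℝ) → Omega r U)
    (γ' : (Fin m' → ℝ) → Omega r U) : Prop :=
  ∃ μ : OpenPartialHomeomorph (Fin m → ℝ) (Fin m' → ℝ), 0 ∈ μ.source ∧ μ 0 = 0 ∧
    ∀ δ ∈ μ.source, LocallySigmaEquivalent (γ δ) (γ' (μ δ))

/-- `γ'` is induced from `γ`, up to local `Σ`-equivalence, by a continuous change of parameters. -/
def InducedFrom {m m' : ℕ} (γ' : (Fin m' → ℝ) → Omega r U) (γ : (Fin m → ℝ) → Omega r U) : Prop :=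
  ∃ N ∈ 𝓝 (0 : Fin m' → ℝ), ∃ μ : (Fin m' → ℝ) → (Fin m → ℝ), ContinuousOn μ N ∧ μ 0 = 0 ∧
    ∀ α ∈ N, LocallySigmaEquivalent (γ' α) (γ (μ α))

/-- `γ` is a versal unfolding of `Z`: every unfolding of `Z`, with any number of parameters, is
induced from it. -/
def IsVersalUnfolding {m : ℕ} (Z : Omega r U) (γ : (Fin m → ℝ) → Omega r U) : Prop :=
  IsUnfolding Z γ ∧
    ∀ (m' : ℕ) (γ' : (Fin m' → ℝ) → Omega r U), IsUnfolding Z γ' → InducedFrom γ' γ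

/-- The one-parameter unfolding `γ` crosses the hypersurface `det Z (0) = 0` of `Ω` with nonzero
speed at the parameter `0`. -/
def IsTransverseUnfolding (γ : (Fin 1 → ℝ) → Omega r U) : Prop :=
  deriv (fun δ : ℝ => detZ (γ fun _ => δ) 0) 0 ≠ 0

end Field

/-! ### The model family -/

/-- The map `(x₁, x₂) ↦ (a - b c₂ x₁, b + a α)`. -/
def modelX (a b c₂ α : ℝ) (p : Plane) : Plane := pt (a - b * c₂ * p 0) (b + a * α)

/-- The map `(x₁, x₂) ↦ (-a, -b + a c₁ x₂)`. -/
def modelY (a b c₁ : ℝ) (p : Plane) : Plane := pt (-a) (-b + a * c₁ * p 1)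

theorem contDiff_pt {n : WithTop ℕ∞} {f g : Plane → ℝ} (hf : ContDiff ℝ n f)
    (hg : ContDiff ℝ n g) : ContDiff ℝ n fun p => pt (f p) (g p) := by
  rw [contDiff_euclidean]
  intro i
  fin_cases i
  · simpa [pt] using hf
  · simpa [pt] using hg

theorem contDiff_modelX (n : WithTop ℕ∞) (a b c₂ α : ℝ) : ContDiff ℝ n (modelX a b c₂ α) :=
  contDiff_pt (by fun_prop) (by fun_prop)

theorem contDiff_modelY (n : WithTop ℕ∞) (a b c₁ : ℝ) : ContDiff ℝ n (modelY a b c₁) :=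
  contDiff_pt (by fun_prop) (by fun_prop)

/-- The one-parameter family `α ↦ Z̃_α = (X̃_α, Ỹ)`. -/
def modelFamily (r : ℕ) (U : BoundedNhd) (a b c₁ c₂ : ℝ) (α : Fin 1 → ℝ) : Omega r U :=
  (VectorField.ofContDiff U (modelX a b c₂ (α 0)) (contDiff_modelX r a b c₂ (α 0)),
    VectorField.ofContDiff U (modelY a b c₁) (contDiff_modelY r a b c₁))

end CrossFilippov

end

/-!
A double pseudo-equilibrium `Z = (X, Y)` has no crossing and no tangency points near the origin: the
arms of the cross `x₁ x₂ = 0` consist of sliding and escaping points, trajectories of `X` and `Y`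
live in the open quadrants, and the origin is a trajectory by itself. Let `e` be the signs of `X
(0)` and `c` those of the partial derivatives of `det Z` at `0` (`HasSigns`); both are constant near
`Z`. On `Σ₁` and `Σ₂` the sliding vector field is `det Z` times a factor of known sign, and the
restriction of `det Z` to each axis has a simple zero at the origin if `det Z (0) = 0`. So the
directions of sliding on the four arms are a function of `e`, `c` and the sign of `det Z (0)`
(`HasSigns.exists_regularNhd`, `slideDir`). The proposition follows from the fact that, among the
fields with given `e` and `c`, this sign is a complete invariant of local `Σ`-equivalence.

*The sign determines the class* (`HasSigns.locallySigmaEquivalent`). The slopes of `X` and of `Y`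
are bounded, Lipschitz and of one and the same sign near the origin. The integral curves of `X` in
the first and third quadrants and of `Y` in the other two therefore fit together to a foliation of
the plane by graphs of monotone functions, the levels of a function `V` with `V (t, 0) = ± t`
(`exists_isCrossLabel`). For two fields with the same `e`, the map that preserves the vertical lines
and carries the levels of `V` to those of `V'` is a homeomorphism that fixes the `x₁`-axis pointwise
and preserves each quadrant and each arm (`exists_homeomorph_matches`). It carries orbits to orbits
in the quadrants, and on the arms as soon as the directions of sliding agree. A monotone curve
within an orbit is reparametrized to a solution by the integral of the reciprocal speed
(`exists_reparametrization`, `mapsTrajectories_of_matches`).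

*The sign is invariant* (`HasSigns.sign_det_eq`). An orientation preserving homeomorphism that
preserves the cross permutes its arms by a rotation (`PreservesOrientation.exists_rotation`). It
maps escaping arms to escaping arms, because a trajectory in a quadrant can start from an escaping
point and not from a sliding one (`escapeForm_nonneg_of_pos`). The escaping arms are two adjacent
ones, so the rotation is trivial. Each half of the `x₁`-axis is then mapped to itself in an
increasing way, which preserves the directions of sliding (`slide_eq_of_increasing`), and these
determine the sign of `det Z (0)`.

*Versality.* If `det Z_δ (0)` has the sign of `± δ`, as it has for transverse unfoldings, every
unfolding `Z'_α` is induced through `δ = ± det Z'_α (0)` (`isVersalUnfolding_of_sign`). Conversely,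
if `Z_δ` is versal, a transverse unfolding is induced from it through some continuous `μ`; as the
sign is invariant, `det Z_{μ (t)} (0)` has the sign of `t`. An intermediate value argument shows
that `det Z_δ (0)` has the sign of `± δ` (`IsVersalUnfolding.exists_sign`). As `det` of the model
family at the origin is the parameter, `δ ↦ ± δ` is a weak equivalence with it.
-/

noncomputable section

namespace CrossFilippov

/-! ### Scalar slope fields and their foliations -/

/-- A family of increasing maps of the line that depends continuously on a parameter, with each
value taken separately, has inverses that depend continuously on parameter and value together. -/
theorem continuous_uncurry_of_rightInverse {T : Type*} [TopologicalSpace T] {F L : T → ℝ → ℝ}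
    (hF : ∀ x, Continuous fun t => F t x) (hmono : ∀ t, StrictMono (F t))
    (hL : ∀ t y, F t (L t y) = y) : Continuous (Function.uncurry L) := by
  rw [continuous_iff_continuousAt]
  rintro ⟨t₀, y₀⟩
  have hlim : ∀ x, Tendsto (fun p : T × ℝ => F p.1 x - p.2) (𝓝 (t₀, y₀)) (𝓝 (F t₀ x - y₀)) :=
    fun x => ((((hF x).comp continuous_fst).sub continuous_snd).tendsto (t₀, y₀))
  refine tendsto_order.2 ⟨fun x hx => ?_, fun x hx => ?_⟩
  · have h : F t₀ x - y₀ < 0 := by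
      have := hmono t₀ hx
      simp only [Function.uncurry, hL] at this
      linarith
    filter_upwards [(hlim x).eventually (gt_mem_nhds h)] with p hp
    refine (hmono p.1).lt_iff_lt.1 ?_
    simp only [Function.uncurry, hL]
    linarith
  · have h : 0 < F t₀ x - y₀ := by
      have := hmono t₀ hx
      simp only [Function.uncurry, hL] at this
      linarith
    filter_upwards [(hlim x).eventually (lt_mem_nhds h)] with p hp
    refine (hmono p.1).lt_iff_lt.1 ?_
    simp only [Function.uncurry, hL]
    linarith

/-- A slope field `f` for the scalar equation `x' = f (t, x)`: continuous, uniformly Lipschitz in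
`x`, and with values between two positive constants. -/
structure IsSlopeField (f : ℝ → ℝ → ℝ) : Prop where
  cont : Continuous (Function.uncurry f)
  lip : ∃ K, ∀ t, LipschitzWith K (f t)
  bounds : ∃ m > 0, ∃ M, ∀ t x, m ≤ f t x ∧ f t x ≤ M

theorem IsSlopeField.pos {f : ℝ → ℝ → ℝ} (hf : IsSlopeField f) (t x : ℝ) : 0 < f t x := by
  obtain ⟨m, hm, M, h⟩ := hf.bounds
  exact hm.trans_le (h t x).1

/-- The solutions exist on the whole interval, as `f` is bounded; it leaves room around `[-1, 1]`,
where they are used. -/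
theorem IsSlopeField.exists_solution {f : ℝ → ℝ → ℝ} (hf : IsSlopeField f) {t₀ : ℝ}
    (ht₀ : t₀ ∈ Icc (-2 : ℝ) 2) (x₀ : ℝ) :
    ∃ η : ℝ → ℝ, η t₀ = x₀ ∧ ∀ t ∈ Ioo (-2 : ℝ) 2, HasDerivAt η (f t (η t)) t := by
  obtain ⟨K, hK⟩ := hf.lip
  obtain ⟨m, hm, M, hM⟩ := hf.bounds
  have hM0 : 0 ≤ M := (hm.le.trans (hM 0 0).1).trans (hM 0 0).2
  have hP : IsPicardLindelof f (⟨t₀, ht₀⟩ : Icc (-2 : ℝ) 2) x₀ (M.toNNReal * 4) 0 M.toNNReal K := by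
    refine ⟨fun t _ => (hK t).lipschitzOnWith, fun x _ => ?_, fun t _ x _ => ?_, ?_⟩
    · exact (hf.cont.comp (continuous_id.prodMk continuous_const)).continuousOn
    · rw [Real.coe_toNNReal _ hM0, Real.norm_of_nonneg (hf.pos t x).le]
      exact (hM t x).2
    · simp only [NNReal.coe_mul, Real.coe_toNNReal _ hM0, NNReal.coe_ofNat, NNReal.coe_zero,
        sub_zero]
      exact mul_le_mul_of_nonneg_left
        (max_le (by linarith [ht₀.1]) (by linarith [ht₀.2])) hM0
  obtain ⟨η, h0, hη⟩ := hP.exists_eq_forall_mem_Icc_hasDerivWithinAt₀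
  exact ⟨η, h0, fun t ht =>
    (hη t (Ioo_subset_Icc_self ht)).hasDerivAt (Icc_mem_nhds ht.1 ht.2)⟩

theorem IsSlopeField.eqOn {f : ℝ → ℝ → ℝ} (hf : IsSlopeField f) {η ζ : ℝ → ℝ}
    (hη : ∀ t ∈ Ioo (-2 : ℝ) 2, HasDerivAt η (f t (η t)) t)
    (hζ : ∀ t ∈ Ioo (-2 : ℝ) 2, HasDerivAt ζ (f t (ζ t)) t) {t₀ : ℝ} (ht₀ : t₀ ∈ Ioo (-2 : ℝ) 2)
    (h : η t₀ = ζ t₀) : EqOn η ζ (Ioo (-2) 2) := by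
  obtain ⟨K, hK⟩ := hf.lip
  exact ODE_solution_unique_of_mem_Ioo (s := fun _ => univ) (fun t _ => (hK t).lipschitzOnWith)
    ht₀ (fun t ht => ⟨hη t ht, mem_univ _⟩) (fun t ht => ⟨hζ t ht, mem_univ _⟩) h

/-- A web: the graphs `t ↦ Φ t u` of increasing maps of the line onto itself, one through each
point of the plane, ordered by their label `u`. -/
structure IsWeb (Φ : ℝ → ℝ → ℝ) : Prop where
  cont : ∀ u, Continuous fun t => Φ t u
  mono_time : ∀ u, StrictMono fun t => Φ t u
  mono_label : ∀ t, StrictMono (Φ t)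
  surj_time : ∀ u, Function.Surjective fun t => Φ t u
  surj_label : ∀ t, Function.Surjective (Φ t)

theorem IsSlopeField.strictMonoOn {f : ℝ → ℝ → ℝ} (hf : IsSlopeField f) {η : ℝ → ℝ}
    (hη : ∀ t ∈ Ioo (-2 : ℝ) 2, HasDerivAt η (f t (η t)) t) : StrictMonoOn η (Ioo (-2) 2) := by
  refine strictMonoOn_of_deriv_pos (convex_Ioo _ _) (HasDerivAt.continuousOn hη) fun t ht => ?_
  rw [interior_Ioo] at ht
  rw [(hη t ht).deriv]
  exact hf.pos _ _

/-- The solutions of a slope field on `[-1, 1]`, labelled by their value at `0` and continued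
with slope `1`, form a web. -/
theorem IsSlopeField.exists_web {f : ℝ → ℝ → ℝ} (hf : IsSlopeField f) :
    ∃ Φ, IsWeb Φ ∧ (∀ u, Φ 0 u = u) ∧
      ∀ u, ∀ t ∈ Ioo (-1 : ℝ) 1, HasDerivAt (fun t => Φ t u) (f t (Φ t u)) t := by
  choose φ hφ0 hφ using hf.exists_solution (t₀ := 0) (by norm_num)
  -- the projection to `[-1, 1]`
  set c : ℝ → ℝ := fun t => max (-1) (min 1 t) with hc
  have hcI : ∀ t, c t ∈ Ioo (-2 : ℝ) 2 := fun t =>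
    ⟨by simp only [hc]; exact lt_max_of_lt_left (by norm_num),
      max_lt (by norm_num) (min_lt_of_left_lt (by norm_num))⟩
  have hcc : Continuous c := by fun_prop
  have hc0 : ∀ t ∈ Icc (-1 : ℝ) 1, c t = t := fun t ht => by
    simp only [hc]; rw [min_eq_right ht.2, max_eq_right ht.1]
  have hcm : ∀ s t, s < t → c s ≤ c t ∧ s - c s ≤ t - c t := by
    intro s t h
    simp only [hc, max_def, min_def]
    split_ifs <;> constructor <;> linarith
  have hinj : ∀ u v, ∀ t ∈ Ioo (-2 : ℝ) 2, φ u t = φ v t → u = v := fun u v t ht h => by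
    have := hf.eqOn (hφ u) (hφ v) ht h (show (0 : ℝ) ∈ Ioo (-2 : ℝ) 2 by norm_num)
    rwa [hφ0, hφ0] at this
  have hcont : ∀ u, ContinuousOn (φ u) (Ioo (-2) 2) := fun u => HasDerivAt.continuousOn (hφ u)
  have hlab : ∀ u v, u < v → ∀ t ∈ Ioo (-2 : ℝ) 2, φ u t < φ v t := by
    intro u v huv t ht
    by_contra! hle
    -- two ordered solutions that change their order would have to meet
    have hiv := isPreconnected_Ioo.intermediate_value₂ (show (0 : ℝ) ∈ Ioo (-2 : ℝ) 2 by norm_num) ht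
      (hcont u) (hcont v) (by rw [hφ0, hφ0]; exact huv.le) hle
    obtain ⟨s, hs, hst⟩ := hiv
    exact huv.ne (hinj u v s hs hst)
  refine ⟨fun t u => φ u (c t) + (t - c t), ⟨fun u => ?_, fun u s t h => ?_, fun t u v h => ?_,
    fun u y => ?_, fun t y => ?_⟩, fun u => ?_, fun u t ht => ?_⟩
  · exact ((hcont u).comp_continuous hcc hcI).add (continuous_id.sub hcc)
  · obtain ⟨h1, h2⟩ := hcm s t h
    rcases h1.eq_or_lt with h1 | h1
    · simp only [h1]; linarith
    · have := hf.strictMonoOn (hφ u) (hcI s) (hcI t) h1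
      simp only
      linarith
  · have := hlab u v h (c t) (hcI t)
    linarith
  · refine mem_range_of_exists_le_of_exists_ge
      (((hcont u).comp_continuous hcc hcI).add (continuous_id.sub hcc))
      ⟨-1 - |y - φ u (-1)|, ?_⟩ ⟨1 + |y - φ u 1|, ?_⟩
    · have hca : c (-1 - |y - φ u (-1)|) = -1 := by
        simp only [hc]
        have := abs_nonneg (y - φ u (-1))
        rw [min_eq_right (by linarith), max_eq_left (by linarith)]
      simp only [hca]
      have := neg_abs_le (y - φ u (-1))
      linarith
    · have hca : c (1 + |y - φ u 1|) = 1 := by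
        simp only [hc]
        have := abs_nonneg (y - φ u 1)
        rw [min_eq_left (by linarith), max_eq_right (by linarith)]
      simp only [hca]
      have := le_abs_self (y - φ u 1)
      linarith
  · obtain ⟨η, h0, hη⟩ := hf.exists_solution (Ioo_subset_Icc_self (hcI t)) (y - (t - c t))
    refine ⟨η 0, ?_⟩
    have := hf.eqOn (hφ (η 0)) hη (show (0 : ℝ) ∈ Ioo (-2 : ℝ) 2 by norm_num) (hφ0 _) (hcI t)
    simp only [this, h0]
    ring
  · simp only [hc0 0 (by norm_num), hφ0]
    ring
  · have heq : (fun t => φ u (c t) + (t - c t)) =ᶠ[𝓝 t] φ u := by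
      filter_upwards [Ioo_mem_nhds ht.1 ht.2] with s hs
      rw [hc0 s (Ioo_subset_Icc_self hs)]
      ring
    have h2 := (hφ u t ⟨by linarith [ht.1], by linarith [ht.2]⟩).congr_of_eventuallyEq heq
    simpa only [hc0 t (Ioo_subset_Icc_self ht), sub_self, add_zero] using h2

/-- Two webs with the same labels on the axis `t = 0` are joined along this axis. -/
theorem IsWeb.glue {Φ Ψ : ℝ → ℝ → ℝ} (hΦ : IsWeb Φ) (hΨ : IsWeb Ψ) (hΦ0 : ∀ u, Φ 0 u = u)
    (hΨ0 : ∀ u, Ψ 0 u = u) : IsWeb fun t u => if t ≤ 0 then Φ t u else Ψ t u := by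
  have hc : ∀ u, Continuous fun t => if t ≤ 0 then Φ t u else Ψ t u := fun u =>
    Continuous.if_le (hΦ.cont u) (hΨ.cont u) continuous_id continuous_const
      (by rintro t rfl; rw [hΦ0, hΨ0])
  refine ⟨hc, fun u s t h => ?_, fun t => ?_, fun u y => ?_, fun t => ?_⟩
  · rcases le_or_gt t 0 with ht | ht
    · simpa only [if_pos ht, if_pos (h.le.trans ht)] using hΦ.mono_time u h
    · rcases le_or_gt s 0 with hs | hs
      · have h1 := (hΦ.mono_time u).monotone hs
        have h2 := hΨ.mono_time u ht
        simp only [if_pos hs, if_neg ht.not_ge, hΦ0, hΨ0] at h1 h2 ⊢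
        exact h1.trans_lt h2
      · simpa only [if_neg hs.not_ge, if_neg ht.not_ge] using hΨ.mono_time u h
  · by_cases ht : t ≤ 0
    · simpa only [if_pos ht] using hΦ.mono_label t
    · simpa only [if_neg ht] using hΨ.mono_label t
  · rcases le_or_gt y u with hy | hy
    · obtain ⟨t, rfl⟩ := hΦ.surj_time u y
      refine ⟨t, if_pos ?_⟩
      rw [← (hΦ.mono_time u).le_iff_le]
      simpa only [hΦ0] using hy
    · obtain ⟨t, rfl⟩ := hΨ.surj_time u y
      refine ⟨t, if_neg (not_le.2 ?_)⟩
      rw [← (hΨ.mono_time u).lt_iff_lt]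
      simpa only [hΨ0] using hy
  · by_cases ht : t ≤ 0
    · simpa only [if_pos ht] using hΦ.surj_label t
    · simpa only [if_neg ht] using hΨ.surj_label t

/-- The graphs of a web can be relabelled by minus the time at which they have height `0`. -/
theorem IsWeb.exists_label {Φ : ℝ → ℝ → ℝ} (hΦ : IsWeb Φ) :
    ∃ V : ℝ → ℝ → ℝ, Continuous (Function.uncurry V) ∧ (∀ t, StrictMono (V t)) ∧
      (∀ t, Function.Surjective (V t)) ∧ (∀ t, V t 0 = -t) ∧
      ∀ c, ∃ u, ∀ t x, V t x = c ↔ x = Φ t u := by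
  choose L hL using hΦ.surj_label
  choose Z hZ using fun u => hΦ.surj_time u 0
  simp only at hZ
  have hLc := continuous_uncurry_of_rightInverse hΦ.cont hΦ.mono_label hL
  have hLm : ∀ t, StrictMono (L t) := fun t x y h => by
    rw [← (hΦ.mono_label t).lt_iff_lt, hL, hL]; exact h
  have hLΦ : ∀ t u, L t (Φ t u) = u := fun t u => (hΦ.mono_label t).injective (hL t _)
  have hZm : StrictMono fun u => -Z u := fun u v h => by
    have h1 := hΦ.mono_label (Z v) h
    simp only [hZ] at h1
    have h2 : Z v < Z u := by
      rw [← (hΦ.mono_time u).lt_iff_lt]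
      simpa only [hZ] using h1
    simpa using h2
  have hZL : ∀ t, Z (L t 0) = t := fun t => (hΦ.mono_time (L t 0)).injective (by
    simp only [hZ, hL])
  have hZs : Function.Surjective fun u => -Z u := fun c => ⟨L (-c) 0, by simp [hZL]⟩
  have hZc := hZm.monotone.continuous_of_surjective hZs
  refine ⟨fun t x => -Z (L t x), hZc.comp hLc, fun t => hZm.comp (hLm t), fun t =>
    hZs.comp fun u => ⟨Φ t u, hLΦ t u⟩, fun t => by simp only [hZL], fun c => ?_⟩
  obtain ⟨u, rfl⟩ := hZs c
  refine ⟨u, fun t x => ?_⟩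
  rw [show (-Z (L t x) = (fun u => -Z u) u) ↔ L t x = u from hZm.injective.eq_iff (a := L t x)]
  constructor
  · rintro rfl
    exact (hL t x).symm
  · rintro rfl
    exact hLΦ t u

/-- In `E × S` the level sets of `V` are graphs of solutions of `x' = f (t, x)`. -/
def LevelsSolve (V f : ℝ → ℝ → ℝ) (E S : Set ℝ) : Prop :=
  ∀ c, ∃ φ : ℝ → ℝ, (∀ q ∈ E, HasDerivAt φ (f q (φ q)) q) ∧ ∀ q ∈ E, ∀ y ∈ S, V q y = c ↔ y = φ q

/-- The label of a web in the half plane `x ≥ 0` or `x ≤ 0` whose graphs solve `x' = f (t, x)` for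
`t < 0` and `x' = g (t, x)` for `t > 0`. -/
theorem exists_label_of_slopeFields {f g : ℝ → ℝ → ℝ} (hf : IsSlopeField f)
    (hg : IsSlopeField g) : ∃ V : ℝ → ℝ → ℝ, Continuous (Function.uncurry V) ∧
      (∀ t, StrictMono (V t)) ∧ (∀ t, Function.Surjective (V t)) ∧ (∀ t, V t 0 = -t) ∧
      (∀ S, LevelsSolve V f (Ioo (-1) 0) S) ∧ ∀ S, LevelsSolve V g (Ioo 0 1) S := by
  obtain ⟨Φ, hΦ, hΦ0, hΦd⟩ := hf.exists_web
  obtain ⟨Ψ, hΨ, hΨ0, hΨd⟩ := hg.exists_web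
  obtain ⟨V, hV1, hV2, hV3, hV4, hV5⟩ := (hΦ.glue hΨ hΦ0 hΨ0).exists_label
  refine ⟨V, hV1, hV2, hV3, hV4, fun S c => ?_, fun S c => ?_⟩ <;> obtain ⟨u, hu⟩ := hV5 c <;>
    refine ⟨fun t => if t ≤ 0 then Φ t u else Ψ t u, fun q hq => ?_, fun q _ y _ => hu q y⟩
  · refine HasDerivAt.congr_of_eventuallyEq ?_ (f := fun t => Φ t u) ?_
    · simpa only [if_pos hq.2.le] using hΦd u q ⟨hq.1, by linarith [hq.2]⟩
    · filter_upwards [gt_mem_nhds hq.2] with t ht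
      rw [if_pos ht.le]
  · refine HasDerivAt.congr_of_eventuallyEq ?_ (f := fun t => Ψ t u) ?_
    · simpa only [if_neg hq.1.not_ge] using hΨd u q ⟨by linarith [hq.1], hq.2⟩
    · filter_upwards [lt_mem_nhds hq.1] with t ht
      rw [if_neg ht.not_ge]

/-- A function whose level curves cross the axes and have slope `f` in the first and third
quadrants and slope `g` in the other two, both of the sign `s`. -/
structure IsCrossLabel (s : ℝ) (f g V : ℝ → ℝ → ℝ) : Prop where
  cont : Continuous (Function.uncurry V)
  mono : ∀ t, StrictMono (V t)
  surj : ∀ t, Function.Surjective (V t)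
  zero : ∀ t, V t 0 = -(s * t)
  first : LevelsSolve V f (Ioo 0 1) (Ioi 0)
  second : LevelsSolve V g (Ioo (-1) 0) (Ioi 0)
  third : LevelsSolve V f (Ioo (-1) 0) (Iio 0)
  fourth : LevelsSolve V g (Ioo 0 1) (Iio 0)

/-- Two webs, one in each of the half planes `x ≥ 0` and `x ≤ 0`, have the same labels on the line
`x = 0`. -/
theorem exists_isCrossLabel_one {f g : ℝ → ℝ → ℝ} (hf : IsSlopeField f) (hg : IsSlopeField g) :
    ∃ V, IsCrossLabel 1 f g V := by
  obtain ⟨A, hA1, hA2, hA3, hA4, hA5, hA6⟩ := exists_label_of_slopeFields hg hf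
  obtain ⟨B, hB1, hB2, hB3, hB4, hB5, hB6⟩ := exists_label_of_slopeFields hf hg
  have hlev : ∀ {W h E S}, (∀ t, ∀ x ∈ S, (if 0 ≤ x then A t x else B t x) = W t x) →
      LevelsSolve W h E S → LevelsSolve (fun t x => if 0 ≤ x then A t x else B t x) h E S := by
    intro W h E S heq hW c
    obtain ⟨φ, h1, h2⟩ := hW c
    exact ⟨φ, h1, fun q hq y hy => by rw [← h2 q hq y hy, ← heq q y hy]⟩
  have hpos : ∀ t, ∀ x ∈ Ioi (0 : ℝ), (if 0 ≤ x then A t x else B t x) = A t x :=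
    fun t x hx => if_pos (le_of_lt hx)
  have hneg : ∀ t, ∀ x ∈ Iio (0 : ℝ), (if 0 ≤ x then A t x else B t x) = B t x :=
    fun t x hx => if_neg (not_le.2 hx)
  refine ⟨fun t x => if 0 ≤ x then A t x else B t x, ⟨?_, fun t x y h => ?_, fun t y => ?_,
    fun t => ?_, hlev hpos (hA6 _), hlev hpos (hA5 _), hlev hneg (hB5 _), hlev hneg (hB6 _)⟩⟩
  · refine Continuous.if_le hA1 hB1 continuous_const continuous_snd fun p hp => ?_
    simp only [← hp, hA4, hB4]
  · rcases le_or_gt 0 x with hx | hx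
    · simpa only [if_pos hx, if_pos (hx.trans h.le)] using hA2 t h
    · rcases le_or_gt 0 y with hy | hy
      · have h1 := hB2 t hx
        have h2 := (hA2 t).monotone hy
        simp only [if_pos hy, if_neg hx.not_ge]
        rw [hB4] at h1
        rw [hA4] at h2
        exact h1.trans_le h2
      · simpa only [if_neg hx.not_ge, if_neg hy.not_ge] using hB2 t h
  · rcases le_or_gt (-t) y with hy | hy
    · obtain ⟨x, rfl⟩ := hA3 t y
      refine ⟨x, if_pos ?_⟩
      rwa [← (hA2 t).le_iff_le, hA4]
    · obtain ⟨x, rfl⟩ := hB3 t y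
      refine ⟨x, if_neg (not_le.2 ?_)⟩
      rwa [← (hB2 t).lt_iff_lt, hB4]
  · simp [hA4]

/-- The solutions with slope `f` in the first and third quadrants and with slope `g` in the other two
fit together to a foliation of the plane across the axes. -/
theorem exists_isCrossLabel {s : ℝ} (hs : s = 1 ∨ s = -1) {f g : ℝ → ℝ → ℝ}
    (hf : IsSlopeField fun t x => s * f t x) (hg : IsSlopeField fun t x => s * g t x) :
    ∃ V, IsCrossLabel s f g V := by
  rcases hs with rfl | rfl
  · simp only [one_mul] at hf hg
    exact exists_isCrossLabel_one hf hg
  · -- the reflection `x ↦ -x` makes the slopes positive and exchanges `f` and `g`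
    have hflip : ∀ {k : ℝ → ℝ → ℝ}, IsSlopeField (fun t x => -1 * k t x) →
        IsSlopeField fun t x => -k t (-x) := by
      intro k hk
      obtain ⟨K, hK⟩ := hk.lip
      obtain ⟨m, hm, M, hM⟩ := hk.bounds
      refine ⟨?_, ⟨K, fun t => ?_⟩, m, hm, M, fun t x => by simpa using hM t (-x)⟩
      · have := hk.cont.comp (continuous_fst.prodMk continuous_snd.neg)
        simp only [Function.comp_def, Function.uncurry, neg_one_mul] at this
        exact this
      · refine LipschitzWith.of_dist_le_mul fun x y => ?_
        have := (hK t).dist_le_mul (-x) (-y)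
        simpa using this
    obtain ⟨V, hV⟩ := exists_isCrossLabel_one (hflip hg) (hflip hf)
    have hlev : ∀ {k E S S'}, (∀ x ∈ S, -x ∈ S') → LevelsSolve V (fun t x => -k t (-x)) E S' →
        LevelsSolve (fun t x => -V t (-x)) k E S := by
      intro k E S S' hS h c
      obtain ⟨φ, h1, h2⟩ := h (-c)
      refine ⟨fun t => -φ t, fun q hq => by simpa using (h1 q hq).fun_neg, fun q hq y hy => ?_⟩
      rw [neg_eq_iff_eq_neg, h2 q hq (-y) (hS y hy), neg_eq_iff_eq_neg]
    refine ⟨fun t x => -V t (-x), ⟨?_, fun t x y h => ?_, fun t y => ?_, fun t => ?_,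
      hlev (fun x hx => ?_) hV.fourth, hlev (fun x hx => ?_) hV.third,
      hlev (fun x hx => ?_) hV.second, hlev (fun x hx => ?_) hV.first⟩⟩
    · exact (hV.cont.comp (continuous_fst.prodMk continuous_snd.neg)).neg
    · exact neg_lt_neg (hV.mono t (neg_lt_neg h))
    · obtain ⟨x, hx⟩ := hV.surj t (-y)
      exact ⟨-x, by simp [hx]⟩
    · simp [hV.zero]
    all_goals simpa using hx

/-! ### Reparametrization of monotone curves -/

theorem image_isOpen_ordConnected {I : Set ℝ} (hI : IsOpen I) (hI' : I.OrdConnected) {q : ℝ → ℝ}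
    (hq : ContinuousOn q I) (hm : StrictMonoOn q I) : IsOpen (q '' I) ∧ (q '' I).OrdConnected := by
  have hoc : (q '' I).OrdConnected := (hI'.isPreconnected.image q hq).ordConnected
  refine ⟨isOpen_iff_mem_nhds.2 ?_, hoc⟩
  rintro _ ⟨t, ht, rfl⟩
  obtain ⟨l, u, ⟨hl, hu⟩, hlu⟩ := mem_nhds_iff_exists_Ioo_subset.1 (hI.mem_nhds ht)
  obtain ⟨l', hl1, hl2⟩ := exists_between hl
  obtain ⟨u', hu1, hu2⟩ := exists_between hu
  have hl' : l' ∈ I := hlu ⟨hl1, hl2.trans hu⟩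
  have hu' : u' ∈ I := hlu ⟨hl.trans hu1, hu2⟩
  exact mem_of_superset (Icc_mem_nhds (hm hl' ht hl2) (hm ht hu' hu1))
    (hoc.out (mem_image_of_mem q hl') (mem_image_of_mem q hu'))

theorem continuousOn_invFunOn {I : Set ℝ} (hI : IsOpen I) (hI' : I.OrdConnected) {q : ℝ → ℝ}
    (hq : ContinuousOn q I) (hm : StrictMonoOn q I) :
    StrictMonoOn (Function.invFunOn q I) (q '' I) ∧ Function.invFunOn q I '' (q '' I) = I ∧
      ContinuousOn (Function.invFunOn q I) (q '' I) := by
  have hmem : ∀ y ∈ q '' I, Function.invFunOn q I y ∈ I := fun y hy => Function.invFunOn_mem hy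
  have heq : ∀ y ∈ q '' I, q (Function.invFunOn q I y) = y := fun y hy => Function.invFunOn_eq hy
  have hmono : StrictMonoOn (Function.invFunOn q I) (q '' I) := fun x hx y hy h => by
    rw [← hm.lt_iff_lt (hmem x hx) (hmem y hy), heq x hx, heq y hy]
    exact h
  have himg : Function.invFunOn q I '' (q '' I) = I := by
    refine Subset.antisymm ?_ fun t ht => ?_
    · rintro _ ⟨y, hy, rfl⟩
      exact hmem y hy
    · refine ⟨q t, mem_image_of_mem q ht, hm.injOn (hmem _ (mem_image_of_mem q ht)) ht ?_⟩
      exact heq _ (mem_image_of_mem q ht)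
  refine ⟨hmono, himg, fun y hy => ?_⟩
  refine (hmono.continuousAt_of_image_mem_nhds
    ((image_isOpen_ordConnected hI hI' hq hm).1.mem_nhds hy) ?_).continuousWithinAt
  rw [himg]
  exact hI.mem_nhds (hmem y hy)

/-- A continuous strictly increasing function on an open interval becomes a solution of `x' = F x`,
`F > 0`, after an increasing change of time. -/
theorem exists_reparametrization_of_pos {I : Set ℝ} (hI : IsOpen I) (hI' : I.OrdConnected)
    {q F : ℝ → ℝ} (hq : ContinuousOn q I) (hm : StrictMonoOn q I) (hF : ContinuousOn F (q '' I))
    (hpos : ∀ x ∈ q '' I, 0 < F x) :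
    ∃ (J : Set ℝ) (σ : ℝ → ℝ), IsOpen J ∧ J.OrdConnected ∧ StrictMonoOn σ J ∧ σ '' J = I ∧
      ContinuousOn σ J ∧ ∀ s ∈ J, HasDerivAt (fun s => q (σ s)) (F (q (σ s))) s := by
  rcases I.eq_empty_or_nonempty with rfl | ⟨t₀, ht₀⟩
  · exact ⟨∅, id, isOpen_empty, ordConnected_empty, subsingleton_empty.strictMonoOn _, image_empty _,
      continuousOn_empty _, by simp⟩
  obtain ⟨hAo, hAc⟩ := image_isOpen_ordConnected hI hI' hq hm
  set A := q '' I with hA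
  have hG : ContinuousOn (fun x => (F x)⁻¹) A := hF.inv₀ fun x hx => (hpos x hx).ne'
  -- the time needed to reach `x`
  set T : ℝ → ℝ := fun x => ∫ y in q t₀..x, (F y)⁻¹ with hT
  have hTd : ∀ x ∈ A, HasDerivAt T (F x)⁻¹ x := fun x hx => by
    have hsub : uIcc (q t₀) x ⊆ A := hAc.uIcc_subset (mem_image_of_mem q ht₀) hx
    exact intervalIntegral.integral_hasDerivAt_right ((hG.mono hsub).intervalIntegrable)
      (hG.stronglyMeasurableAtFilter hAo x hx) (hG.continuousAt (hAo.mem_nhds hx))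
  have hTc : ContinuousOn T A := HasDerivAt.continuousOn hTd
  have hTm : StrictMonoOn T A := by
    refine strictMonoOn_of_deriv_pos hAc.convex hTc fun x hx => ?_
    rw [(hTd x (interior_subset hx)).deriv]
    exact inv_pos.2 (hpos x (interior_subset hx))
  have hθc : ContinuousOn (fun t => T (q t)) I := hTc.comp hq (mapsTo_image q I)
  have hθm : StrictMonoOn (fun t => T (q t)) I := fun s hs t ht h =>
    hTm (mem_image_of_mem q hs) (mem_image_of_mem q ht) (hm hs ht h)
  obtain ⟨hJo, hJc⟩ := image_isOpen_ordConnected hI hI' hθc hθm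
  obtain ⟨h1, h2, h3⟩ := continuousOn_invFunOn hI hI' hθc hθm
  set J := (fun t => T (q t)) '' I with hJ
  set σ := Function.invFunOn (fun t => T (q t)) I with hσ
  have hσI : MapsTo σ J I := fun s hs => h2 ▸ mem_image_of_mem σ hs
  refine ⟨J, σ, hJo, hJc, h1, h2, h3, fun s hs => ?_⟩
  have hx : q (σ s) ∈ A := mem_image_of_mem q (hσI hs)
  have hcont : ContinuousAt (fun s => q (σ s)) s :=
    (hq.comp h3 hσI).continuousAt (hJo.mem_nhds hs)
  have := HasDerivAt.of_local_left_inverse (f := T) hcont (hTd _ hx) (inv_ne_zero (hpos _ hx).ne') (by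
    filter_upwards [hJo.mem_nhds hs] with y hy
    exact Function.invFunOn_eq (f := fun t => T (q t)) (s := I) hy)
  rwa [inv_inv] at this

/-- A strictly monotone continuous function on an open interval becomes a solution of `x' = F x` after
an increasing change of time, if `F` has the sign `e` of its direction. -/
theorem exists_reparametrization {e : ℝ} (he : e = 1 ∨ e = -1) {I : Set ℝ} (hI : IsOpen I)
    (hI' : I.OrdConnected) {q F : ℝ → ℝ} (hq : ContinuousOn q I)
    (hm : StrictMonoOn (fun t => e * q t) I) (hF : ContinuousOn F (q '' I))
    (hpos : ∀ t ∈ I, 0 < e * F (q t)) :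
    ∃ (J : Set ℝ) (σ : ℝ → ℝ), IsOpen J ∧ J.OrdConnected ∧ StrictMonoOn σ J ∧ σ '' J = I ∧
      ContinuousOn σ J ∧ ∀ s ∈ J, HasDerivAt (fun s => q (σ s)) (F (q (σ s))) s := by
  have hee : ∀ x, e * (e * x) = x := fun x => by rcases he with rfl | rfl <;> ring
  obtain ⟨J, σ, h1, h2, h3, h4, h5, h6⟩ := exists_reparametrization_of_pos hI hI'
    (q := fun t => e * q t) (F := fun x => e * F (e * x)) (hq.const_mul e) hm
    ((hF.comp ((continuous_const.mul continuous_id).continuousOn) (by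
      rintro _ ⟨t, ht, rfl⟩
      exact ⟨t, ht, (hee _).symm⟩)).const_mul e)
    (by
      rintro _ ⟨t, ht, rfl⟩
      simpa only [hee] using hpos t ht)
  refine ⟨J, σ, h1, h2, h3, h4, h5, fun s hs => ?_⟩
  simpa only [hee] using (h6 s hs).const_mul e

/-! ### Homeomorphisms of the plane that match two foliations -/

@[simp] theorem pt_zero (x y : ℝ) : pt x y 0 = x := by simp [pt]

@[simp] theorem pt_one (x y : ℝ) : pt x y 1 = y := by simp [pt]

theorem plane_ext {p q : Plane} (h0 : p 0 = q 0) (h1 : p 1 = q 1) : p = q := by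
  ext i
  fin_cases i <;> assumption

theorem pt_eta (p : Plane) : pt (p 0) (p 1) = p := plane_ext (by simp) (by simp)

theorem plane_ne_zero {p : Plane} {i : Fin 2} (h : p i ≠ 0) : p ≠ 0 := by
  rintro rfl
  exact h rfl

theorem plane_eq_zero {p : Plane} (h0 : p 0 = 0) (h1 : p 1 = 0) : p = 0 := plane_ext h0 h1

theorem continuous_coord (i : Fin 2) : Continuous fun p : Plane => p i := by fun_prop

theorem continuous_pt : Continuous fun p : ℝ × ℝ => pt p.1 p.2 :=
  (PiLp.continuous_toLp 2 fun _ : Fin 2 => ℝ).comp (continuous_pi fun i => by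
    fin_cases i
    · exact continuous_fst
    · exact continuous_snd)

theorem hasDerivAt_plane {γ : ℝ → Plane} {v : Plane} {t : ℝ} :
    HasDerivAt γ v t ↔ ∀ i, HasDerivAt (fun s => γ s i) (v i) t := by
  constructor
  · intro h i
    have := (PiLp.hasFDerivAt_apply (𝕜 := ℝ) 2 (E := fun _ : Fin 2 => ℝ) (γ t) i).comp_hasDerivAt t h
    exact this
  · intro h
    have h1 : HasDerivAt (fun s i => γ s i) (fun i => v i) t := hasDerivAt_pi.2 h
    exact ((PiLp.hasFDerivAt_toLp (𝕜 := ℝ) 2 (E := fun _ : Fin 2 => ℝ)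
      (fun i => γ t i)).comp_hasDerivAt t h1)

theorem hasDerivAt_plane' {γ : ℝ → Plane} {v : Plane} {t : ℝ} (i : Fin 2)
    (h : HasDerivAt (fun s => γ s i) (v i) t)
    (h' : HasDerivAt (fun s => γ s (1 - i)) (v (1 - i)) t) : HasDerivAt γ v t := by
  refine hasDerivAt_plane.2 fun j => ?_
  fin_cases i <;> fin_cases j <;> first | exact h | exact h'

/-- The homeomorphism `(t, x) ↦ (t, V (t, x))`. -/
def fiberHomeo (V : ℝ → ℝ → ℝ) (hc : Continuous (Function.uncurry V)) (hm : ∀ t, StrictMono (V t))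
    (hs : ∀ t, Function.Surjective (V t)) : Plane ≃ₜ Plane where
  toFun p := pt (p 0) (V (p 0) (p 1))
  invFun p := pt (p 0) (Function.surjInv (hs (p 0)) (p 1))
  left_inv p := plane_ext (by simp) (by
    simp only [pt_zero, pt_one]
    exact (hm (p 0)).injective (Function.surjInv_eq (hs (p 0)) _))
  right_inv p := plane_ext (by simp) (by
    simp only [pt_zero, pt_one]
    exact Function.surjInv_eq (hs (p 0)) _)
  continuous_toFun := continuous_pt.comp ((continuous_coord 0).prodMk
    (hc.comp ((continuous_coord 0).prodMk (continuous_coord 1))))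
  continuous_invFun := by
    have hV : ∀ x, Continuous fun t => V t x := fun x =>
      hc.comp (continuous_id.prodMk continuous_const)
    have := continuous_uncurry_of_rightInverse hV hm fun t y => Function.surjInv_eq (hs t) y
    exact continuous_pt.comp ((continuous_coord 0).prodMk
      (this.comp ((continuous_coord 0).prodMk (continuous_coord 1))))

/-- A bijection of the plane carries the level curves of `V` to those of `V'` along the vertical
lines `x₁ = const`, each of which it maps to itself. -/
structure Matches (V V' : ℝ → ℝ → ℝ) (h : Plane → Plane) : Prop where
  fst : ∀ p, h p 0 = p 0
  level : ∀ p, V' (p 0) (h p 1) = V (p 0) (p 1)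

theorem fiberHomeo_matches {V V' : ℝ → ℝ → ℝ} (hc hm hs) (hc' hm' hs') :
    Matches V V' ((fiberHomeo V hc hm hs).trans (fiberHomeo V' hc' hm' hs').symm) := by
  refine ⟨fun p => ?_, fun p => ?_⟩
  · change pt (pt (p 0) (V (p 0) (p 1)) 0) _ 0 = _
    rw [pt_zero, pt_zero]
  · change V' _ (pt _ (Function.surjInv (hs' (pt (p 0) (V (p 0) (p 1)) 0))
      (pt (p 0) (V (p 0) (p 1)) 1)) 1) = _
    rw [pt_zero, pt_one, pt_one]
    exact Function.surjInv_eq _ _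

/-- Along each vertical line, the two labels are homeomorphisms onto the line of labels. -/
theorem exists_homeomorph_matches {s : ℝ} {f g V f' g' V' : ℝ → ℝ → ℝ} (hV : IsCrossLabel s f g V)
    (hV' : IsCrossLabel s f' g' V') :
    ∃ h : Plane ≃ₜ Plane, Matches V V' h ∧ Matches V' V h.symm :=
  ⟨_, fiberHomeo_matches hV.cont hV.mono hV.surj hV'.cont hV'.mono hV'.surj,
    fiberHomeo_matches hV'.cont hV'.mono hV'.surj hV.cont hV.mono hV.surj⟩

section Matches

variable {s : ℝ} {f g V f' g' V' : ℝ → ℝ → ℝ} {h : Plane → Plane}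

theorem Matches.strictMono (hh : Matches V V' h) (hV : IsCrossLabel s f g V)
    (hV' : IsCrossLabel s f' g' V') (t : ℝ) : StrictMono fun x => h (pt t x) 1 := fun x y hxy => by
  have h1 := hh.level (pt t x)
  have h2 := hh.level (pt t y)
  simp only [pt_zero, pt_one] at h1 h2
  rw [← (hV'.mono t).lt_iff_lt, h1, h2]
  exact hV.mono t hxy

theorem Matches.axis_fixed (hh : Matches V V' h) (hV : IsCrossLabel s f g V)
    (hV' : IsCrossLabel s f' g' V') (t : ℝ) : h (pt t 0) = pt t 0 := by
  refine plane_ext (hh.fst _) ?_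
  have h1 := hh.level (pt t 0)
  simp only [pt_zero, pt_one, hV.zero] at h1
  rw [pt_one]
  exact (hV'.mono t).injective (h1.trans (hV'.zero t).symm)

theorem Matches.sign_snd (hh : Matches V V' h) (hV : IsCrossLabel s f g V)
    (hV' : IsCrossLabel s f' g' V') (p : Plane) :
    SignType.sign (h p 1) = SignType.sign (p 1) := by
  have h0 : h (pt (p 0) 0) 1 = 0 := by rw [hh.axis_fixed hV hV', pt_one]
  have hm := hh.strictMono hV hV' (p 0)
  rcases lt_trichotomy (p 1) 0 with h1 | h1 | h1
  · have := hm h1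
    simp only [h0, pt_eta] at this
    rw [sign_neg h1, sign_neg this]
  · have : p = pt (p 0) 0 := by rw [← h1, pt_eta]
    rw [this, h0, pt_one]
  · have := hm h1
    simp only [h0, pt_eta] at this
    rw [sign_pos h1, sign_pos this]

/-- A matching bijection preserves the quadrants and the half axes. -/
theorem Matches.sign (hh : Matches V V' h) (hV : IsCrossLabel s f g V)
    (hV' : IsCrossLabel s f' g' V') (p : Plane) (i : Fin 2) :
    SignType.sign (h p i) = SignType.sign (p i) := by
  fin_cases i
  · exact congrArg _ (hh.fst p)
  · exact hh.sign_snd hV hV' p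

end Matches

/-! ### Orientation -/

/-- A homeomorphism that turns no point near the origin by a right angle or more preserves the
orientation. -/
theorem preservesOrientation_of_inner_pos {h : OpenPartialHomeomorph Plane Plane}
    (h0 : (0 : Plane) ∈ h.source)
    (hpos : ∀ p ∈ h.source, p ≠ 0 → 0 < p 0 * h p 0 + p 1 * h p 1) : PreservesOrientation h := by
  obtain ⟨ρ, hρ, hball⟩ := Metric.nhds_basis_closedBall.mem_iff.1 (h.open_source.mem_nhds h0)
  refine ⟨ρ, hρ, hball, ?_⟩
  set P : ℝ → Plane := fun t => pt (ρ * Real.cos t) (ρ * Real.sin t) with hP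
  have hPc : Continuous P := continuous_pt.comp (by fun_prop : Continuous fun t : ℝ =>
    (ρ * Real.cos t, ρ * Real.sin t))
  have hPn : ∀ t, ‖P t‖ = ρ := fun t => by
    rw [EuclideanSpace.norm_eq, Fin.sum_univ_two]
    simp only [hP, pt_zero, pt_one, Real.norm_eq_abs, sq_abs]
    rw [show (ρ * Real.cos t) ^ 2 + (ρ * Real.sin t) ^ 2 = ρ ^ 2 by
      linear_combination ρ ^ 2 * Real.sin_sq_add_cos_sq t]
    exact Real.sqrt_sq hρ.le
  have hPs : ∀ t, P t ∈ h.source := fun t => hball (by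
    rw [mem_closedBall_zero_iff, hPn])
  have hhc : Continuous fun t => h (P t) := h.continuousOn.comp_continuous hPc hPs
  -- the image point, turned back by the angle `t`
  set z : ℝ → ℂ := fun t =>
    ⟨Real.cos t * h (P t) 0 + Real.sin t * h (P t) 1,
      Real.cos t * h (P t) 1 - Real.sin t * h (P t) 0⟩ with hz
  have hzc : Continuous z := by
    have e : z = fun t => ((Real.cos t * h (P t) 0 + Real.sin t * h (P t) 1 : ℝ) : ℂ) +
        ((Real.cos t * h (P t) 1 - Real.sin t * h (P t) 0 : ℝ) : ℂ) * Complex.I := by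
      funext t
      exact Complex.mk_eq_add_mul_I _ _
    have c0 := (continuous_coord 0).comp hhc
    have c1 := (continuous_coord 1).comp hhc
    rw [e]
    exact (Complex.continuous_ofReal.comp
      ((Real.continuous_cos.mul c0).add (Real.continuous_sin.mul c1))).add
      ((Complex.continuous_ofReal.comp
        ((Real.continuous_cos.mul c1).sub (Real.continuous_sin.mul c0))).mul continuous_const)
  have hzpos : ∀ t, 0 < (z t).re := fun t => by
    have := hpos (P t) (hPs t) (by
      intro h
      have := hPn t
      rw [h, norm_zero] at this
      exact hρ.ne this)
    simp only [hP, pt_zero, pt_one] at this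
    simp only [hz, hP]
    have h2 : 0 < ρ * (Real.cos t * h (pt (ρ * Real.cos t) (ρ * Real.sin t)) 0 +
      Real.sin t * h (pt (ρ * Real.cos t) (ρ * Real.sin t)) 1) := by linarith
    exact pos_of_mul_pos_right h2 hρ.le
  have hper : P (2 * Real.pi) = P 0 := by simp [hP]
  have hzper : z (2 * Real.pi) = z 0 := by simp [hz, hper]
  refine ⟨fun t => t + (z t).arg, ?_, ?_, fun t => ?_⟩
  · refine continuous_id.add ?_
    exact continuous_iff_continuousAt.2 fun t =>
      (Complex.continuousAt_arg (Or.inl (hzpos t))).comp hzc.continuousAt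
  · simp only [hzper]
    ring
  · have hzne : z t ≠ 0 := fun h => by
      have := hzpos t
      rw [h] at this
      exact lt_irrefl _ this
    have hn : ‖z t‖ = ‖h (P t)‖ := by
      rw [EuclideanSpace.norm_eq, Fin.sum_univ_two, Complex.norm_def, Complex.normSq_apply]
      congr 1
      simp only [hz, Real.norm_eq_abs, sq_abs]
      linear_combination (h (P t) 0 ^ 2 + h (P t) 1 ^ 2) * Real.sin_sq_add_cos_sq t
    have hre : ‖z t‖ * Real.cos (z t).arg = (z t).re := Complex.norm_mul_cos_arg _
    have him : ‖z t‖ * Real.sin (z t).arg = (z t).im := Complex.norm_mul_sin_arg _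
    rw [hn] at hre him
    change h (P t) = ‖h (P t)‖ • _
    simp only [hz] at hre him
    have hsc := Real.sin_sq_add_cos_sq t
    refine plane_ext ?_ ?_
    · simp only [PiLp.smul_apply, smul_eq_mul, pt_zero, Real.cos_add]
      simp only [hz]
      linear_combination -Real.cos t * hre + Real.sin t * him - h (P t) 0 * hsc
    · simp only [PiLp.smul_apply, smul_eq_mul, pt_one, Real.sin_add]
      simp only [hz]
      linear_combination -Real.sin t * hre - Real.cos t * him - h (P t) 1 * hsc

/-! ### Trajectories near a double pseudo-equilibrium -/

/-- The point of `Σᵢ` with the given coordinate along this axis. -/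
def axisPt (i : Fin 2) (x : ℝ) : Plane := EuclideanSpace.single (1 - i) x

@[simp] theorem axisPt_self (i : Fin 2) (x : ℝ) : axisPt i x i = 0 := by
  fin_cases i <;> simp [axisPt]

@[simp] theorem axisPt_other (i : Fin 2) (x : ℝ) : axisPt i x (1 - i) = x := by
  simp [axisPt]

theorem plane_ext' {p q : Plane} (i : Fin 2) (h : p i = q i) (h' : p (1 - i) = q (1 - i)) :
    p = q := by
  fin_cases i
  · exact plane_ext h h'
  · exact plane_ext h' h

theorem eq_axisPt {p : Plane} {i : Fin 2} (h : p i = 0) : p = axisPt i (p (1 - i)) :=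
  plane_ext' i (by simp [h]) (by simp)

@[simp] theorem axisPt_zero (i : Fin 2) : axisPt i 0 = 0 := by simp [axisPt]

theorem continuous_axisPt (i : Fin 2) : Continuous (axisPt i) := by
  unfold axisPt
  exact (PiLp.continuous_toLp 2 fun _ : Fin 2 => ℝ).comp
    (continuous_single (A := fun _ : Fin 2 => ℝ) (1 - i))

theorem other_ne_zero {p : Plane} {i : Fin 2} (h : p i = 0) (hp : p ≠ 0) : p (1 - i) ≠ 0 :=
  fun h' => hp (plane_ext' i h h')

theorem mul_eq_zero_of_coord {p : Plane} {i : Fin 2} (h : p i = 0) : p 0 * p 1 = 0 := by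
  fin_cases i
  · exact mul_eq_zero_of_left h _
  · exact mul_eq_zero_of_right _ h

section Field

variable {r : ℕ} {U : BoundedNhd}

theorem slidingField_self (Z : Omega r U) (i : Fin 2) (p : Plane) : slidingField Z i p i = 0 := by
  simp only [slidingField, PiLp.smul_apply, PiLp.sub_apply, smul_eq_mul]
  ring

/-- A neighbourhood `G` of the origin on which `X` has the signs `e` and `Y` the opposite ones, and
on the axes of which the direction of the sliding vector field is given by `τ`, as a function of the
axis and of the half axis. -/
structure IsRegularNhd (Z : Omega r U) (e : Fin 2 → ℝ) (τ : Fin 2 → SignType → SignType)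
    (G : Set Plane) : Prop where
  subset : G ⊆ U.carrier
  mem_nhds : G ∈ 𝓝 0
  contX : ContinuousOn (fieldX Z) G
  contY : ContinuousOn (fieldY Z) G
  signX : ∀ p ∈ G, ∀ i, 0 < e i * fieldX Z p i
  signY : ∀ p ∈ G, ∀ i, 0 < -e i * fieldY Z p i
  slide : ∀ p ∈ G, ∀ i, p i = 0 →
    SignType.sign (slidingField Z i p (1 - i)) = τ i (SignType.sign (p (1 - i)))

section Regular

variable {Z : Omega r U} {e : Fin 2 → ℝ} {τ : Fin 2 → SignType → SignType} {G : Set Plane}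

theorem IsRegularNhd.XY_neg (hG : IsRegularNhd Z e τ G) {p : Plane} (hp : p ∈ G) (i : Fin 2) :
    fieldX Z p i * fieldY Z p i < 0 := by
  have h1 := hG.signX p hp i
  have h2 := hG.signY p hp i
  have h3 : 0 < (e i) ^ 2 * -(fieldX Z p i * fieldY Z p i) := by
    have := mul_pos h1 h2
    linarith
  have := pos_of_mul_pos_right h3 (sq_nonneg _)
  linarith

theorem IsRegularNhd.notMem_crossing (hG : IsRegularNhd Z e τ G) {p : Plane} (hp : p ∈ G)
    (i : Fin 2) : p ∉ crossing Z i := fun h => (hG.XY_neg hp i).not_gt h.2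

theorem IsRegularNhd.notMem_tangency (hG : IsRegularNhd Z e τ G) {p : Plane} (hp : p ∈ G)
    (i : Fin 2) : p ∉ tangency Z i := fun h => (hG.XY_neg hp i).ne h.2.2

theorem IsRegularNhd.mem_slideEsc (hG : IsRegularNhd Z e τ G) {p : Plane} (hp : p ∈ G) {i : Fin 2}
    (hi : p i = 0) (h0 : p ≠ 0) : p ∈ slideEsc Z i := by
  have hax : p ∈ axis U i := ⟨hG.subset hp, hi⟩
  have hXY := hG.XY_neg hp i
  rcases (other_ne_zero hi h0).lt_or_gt with h | h <;>
    rcases mul_neg_iff.1 hXY with ⟨h1, h2⟩ | ⟨h1, h2⟩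
  · exact Or.inl ⟨hax, Or.inr ⟨h, h1, h2⟩⟩
  · exact Or.inr ⟨hax, Or.inr ⟨h, h1, h2⟩⟩
  · exact Or.inr ⟨hax, Or.inl ⟨h, h1, h2⟩⟩
  · exact Or.inl ⟨hax, Or.inl ⟨h, h1, h2⟩⟩

theorem ne_zero_of_mem_slideEsc {p : Plane} {i : Fin 2} (h : p ∈ slideEsc Z i) : p ≠ 0 := by
  have : p (1 - i) ≠ 0 := by
    rcases h with ⟨_, h | h⟩ | ⟨_, h | h⟩
    exacts [h.1.ne', h.1.ne, h.1.ne', h.1.ne]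
  exact plane_ne_zero this

theorem mem_axis_of_mem_slideEsc {p : Plane} {i : Fin 2} (h : p ∈ slideEsc Z i) : p ∈ axis U i := by
  rcases h with h | h <;> exact h.1

/-- Both axes have sliding or escaping points close to the origin, which is therefore a trajectory by
itself. -/
theorem IsRegularNhd.slidesAtOrigin (hG : IsRegularNhd Z e τ G) (i : Fin 2) :
    SlidesAtOrigin Z i := by
  have ht : Tendsto (axisPt i) (𝓝[>] 0) (𝓝 0) := by
    have := (continuous_axisPt i).tendsto 0
    rw [axisPt_zero] at this
    exact this.mono_left nhdsWithin_le_nhds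
  refine mem_closure_of_tendsto ht ?_
  filter_upwards [ht hG.mem_nhds, self_mem_nhdsWithin] with x hx hx0
  refine hG.mem_slideEsc hx (axisPt_self i x) (plane_ne_zero (i := 1 - i) ?_)
  rw [axisPt_other]
  exact ne_of_gt hx0

theorem IsRegularNhd.origin_fixed (hG : IsRegularNhd Z e τ G) {I : Set ℝ} {γ : ℝ → Plane}
    (hγ : IsTrajectory Z I γ) {t : ℝ} (ht : t ∈ I) (h0 : γ t = 0) : ∀ s ∈ I, γ s = 0 :=
  hγ.originFixed t ht h0 (fun ⟨i, h⟩ => h.2.1 (hG.slidesAtOrigin (1 - i)))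
    fun h => (h 0).1 (hG.slidesAtOrigin 0)

/-- Near a double pseudo-equilibrium, a curve is a trajectory as soon as it follows `X`, `Y` and
the sliding vector fields and does not pass through the origin. -/
theorem IsRegularNhd.isTrajectory (hG : IsRegularNhd Z e τ G) {I : Set ℝ} {γ : ℝ → Plane}
    (hI : IsOpen I) (hI' : I.OrdConnected) (hc : ContinuousOn γ I) (hmaps : MapsTo γ I G)
    (hX : ∀ t ∈ I, 0 < γ t 0 * γ t 1 → HasDerivAt γ (fieldX Z (γ t)) t)
    (hY : ∀ t ∈ I, γ t 0 * γ t 1 < 0 → HasDerivAt γ (fieldY Z (γ t)) t)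
    (hS : ∀ t ∈ I, ∀ i, γ t i = 0 → γ t ≠ 0 →
      HasDerivAt γ (slidingField Z i (γ t)) t ∧ ∀ s ∈ I, γ s i = 0)
    (h0 : ∀ t ∈ I, γ t = 0 → ∀ s ∈ I, γ s = 0) : IsTrajectory Z I γ where
  isOpen := hI
  ordConnected := hI'
  mapsTo := fun t ht => hG.subset (hmaps ht)
  continuousOn := hc
  followX := hX
  followY := hY
  cross := fun t ht i _ h => absurd h (hG.notMem_crossing (hmaps ht) i)
  slide := fun t ht i h => by
    obtain ⟨h1, h2⟩ := hS t ht i (mem_axis_of_mem_slideEsc h).2 (ne_zero_of_mem_slideEsc h)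
    refine ⟨h1, ?_⟩
    filter_upwards [hI.mem_nhds ht] with s hs
    exact ⟨hG.subset (hmaps hs), h2 s hs⟩
  regularTangency := fun t ht i h => absurd h (hG.notMem_tangency (hmaps ht) i)
  singularTangency := fun t ht i h => absurd h (hG.notMem_tangency (hmaps ht) i)
  originSlide := fun t _ _ i _ h => absurd (hG.slidesAtOrigin (1 - i)) h
  originCross := fun t _ _ h => absurd (hG.slidesAtOrigin 0) (h 0)
  originFixed := fun t ht h _ _ => h0 t ht h

/-- A trajectory near a double pseudo-equilibrium does not leave its quadrant or half axis. -/
theorem IsRegularNhd.sign_const (hG : IsRegularNhd Z e τ G) {I : Set ℝ} {γ : ℝ → Plane}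
    (hγ : IsTrajectory Z I γ) (hmaps : MapsTo γ I G) {s t : ℝ} (hs : s ∈ I) (ht : t ∈ I)
    (i : Fin 2) : SignType.sign (γ s i) = SignType.sign (γ t i) := by
  refine hγ.ordConnected.isPreconnected.constant (f := fun t => SignType.sign (γ t i))
    (fun t ht => ?_) hs ht
  have hct : ContinuousAt (fun s => γ s i) t :=
    (continuous_coord i).continuousAt.comp (hγ.continuousOn.continuousAt (hγ.isOpen.mem_nhds ht))
  by_cases hi : γ t i = 0
  · refine tendsto_nhds_of_eventually_eq ?_
    by_cases h0 : γ t = 0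
    · filter_upwards [self_mem_nhdsWithin] with s hs
      rw [hG.origin_fixed hγ ht h0 s hs, h0]
    · filter_upwards [mem_nhdsWithin_of_mem_nhds
        (hγ.slide t ht i (hG.mem_slideEsc (hmaps ht) hi h0)).2] with s hs
      rw [hs.2, hi]
  · exact (ContinuousAt.comp (f := fun s => γ s i) (continuousAt_sign_of_ne_zero hi)
      hct).continuousWithinAt

theorem continuousOn_slidingField (hG : IsRegularNhd Z e τ G) (i : Fin 2) :
    ContinuousOn (slidingField Z i) G := by
  have hX : ContinuousOn (fun p => fieldX Z p i) G := (continuous_coord i).comp_continuousOn hG.contX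
  have hY : ContinuousOn (fun p => fieldY Z p i) G := (continuous_coord i).comp_continuousOn hG.contY
  refine ((hY.sub hX).inv₀ fun p hp h => ?_).smul ((hY.smul hG.contX).sub (hX.smul hG.contY))
  have := hG.XY_neg hp i
  rw [show fieldY Z p i = fieldX Z p i from sub_eq_zero.1 h] at this
  exact absurd this (mul_self_nonneg _).not_gt

end Regular

end Field

/-! ### Transport of trajectories -/

/-- A point of an open interval and another one lie together in an open subinterval with ends. -/
theorem exists_Ioo_subset {I : Set ℝ} (hI : IsOpen I) (hI' : I.OrdConnected) {s t : ℝ} (hs : s ∈ I)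
    (ht : t ∈ I) : ∃ l u, s ∈ Ioo l u ∧ t ∈ Ioo l u ∧ Ioo l u ⊆ I := by
  have hmin : min s t ∈ I := by rcases min_choice s t with h | h <;> rwa [h]
  have hmax : max s t ∈ I := by rcases max_choice s t with h | h <;> rwa [h]
  obtain ⟨l, _, ⟨hl, _⟩, hlI⟩ := mem_nhds_iff_exists_Ioo_subset.1 (hI.mem_nhds hmin)
  obtain ⟨_, u, ⟨_, hu⟩, huI⟩ := mem_nhds_iff_exists_Ioo_subset.1 (hI.mem_nhds hmax)
  refine ⟨l, u, ⟨hl.trans_le (min_le_left _ _), (le_max_left _ _).trans_lt hu⟩,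
    ⟨hl.trans_le (min_le_right _ _), (le_max_right _ _).trans_lt hu⟩, fun x hx => ?_⟩
  rcases le_or_gt x (min s t) with h1 | h1
  · rcases h1.eq_or_lt with h1 | h1
    · rwa [h1]
    · exact hlI ⟨hx.1, h1.trans (by assumption)⟩
  · rcases le_or_gt (max s t) x with h2 | h2
    · rcases h2.eq_or_lt with h2 | h2
      · rwa [← h2]
      · exact huI ⟨lt_trans (by assumption) h2, hx.2⟩
    · exact hI'.out hmin hmax ⟨h1.le, h2.le⟩

/-- If the level curves of `V` are the graphs with slope `f`, then `V` is constant along the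
integral curves of a planar vector field `A` with slope `f`. -/
theorem LevelsSolve.const {V f : ℝ → ℝ → ℝ} {E S : Set ℝ} (hV : LevelsSolve V f E S)
    (hlip : ∃ K, ∀ t, LipschitzWith K (f t)) {A : Plane → Plane} {B : ℝ} {I : Set ℝ}
    {γ : ℝ → Plane} (hI : IsOpen I) (hI' : I.OrdConnected)
    (hγ : ∀ t ∈ I, HasDerivAt γ (A (γ t)) t) (hmem : ∀ t ∈ I, γ t 0 ∈ E ∧ γ t 1 ∈ S)
    (hslope : ∀ t ∈ I, A (γ t) 1 = f (γ t 0) (γ t 1) * A (γ t) 0)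
    (hB : ∀ t ∈ I, |A (γ t) 0| ≤ B) {s t : ℝ} (hs : s ∈ I) (ht : t ∈ I) :
    V (γ t 0) (γ t 1) = V (γ s 0) (γ s 1) := by
  obtain ⟨K, hK⟩ := hlip
  obtain ⟨φ, hφ, hlev⟩ := hV (V (γ s 0) (γ s 1))
  obtain ⟨l, u, hsl, htl, hsub⟩ := exists_Ioo_subset hI hI' hs ht
  rw [hlev _ (hmem t ht).1 _ (hmem t ht).2]
  have h0 : γ s 1 = φ (γ s 0) := (hlev _ (hmem s hs).1 _ (hmem s hs).2).1 rfl
  refine ODE_solution_unique_of_mem_Ioo (f := fun t => γ t 1) (g := fun t => φ (γ t 0))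
    (v := fun t y => f (γ t 0) y * A (γ t) 0) (s := fun _ => univ) (K := K * B.toNNReal)
    (fun τ hτ => (LipschitzWith.of_dist_le_mul fun x y => ?_).lipschitzOnWith) hsl
    (fun τ hτ => ⟨?_, mem_univ _⟩) (fun τ hτ => ⟨?_, mem_univ _⟩) h0 htl
  · have hB' := hB τ (hsub hτ)
    have h1 := (hK (γ τ 0)).dist_le_mul x y
    rw [Real.dist_eq] at h1 ⊢
    rw [← sub_mul, abs_mul, NNReal.coe_mul, Real.coe_toNNReal _ ((abs_nonneg _).trans hB')]
    calc _ ≤ (K * dist x y) * B := mul_le_mul h1 hB' (abs_nonneg _) (by positivity)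
      _ = _ := by ring
  · simp only
    rw [← hslope τ (hsub hτ)]
    exact hasDerivAt_plane.1 (hγ τ (hsub hτ)) 1
  · exact (hφ _ (hmem τ (hsub hτ)).1).comp τ (hasDerivAt_plane.1 (hγ τ (hsub hτ)) 0)

theorem strictMonoOn_of_hasDerivAt_pos {I : Set ℝ} (hI : IsOpen I) (hI' : I.OrdConnected)
    {q q' : ℝ → ℝ} (hq : ∀ t ∈ I, HasDerivAt q (q' t) t) (hpos : ∀ t ∈ I, 0 < q' t) :
    StrictMonoOn q I := by
  refine strictMonoOn_of_deriv_pos hI'.convex (HasDerivAt.continuousOn hq) fun t ht => ?_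
  rw [hI.interior_eq] at ht
  rw [(hq t ht).deriv]
  exact hpos t ht

/-- The data of an increasing change of time under which `γ` becomes an integral curve of `A`. -/
def ReparametrizesTo (γ : ℝ → Plane) (I : Set ℝ) (A : Plane → Plane) : Prop :=
  ∃ (J : Set ℝ) (σ : ℝ → ℝ), IsOpen J ∧ J.OrdConnected ∧ StrictMonoOn σ J ∧ σ '' J = I ∧
    ContinuousOn σ J ∧ ∀ s ∈ J, HasDerivAt (fun s => γ (σ s)) (A (γ (σ s))) s

/-- A bijection that matches the level curves of `V` and `V'` carries integral curves with slope `f`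
to reparametrized integral curves with slope `f'`. -/
theorem Matches.reparametrizesTo {V f V' f' : ℝ → ℝ → ℝ} {h : Plane → Plane} {E S : Set ℝ}
    (hh : Matches V V' h) (hV : LevelsSolve V f E S) (hV' : LevelsSolve V' f' E S)
    (hlip : ∃ K, ∀ t, LipschitzWith K (f t)) {A A' : Plane → Plane} {B e : ℝ}
    (he : e = 1 ∨ e = -1) {I : Set ℝ} {γ : ℝ → Plane} (hI : IsOpen I) (hI' : I.OrdConnected)
    (hγ : ∀ t ∈ I, HasDerivAt γ (A (γ t)) t) (hmem : ∀ t ∈ I, γ t 0 ∈ E ∧ γ t 1 ∈ S)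
    (hmem' : ∀ t ∈ I, h (γ t) 1 ∈ S)
    (hslope : ∀ t ∈ I, A (γ t) 1 = f (γ t 0) (γ t 1) * A (γ t) 0)
    (hB : ∀ t ∈ I, |A (γ t) 0| ≤ B) (hpos : ∀ t ∈ I, 0 < e * A (γ t) 0) {G' : Set Plane}
    (hG' : ∀ t ∈ I, h (γ t) ∈ G') (hA' : ContinuousOn A' G')
    (hslope' : ∀ p ∈ G', A' p 1 = f' (p 0) (p 1) * A' p 0) (hpos' : ∀ p ∈ G', 0 < e * A' p 0) :
    ReparametrizesTo (fun t => h (γ t)) I A' := by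
  rcases I.eq_empty_or_nonempty with rfl | ⟨t₀, ht₀⟩
  · exact ⟨∅, id, isOpen_empty, ordConnected_empty, subsingleton_empty.strictMonoOn _,
      image_empty _, continuousOn_empty _, by simp⟩
  obtain ⟨φ, hφ, hlev⟩ := hV' (V (γ t₀ 0) (γ t₀ 1))
  have hgraph : ∀ t ∈ I, h (γ t) = pt (γ t 0) (φ (γ t 0)) := fun t ht => by
    refine plane_ext (by rw [hh.fst, pt_zero]) ?_
    rw [pt_one, ← hlev _ (hmem t ht).1 _ (hmem' t ht), hh.level]
    exact hV.const hlip hI hI' hγ hmem hslope hB ht₀ ht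
  have hq : ∀ t ∈ I, HasDerivAt (fun t => γ t 0) (A (γ t) 0) t := fun t ht =>
    hasDerivAt_plane.1 (hγ t ht) 0
  have hφE : ContinuousOn φ E := HasDerivAt.continuousOn hφ
  obtain ⟨J, σ, h1, h2, h3, h4, h5, h6⟩ := exists_reparametrization he hI hI'
    (q := fun t => γ t 0) (F := fun x => A' (pt x (φ x)) 0)
    (HasDerivAt.continuousOn hq)
    (strictMonoOn_of_hasDerivAt_pos hI hI' (fun t ht => (hq t ht).const_mul e) hpos)
    ((continuous_coord 0).comp_continuousOn (hA'.comp (continuous_pt.comp_continuousOn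
      (continuousOn_id.prodMk (hφE.mono (by
        rintro _ ⟨t, ht, rfl⟩
        exact (hmem t ht).1)))) (by
      rintro _ ⟨t, ht, rfl⟩
      simpa only [Function.comp_apply, id, ← hgraph t ht] using hG' t ht)))
    (fun t ht => by rw [← hgraph t ht]; exact hpos' _ (hG' t ht))
  have hσ : MapsTo σ J I := fun s hs => h4 ▸ mem_image_of_mem σ hs
  refine ⟨J, σ, h1, h2, h3, h4, h5, fun s hs => hasDerivAt_plane' 0 ?_ ?_⟩
  · have := h6 s hs
    rw [← hgraph _ (hσ hs)] at this
    simpa only [hh.fst] using this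
  · have h7 := (hφ _ (hmem _ (hσ hs)).1).comp s (h6 s hs)
    rw [← hgraph _ (hσ hs)] at h7
    have h8 : HasDerivAt (fun s => h (γ (σ s)) 1) (A' (h (γ (σ s))) 1) s := by
      rw [hslope' _ (hG' _ (hσ hs)), hgraph _ (hσ hs), pt_zero, pt_one, ← hgraph _ (hσ hs)]
      refine h7.congr_of_eventuallyEq ?_
      filter_upwards [h1.mem_nhds hs] with y hy
      rw [hgraph _ (hσ hy), pt_one]
      rfl
    exact h8

section Field

variable {r : ℕ} {U : BoundedNhd} {Z Z' : Omega r U} {e : Fin 2 → ℝ}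
  {τ : Fin 2 → SignType → SignType} {G G' : Set Plane}

theorem sign_cast_of_ne_zero {σ : SignType} (h : σ ≠ 0) : (σ : ℝ) = 1 ∨ (σ : ℝ) = -1 := by
  cases σ <;> simp at h ⊢

theorem pos_of_sign_eq {σ : SignType} (h : σ ≠ 0) {x : ℝ} (hx : SignType.sign x = σ) :
    0 < (σ : ℝ) * x := by
  subst hx
  rw [sign_mul_self]
  exact abs_pos.2 fun h0 => h (by rw [h0, sign_zero])

/-- A map that is increasing along an axis carries sliding trajectories to reparametrized sliding
trajectories. -/
theorem IsRegularNhd.reparametrizesTo_sliding (hG : IsRegularNhd Z e τ G)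
    (hG' : IsRegularNhd Z' e τ G') (hτ : ∀ i σ, σ ≠ 0 → τ i σ ≠ 0) {h : Plane → Plane}
    (hh : Continuous h) (hsign : ∀ p i, SignType.sign (h p i) = SignType.sign (p i)) {i : Fin 2}
    (hmono : StrictMono fun x => h (axisPt i x) (1 - i)) {I : Set ℝ} {γ : ℝ → Plane}
    (hI : IsOpen I) (hI' : I.OrdConnected) {σ₀ : SignType} (hσ₀ : σ₀ ≠ 0)
    (hγ : ∀ t ∈ I, HasDerivAt γ (slidingField Z i (γ t)) t) (hγi : ∀ t ∈ I, γ t i = 0)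
    (hγs : ∀ t ∈ I, SignType.sign (γ t (1 - i)) = σ₀) (hmaps : MapsTo γ I G)
    (hmaps' : ∀ t ∈ I, h (γ t) ∈ G') :
    ReparametrizesTo (fun t => h (γ t)) I (slidingField Z' i) := by
  have hτ0 := hτ i σ₀ hσ₀
  have he := sign_cast_of_ne_zero hτ0
  have hhi : ∀ t ∈ I, h (γ t) i = 0 := fun t ht => by
    rw [← sign_eq_zero_iff, hsign, hγi t ht, sign_zero]
  have hq : ∀ t ∈ I, HasDerivAt (fun t => γ t (1 - i)) (slidingField Z i (γ t) (1 - i)) t :=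
    fun t ht => hasDerivAt_plane.1 (hγ t ht) (1 - i)
  have hm1 : StrictMonoOn (fun t => (τ i σ₀ : ℝ) * γ t (1 - i)) I :=
    strictMonoOn_of_hasDerivAt_pos hI hI' (fun t ht => (hq t ht).const_mul _) fun t ht =>
      pos_of_sign_eq hτ0 (by rw [hG.slide _ (hmaps ht) i (hγi t ht), hγs t ht])
  have hlt : ∀ s ∈ I, ∀ t ∈ I, γ s (1 - i) < γ t (1 - i) → h (γ s) (1 - i) < h (γ t) (1 - i) := by
    intro s hs t ht hst
    have := hmono hst
    simpa only [← eq_axisPt (hγi s hs), ← eq_axisPt (hγi t ht)] using this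
  have hm2 : StrictMonoOn (fun t => (τ i σ₀ : ℝ) * h (γ t) (1 - i)) I := by
    intro s hs t ht hst
    have h1 := hm1 hs ht hst
    rcases he with he | he <;> simp only [he, one_mul, neg_mul, neg_lt_neg_iff] at h1 ⊢
    · exact hlt s hs t ht h1
    · exact hlt t ht s hs h1
  have hγc : ContinuousOn γ I := HasDerivAt.continuousOn hγ
  have hax : ∀ t ∈ I, axisPt i (h (γ t) (1 - i)) = h (γ t) := fun t ht =>
    (eq_axisPt (hhi t ht)).symm
  obtain ⟨J, σ, h1, h2, h3, h4, h5, h6⟩ := exists_reparametrization he hI hI'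
    (q := fun t => h (γ t) (1 - i)) (F := fun x => slidingField Z' i (axisPt i x) (1 - i))
    ((continuous_coord _).comp_continuousOn (hh.comp_continuousOn hγc)) hm2
    ((continuous_coord _).comp_continuousOn ((continuousOn_slidingField hG' i).comp
      (continuous_axisPt i).continuousOn (by
      rintro _ ⟨t, ht, rfl⟩
      simp only [hax t ht]
      exact hmaps' t ht)))
    (fun t ht => by
      rw [hax t ht]
      refine pos_of_sign_eq hτ0 ?_
      rw [hG'.slide _ (hmaps' t ht) i (hhi t ht), hsign, hγs t ht])
  have hσ : MapsTo σ J I := fun s hs => h4 ▸ mem_image_of_mem σ hs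
  refine ⟨J, σ, h1, h2, h3, h4, h5, fun s hs => hasDerivAt_plane' i ?_ ?_⟩
  · rw [slidingField_self]
    refine (hasDerivAt_const s (0 : ℝ)).congr_of_eventuallyEq ?_
    filter_upwards [h1.mem_nhds hs] with y hy
    exact hhi _ (hσ hy)
  · have := h6 s hs
    rwa [hax _ (hσ hs)] at this

/-- On `G`, the slopes of `X` and `Y` are `f` and `g`. -/
structure HasSlopes (Z : Omega r U) (f g : ℝ → ℝ → ℝ) (G : Set Plane) : Prop where
  lipX : ∃ K, ∀ t, LipschitzWith K (f t)
  lipY : ∃ K, ∀ t, LipschitzWith K (g t)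
  abs_lt : ∀ p ∈ G, |p 0| < 1
  slopeX : ∀ p ∈ G, fieldX Z p 1 = f (p 0) (p 1) * fieldX Z p 0
  slopeY : ∀ p ∈ G, fieldY Z p 1 = g (p 0) (p 1) * fieldY Z p 0
  bound : ∃ B, ∀ p ∈ G, |fieldX Z p 0| ≤ B ∧ |fieldY Z p 0| ≤ B

/-- A trajectory stays in a quadrant, on a half axis or at the origin; in each case its image is a
trajectory after a change of time. -/
theorem mapsTrajectories_of_matches {s : ℝ} {f g V f' g' V' : ℝ → ℝ → ℝ}
    (he : ∀ i, e i = 1 ∨ e i = -1) (hτ : ∀ i σ, σ ≠ 0 → τ i σ ≠ 0)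
    (hG : IsRegularNhd Z e τ G) (hG' : IsRegularNhd Z' e τ G')
    (hf : HasSlopes Z f g G) (hf' : HasSlopes Z' f' g' G')
    (hV : IsCrossLabel s f g V) (hV' : IsCrossLabel s f' g' V')
    {h : Plane → Plane} (hc : Continuous h) (hh : Matches V V' h)
    {I : Set ℝ} {γ : ℝ → Plane} (hγ : IsTrajectory Z I γ) (hmaps : MapsTo γ I G)
    (hmaps' : ∀ t ∈ I, h (γ t) ∈ G') :
    ∃ (J : Set ℝ) (σ : ℝ → ℝ), StrictMonoOn σ J ∧ σ '' J = I ∧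
      IsTrajectory Z' J (fun s => h (γ (σ s))) := by
  have hsign := hh.sign hV hV'
  have hI := hγ.isOpen
  have hI' := hγ.ordConnected
  rcases I.eq_empty_or_nonempty with rfl | ⟨t₀, ht₀⟩
  · refine ⟨∅, id, subsingleton_empty.strictMonoOn _, image_empty _, ?_⟩
    exact hG'.isTrajectory isOpen_empty ordConnected_empty (continuousOn_empty _)
      (mapsTo_empty _ _) (by simp) (by simp) (by simp) (by simp)
  have hconst : ∀ t ∈ I, ∀ i, SignType.sign (γ t i) = SignType.sign (γ t₀ i) := fun t ht i =>
    hG.sign_const hγ hmaps ht ht₀ i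
  -- it is enough to find a reparametrization that follows the right vector field
  have finish : ∀ A : Plane → Plane, ReparametrizesTo (fun t => h (γ t)) I A →
      (0 < γ t₀ 0 * γ t₀ 1 → A = fieldX Z') → (γ t₀ 0 * γ t₀ 1 < 0 → A = fieldY Z') →
      (∀ i, γ t₀ i = 0 → A = slidingField Z' i) → γ t₀ ≠ 0 →
      ∃ (J : Set ℝ) (σ : ℝ → ℝ), StrictMonoOn σ J ∧ σ '' J = I ∧
        IsTrajectory Z' J (fun s => h (γ (σ s))) := by
    rintro A ⟨J, σ, h1, h2, h3, h4, h5, h6⟩ hAX hAY hAS hne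
    have hσ : MapsTo σ J I := fun s hs => h4 ▸ mem_image_of_mem σ hs
    have hs0 : ∀ s ∈ J, ∀ i, SignType.sign (h (γ (σ s)) i) = SignType.sign (γ t₀ i) :=
      fun s hs i => by rw [hsign, hconst _ (hσ hs)]
    have hs1 : ∀ s ∈ J, SignType.sign (h (γ (σ s)) 0 * h (γ (σ s)) 1) =
        SignType.sign (γ t₀ 0 * γ t₀ 1) := fun s hs => by
      rw [sign_mul, sign_mul, hs0 s hs, hs0 s hs]
    have hz : ∀ s ∈ J, ∀ i, h (γ (σ s)) i = 0 ↔ γ t₀ i = 0 := fun s hs i => by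
      rw [← sign_eq_zero_iff, hs0 s hs, sign_eq_zero_iff]
    refine ⟨J, σ, h3, h4, hG'.isTrajectory h1 h2
      (hc.comp_continuousOn (hγ.continuousOn.comp h5 hσ)) (fun s hs => hmaps' _ (hσ hs))
      (fun s hs hp => ?_) (fun s hs hp => ?_) (fun s hs i hi _ => ⟨?_, fun s' hs' => ?_⟩)
      fun s hs h0 => ?_⟩
    · rw [← hAX (sign_eq_one_iff.1 (by rw [← hs1 s hs]; exact sign_pos hp))]
      exact h6 s hs
    · rw [← hAY (sign_eq_neg_one_iff.1 (by rw [← hs1 s hs]; exact sign_neg hp))]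
      exact h6 s hs
    · rw [← hAS i ((hz s hs i).1 hi)]
      exact h6 s hs
    · exact (hz s' hs' i).2 ((hz s hs i).1 hi)
    · exact absurd (plane_eq_zero ((hz s hs 0).1 (by rw [h0]; rfl))
        ((hz s hs 1).1 (by rw [h0]; rfl))) hne
  have hmap1 : StrictMono fun x => h (axisPt 1 x) 0 := fun x y hxy => by
    have hx : ∀ x, axisPt 1 x 0 = x := fun x => axisPt_other 1 x
    simpa only [hh.fst, hx] using hxy
  have hmap0 : StrictMono fun x => h (axisPt 0 x) 1 := by
    have : axisPt 0 = pt 0 := by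
      funext x
      exact plane_ext' 0 (by rw [axisPt_self, pt_zero])
        ((axisPt_other 0 x).trans (pt_one 0 x).symm)
    rw [this]
    exact hh.strictMono hV hV' 0
  have slide : ∀ i, γ t₀ i = 0 → γ t₀ ≠ 0 →
      (StrictMono fun x => h (axisPt i x) (1 - i)) →
      ReparametrizesTo (fun t => h (γ t)) I (slidingField Z' i) := by
    intro i hi hne hmono
    have hi' : ∀ t ∈ I, γ t i = 0 := fun t ht => by
      rw [← sign_eq_zero_iff, hconst t ht, hi, sign_zero]
    have hne' := other_ne_zero hi hne
    refine hG.reparametrizesTo_sliding hG' hτ hc hsign hmono hI hI'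
      (σ₀ := SignType.sign (γ t₀ (1 - i))) (fun h => hne' (sign_eq_zero_iff.1 h))
      (fun t ht => ?_) hi' (fun t ht => hconst t ht _) hmaps hmaps'
    refine (hγ.slide t ht i (hG.mem_slideEsc (hmaps ht) (hi' t ht) ?_)).1
    refine plane_ne_zero (i := 1 - i) fun h => hne' ?_
    rw [← sign_eq_zero_iff, ← hconst t ht, h, sign_zero]
  obtain ⟨B, hB⟩ := hf.bound
  have hmemE : ∀ t ∈ I, (0 < γ t₀ 0 → γ t 0 ∈ Ioo (0 : ℝ) 1) ∧
      (γ t₀ 0 < 0 → γ t 0 ∈ Ioo (-1 : ℝ) 0) := fun t ht => by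
    have := abs_lt.1 (hf.abs_lt _ (hmaps ht))
    refine ⟨fun h0 => ⟨sign_eq_one_iff.1 ?_, this.2⟩, fun h0 => ⟨this.1, sign_eq_neg_one_iff.1 ?_⟩⟩
    · rw [hconst t ht, sign_pos h0]
    · rw [hconst t ht, sign_neg h0]
  have hmemS : ∀ t ∈ I, (0 < γ t₀ 1 → γ t 1 ∈ Ioi (0 : ℝ) ∧ h (γ t) 1 ∈ Ioi (0 : ℝ)) ∧
      (γ t₀ 1 < 0 → γ t 1 ∈ Iio (0 : ℝ) ∧ h (γ t) 1 ∈ Iio (0 : ℝ)) := fun t ht => by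
    refine ⟨fun h0 => ⟨mem_Ioi.2 (sign_eq_one_iff.1 ?_), mem_Ioi.2 (sign_eq_one_iff.1 ?_)⟩,
      fun h0 => ⟨mem_Iio.2 (sign_eq_neg_one_iff.1 ?_), mem_Iio.2 (sign_eq_neg_one_iff.1 ?_)⟩⟩
    · rw [hconst t ht, sign_pos h0]
    · rw [hsign, hconst t ht, sign_pos h0]
    · rw [hconst t ht, sign_neg h0]
    · rw [hsign, hconst t ht, sign_neg h0]
  have hneg : -e 0 = 1 ∨ -e 0 = -1 := by rcases he 0 with h | h <;> simp [h]
  have hprod : ∀ t ∈ I, SignType.sign (γ t 0 * γ t 1) = SignType.sign (γ t₀ 0 * γ t₀ 1) :=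
    fun t ht => by rw [sign_mul, sign_mul, hconst t ht, hconst t ht]
  have followX : ∀ {E S}, LevelsSolve V f E S → LevelsSolve V' f' E S → 0 < γ t₀ 0 * γ t₀ 1 →
      (∀ t ∈ I, γ t 0 ∈ E) → (∀ t ∈ I, γ t 1 ∈ S ∧ h (γ t) 1 ∈ S) →
      ReparametrizesTo (fun t => h (γ t)) I (fieldX Z') := fun hE hE' hp hm hm' =>
    hh.reparametrizesTo hE hE' hf.lipX (he 0) hI hI'
      (fun t ht => hγ.followX t ht (sign_eq_one_iff.1 (by rw [hprod t ht, sign_pos hp])))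
      (fun t ht => ⟨hm t ht, (hm' t ht).1⟩) (fun t ht => (hm' t ht).2)
      (fun t ht => hf.slopeX _ (hmaps ht)) (fun t ht => (hB _ (hmaps ht)).1)
      (fun t ht => hG.signX _ (hmaps ht) 0) hmaps' hG'.contX hf'.slopeX
      (fun p hp => hG'.signX p hp 0)
  have followY : ∀ {E S}, LevelsSolve V g E S → LevelsSolve V' g' E S → γ t₀ 0 * γ t₀ 1 < 0 →
      (∀ t ∈ I, γ t 0 ∈ E) → (∀ t ∈ I, γ t 1 ∈ S ∧ h (γ t) 1 ∈ S) →
      ReparametrizesTo (fun t => h (γ t)) I (fieldY Z') := fun hE hE' hp hm hm' =>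
    hh.reparametrizesTo hE hE' hf.lipY hneg hI hI'
      (fun t ht => hγ.followY t ht (sign_eq_neg_one_iff.1 (by rw [hprod t ht, sign_neg hp])))
      (fun t ht => ⟨hm t ht, (hm' t ht).1⟩) (fun t ht => (hm' t ht).2)
      (fun t ht => hf.slopeY _ (hmaps ht)) (fun t ht => (hB _ (hmaps ht)).2)
      (fun t ht => hG.signY _ (hmaps ht) 0) hmaps' hG'.contY hf'.slopeY
      (fun p hp => hG'.signY p hp 0)
  by_cases hne : γ t₀ = 0
  · have hall := hG.origin_fixed hγ ht₀ hne
    have hh0 : h 0 = 0 := by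
      have := hh.axis_fixed hV hV' 0
      rwa [show pt 0 0 = 0 from plane_eq_zero (pt_zero _ _) (pt_one _ _)] at this
    have hval : ∀ t ∈ I, h (γ t) = 0 := fun t ht => by rw [hall t ht, hh0]
    refine ⟨I, id, strictMono_id.strictMonoOn _, image_id _, hG'.isTrajectory hI hI'
      (hc.comp_continuousOn hγ.continuousOn) (fun t ht => hmaps' t ht)
      (fun t ht hp => absurd hp ?_) (fun t ht hp => absurd hp ?_)
      (fun t ht i _ h0 => absurd (hval t ht) h0) fun _ _ _ => hval⟩ <;>
    · simp only [id, hval t ht]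
      simp
  by_cases h0 : γ t₀ 0 = 0
  · have hz := mul_eq_zero_of_coord h0
    refine finish _ (slide 0 h0 hne hmap0) (fun h => absurd hz h.ne') (fun h => absurd hz h.ne)
      (fun i hi => ?_) hne
    fin_cases i
    · rfl
    · exact absurd (plane_eq_zero h0 hi) hne
  by_cases h1 : γ t₀ 1 = 0
  · have hz := mul_eq_zero_of_coord h1
    refine finish _ (slide 1 h1 hne hmap1) (fun h => absurd hz h.ne') (fun h => absurd hz h.ne)
      (fun i hi => ?_) hne
    fin_cases i
    · exact absurd hi h0
    · rfl
  have hS : ∀ A : Plane → Plane, ∀ i, γ t₀ i = 0 → A = slidingField Z' i := fun A i hi => by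
    fin_cases i
    · exact absurd hi h0
    · exact absurd hi h1
  rcases lt_or_gt_of_ne h0 with h0 | h0 <;> rcases lt_or_gt_of_ne h1 with h1 | h1
  · have hp := mul_pos_of_neg_of_neg h0 h1
    exact finish _ (followX hV.third hV'.third hp (fun t ht => (hmemE t ht).2 h0)
      fun t ht => (hmemS t ht).2 h1) (fun _ => rfl) (fun h => absurd hp h.not_gt) (hS _) hne
  · have hp := mul_neg_of_neg_of_pos h0 h1
    exact finish _ (followY hV.second hV'.second hp (fun t ht => (hmemE t ht).2 h0)
      fun t ht => (hmemS t ht).1 h1) (fun h => absurd hp h.not_gt) (fun _ => rfl) (hS _) hne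
  · have hp := mul_neg_of_pos_of_neg h0 h1
    exact finish _ (followY hV.fourth hV'.fourth hp (fun t ht => (hmemE t ht).1 h0)
      fun t ht => (hmemS t ht).2 h1) (fun h => absurd hp h.not_gt) (fun _ => rfl) (hS _) hne
  · have hp := mul_pos h0 h1
    exact finish _ (followX hV.first hV'.first hp (fun t ht => (hmemE t ht).1 h0)
      fun t ht => (hmemS t ht).1 h1) (fun _ => rfl) (fun h => absurd hp h.not_gt) (hS _) hne

/-- Two fields with the same signs at a double pseudo-equilibrium and the same sliding directions
are locally `Σ`-equivalent. -/
theorem locallySigmaEquivalent_of_matches {s : ℝ} {f g V f' g' V' : ℝ → ℝ → ℝ}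
    (he : ∀ i, e i = 1 ∨ e i = -1) (hτ : ∀ i σ, σ ≠ 0 → τ i σ ≠ 0)
    (hG : IsRegularNhd Z e τ G) (hG' : IsRegularNhd Z' e τ G')
    (hf : HasSlopes Z f g G) (hf' : HasSlopes Z' f' g' G')
    (hV : IsCrossLabel s f g V) (hV' : IsCrossLabel s f' g' V') : LocallySigmaEquivalent Z Z' := by
  obtain ⟨h, hh, hh'⟩ := exists_homeomorph_matches hV hV'
  have h0 : h 0 = 0 := by
    have := hh.axis_fixed hV hV' 0
    rwa [show pt 0 0 = 0 from plane_eq_zero (pt_zero _ _) (pt_one _ _)] at this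
  have hsign := hh.sign hV hV'
  have hN : G ∩ h ⁻¹' G' ∈ 𝓝 (0 : Plane) := inter_mem hG.mem_nhds
    (h.continuous.continuousAt.preimage_mem_nhds (by rw [h0]; exact hG'.mem_nhds))
  obtain ⟨ε, hε, hball⟩ := Metric.mem_nhds_iff.1 hN
  refine ⟨h.toOpenPartialHomeomorphOfImageEq (Metric.ball 0 ε) Metric.isOpen_ball
    (h '' Metric.ball 0 ε) rfl, ?_, ?_, ?_, ?_, h0, ?_, fun p hp => ?_, fun I γ hγ hI => ?_,
    fun I γ hγ hI => ?_⟩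
  · exact fun p hp => hG.subset (hball hp).1
  · rintro _ ⟨p, hp, rfl⟩
    exact hG'.subset (hball hp).2
  · exact (convex_ball (0 : Plane) ε).isConnected ⟨0, Metric.mem_ball_self hε⟩
  · exact Metric.mem_ball_self hε
  · refine preservesOrientation_of_inner_pos (Metric.mem_ball_self hε) fun p _ hp => ?_
    change 0 < p 0 * h p 0 + p 1 * h p 1
    have hm : ∀ i, 0 ≤ p i * h p i ∧ (p i ≠ 0 → 0 < p i * h p i) := fun i => by
      have := hsign p i
      rcases lt_trichotomy (p i) 0 with hi | hi | hi
      · rw [sign_neg hi, sign_eq_neg_one_iff] at this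
        exact ⟨(mul_pos_of_neg_of_neg hi this).le, fun _ => mul_pos_of_neg_of_neg hi this⟩
      · simp [hi]
      · rw [sign_pos hi, sign_eq_one_iff] at this
        exact ⟨(mul_pos hi this).le, fun _ => mul_pos hi this⟩
    by_cases hp0 : p 0 = 0
    · exact add_pos_of_nonneg_of_pos (hm 0).1 ((hm 1).2 fun hp1 => hp (plane_eq_zero hp0 hp1))
    · exact add_pos_of_pos_of_nonneg ((hm 0).2 hp0) (hm 1).1
  · have hz : h p 0 * h p 1 = 0 ↔ p 0 * p 1 = 0 := by
      rw [← sign_eq_zero_iff, ← sign_eq_zero_iff (a := p 0 * p 1), sign_mul, sign_mul, hsign, hsign]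
    exact ⟨fun hq => ⟨hG.subset (hball hp).1, hz.1 hq.2⟩,
      fun hq => ⟨hG'.subset (hball hp).2, hz.2 hq.2⟩⟩
  · exact mapsTrajectories_of_matches he hτ hG hG' hf hf' hV hV' h.continuous hh hγ
      (fun t ht => (hball (hI ht)).1) fun t ht => (hball (hI ht)).2
  · have hI2 : ∀ t ∈ I, h.symm (γ t) ∈ Metric.ball (0 : Plane) ε := fun t ht => by
      obtain ⟨p, hp, hpt⟩ := hI ht
      rw [← hpt]
      simpa using hp
    refine mapsTrajectories_of_matches he hτ hG' hG hf' hf hV' hV h.symm.continuous hh' hγ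
      (fun t ht => ?_) fun t ht => (hball (hI2 t ht)).1
    have := (hball (hI2 t ht)).2
    simpa using this

end Field

/-! ### Local data of a double pseudo-equilibrium -/

/-- Near a point where both components of a `C¹` vector field are nonzero, its slope is the
restriction of a slope field on the plane. -/
theorem exists_slopeField {A : Plane → Plane} (hA : ContDiffAt ℝ 1 A 0) {s : ℝ}
    (hs : s = 1 ∨ s = -1) (hpos : 0 < s * (A 0 1 / A 0 0)) :
    ∃ f : ℝ → ℝ → ℝ, IsSlopeField (fun t x => s * f t x) ∧
      ∀ᶠ p in 𝓝 (0 : Plane), A p 1 = f (p 0) (p 1) * A p 0 := by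
  have hss : s * s = 1 := by rcases hs with rfl | rfl <;> norm_num
  have hA0 : A 0 0 ≠ 0 := fun h => by rw [h] at hpos; simp at hpos
  have hcoord : ∀ i, ContDiffAt ℝ 1 (fun p => A p i) 0 := fun i =>
    (EuclideanSpace.proj (𝕜 := ℝ) i).contDiff.contDiffAt.comp (0 : Plane) hA
  have hR : ContDiffAt ℝ 1 (fun p => s * (A p 1 / A p 0)) 0 :=
    contDiffAt_const.mul ((hcoord 1).div (hcoord 0) hA0)
  obtain ⟨K, N, hN, hK⟩ := hR.exists_lipschitzOnWith
  obtain ⟨g, hg, hgN⟩ := hK.extend_real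
  set R₀ := s * (A 0 1 / A 0 0) with hR₀
  set F : Plane → ℝ := fun p => max (R₀ / 2) (min (2 * R₀) (g p)) with hF
  have hFl : LipschitzWith K F := (hg.const_min (2 * R₀)).const_max (R₀ / 2)
  have hd : ∀ t x y, dist (pt t x) (pt t y) = dist x y := fun t x y => by
    rw [EuclideanSpace.dist_eq, Fin.sum_univ_two]
    simp only [pt_zero, pt_one, dist_self]
    rw [zero_pow two_ne_zero, zero_add, Real.sqrt_sq dist_nonneg]
  have hsf : (fun t x => s * (s * F (pt t x))) = fun t x => F (pt t x) := by
    funext t x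
    rw [← mul_assoc, hss, one_mul]
  refine ⟨fun t x => s * F (pt t x), ?_, ?_⟩
  · rw [hsf]
    refine ⟨hFl.continuous.comp continuous_pt, ⟨K, fun t => LipschitzWith.of_dist_le_mul
      fun x y => ?_⟩, R₀ / 2, by linarith, 2 * R₀, fun t x => ⟨le_max_left _ _, ?_⟩⟩
    · rw [← hd t x y]
      exact hFl.dist_le_mul _ _
    · exact max_le (by linarith) (min_le_left _ _)
  · have hlim := hR.continuousAt.tendsto
    filter_upwards [hN, hlim.eventually (lt_mem_nhds (show R₀ / 2 < R₀ by linarith)),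
      hlim.eventually (gt_mem_nhds (show R₀ < 2 * R₀ by linarith)),
      (hcoord 0).continuousAt.eventually_ne hA0] with p hpN h1 h2 h3
    have hgp : g p = s * (A p 1 / A p 0) := (hgN hpN).symm
    simp only [pt_eta, hF, hgp]
    rw [min_eq_right h2.le, max_eq_right h1.le, ← mul_assoc, hss, one_mul, div_mul_cancel₀ _ h3]

/-- Near a simple zero, the sign of a function is that of its derivative times that of the
variable. -/
theorem eventually_sign_eq {f : ℝ → ℝ} {f' : ℝ} (hf : HasDerivAt f f' 0) (h0 : f 0 = 0)
    (h' : f' ≠ 0) : ∀ᶠ x in 𝓝 0, SignType.sign (f x) = SignType.sign f' * SignType.sign x := by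
  have h1 := hasDerivAt_iff_tendsto_slope.1 hf
  have h2 : ∀ᶠ x in 𝓝[≠] 0, SignType.sign (slope f 0 x) = SignType.sign f' := by
    have := (continuousAt_sign_of_ne_zero h').tendsto.comp h1
    rw [nhds_discrete] at this
    exact tendsto_pure.1 this
  rw [eventually_nhdsWithin_iff] at h2
  filter_upwards [h2] with x hx
  by_cases hx0 : x = 0
  · simp [hx0, h0]
  · have h3 : f x = slope f 0 x * x := by
      rw [slope_def_field, h0]
      field_simp
      ring
    rw [h3, sign_mul, hx hx0]

section Field

variable {r : ℕ} {U : BoundedNhd}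

theorem zero_mem_closure (U : BoundedNhd) : (0 : Plane) ∈ closure U.carrier :=
  subset_closure U.zero_mem

theorem evalField_contDiffAt (hr : 1 ≤ r) (V : VectorField r U) {p : Plane}
    (hp : p ∈ U.carrier) : ContDiffAt ℝ 1 (evalField V) p := by
  obtain ⟨F, hF, hJ⟩ := V.2
  have h : ∀ q ∈ U.carrier, evalField V q = F q := fun q hq => by
    rw [evalField, dif_pos (subset_closure hq), hJ 0 _ hq]
    exact iteratedFDeriv_zero_apply (𝕜 := ℝ) (f := F) (x := q) (fun _ => 0)
  refine ((hF.contDiffAt (U.isOpen.mem_nhds hp)).of_le (by exact_mod_cast hr)).congr_of_eventuallyEq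
    ?_
  filter_upwards [U.isOpen.mem_nhds hp] with q hq using h q hq

theorem evalField_apply_zero (V : VectorField r U) :
    evalField V 0 = (V : JetSpace r U) 0 ⟨0, zero_mem_closure U⟩ (fun _ => 0) :=
  dif_pos (zero_mem_closure U)

theorem fderiv_evalField (hr : 1 ≤ r) (V : VectorField r U) (v : Plane) :
    fderiv ℝ (evalField V) 0 v =
      (V : JetSpace r U) ⟨1, by omega⟩ ⟨0, zero_mem_closure U⟩ (fun _ => v) := by
  obtain ⟨F, hF, hJ⟩ := V.2
  have h : evalField V =ᶠ[𝓝 0] F := by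
    filter_upwards [U.isOpen.mem_nhds U.zero_mem] with q hq
    rw [evalField, dif_pos (subset_closure hq), hJ 0 _ hq]
    exact iteratedFDeriv_zero_apply (𝕜 := ℝ) (f := F) (x := q) (fun _ => 0)
  rw [h.fderiv_eq, hJ ⟨1, by omega⟩ _ U.zero_mem]
  exact (iteratedFDeriv_one_apply (𝕜 := ℝ) (f := F) (x := 0) (fun _ => v)).symm

theorem continuous_evalField_zero : Continuous fun V : VectorField r U => evalField V 0 := by
  simp only [evalField_apply_zero]
  have h1 : Continuous fun V : VectorField r U => (V : JetSpace r U) 0 :=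
    (continuous_apply 0).comp continuous_subtype_val
  exact (continuous_eval_const _).comp
    ((continuous_eval_const _).comp h1)

theorem continuous_fderiv_evalField (hr : 1 ≤ r) (v : Plane) :
    Continuous fun V : VectorField r U => fderiv ℝ (evalField V) 0 v := by
  simp only [fderiv_evalField hr]
  have h1 : Continuous fun V : VectorField r U => (V : JetSpace r U) ⟨1, by omega⟩ :=
    (continuous_apply _).comp continuous_subtype_val
  exact (continuous_eval_const _).comp
    ((continuous_eval_const _).comp h1)

theorem hasFDerivAt_coord {A : Plane → Plane} {p : Plane} (hA : DifferentiableAt ℝ A p)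
    (i : Fin 2) :
    HasFDerivAt (fun q => A q i) ((EuclideanSpace.proj (𝕜 := ℝ) i).comp (fderiv ℝ A p)) p :=
  (EuclideanSpace.proj (𝕜 := ℝ) i).hasFDerivAt.comp p hA.hasFDerivAt

theorem differentiableAt_field (hr : 1 ≤ r) (V : VectorField r U) :
    DifferentiableAt ℝ (evalField V) 0 :=
  (evalField_contDiffAt hr V U.zero_mem).differentiableAt one_ne_zero

theorem differentiableAt_detZ (hr : 1 ≤ r) (Z : Omega r U) : DifferentiableAt ℝ (detZ Z) 0 := by
  have hX := fun i => (hasFDerivAt_coord (differentiableAt_field hr Z.1) i).differentiableAt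
  have hY := fun i => (hasFDerivAt_coord (differentiableAt_field hr Z.2) i).differentiableAt
  exact ((hX 0).mul (hY 1)).sub ((hX 1).mul (hY 0))

theorem partialDet_eq (hr : 1 ≤ r) (Z : Omega r U) (j : Fin 2) :
    partialDet Z j =
      (fieldX Z 0 0 * fderiv ℝ (evalField Z.2) 0 (EuclideanSpace.single j 1) 1 +
        fieldY Z 0 1 * fderiv ℝ (evalField Z.1) 0 (EuclideanSpace.single j 1) 0) -
      (fieldX Z 0 1 * fderiv ℝ (evalField Z.2) 0 (EuclideanSpace.single j 1) 0 +
        fieldY Z 0 0 * fderiv ℝ (evalField Z.1) 0 (EuclideanSpace.single j 1) 1) := by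
  have hX := hasFDerivAt_coord (differentiableAt_field hr Z.1)
  have hY := hasFDerivAt_coord (differentiableAt_field hr Z.2)
  have : HasFDerivAt (detZ Z) _ 0 := ((hX 0).mul (hY 1)).sub ((hX 1).mul (hY 0))
  rw [partialDet, this.fderiv]
  rfl

theorem continuous_coord_fieldX (i : Fin 2) : Continuous fun Z : Omega r U => fieldX Z 0 i :=
  (continuous_coord i).comp (continuous_evalField_zero.comp continuous_fst)

theorem continuous_coord_fieldY (i : Fin 2) : Continuous fun Z : Omega r U => fieldY Z 0 i :=
  (continuous_coord i).comp (continuous_evalField_zero.comp continuous_snd)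

theorem continuous_detZ_zero : Continuous fun Z : Omega r U => detZ Z 0 :=
  ((continuous_coord_fieldX 0).mul (continuous_coord_fieldY 1)).sub
    ((continuous_coord_fieldX 1).mul (continuous_coord_fieldY 0))

theorem continuous_partialDet (hr : 1 ≤ r) (j : Fin 2) :
    Continuous fun Z : Omega r U => partialDet Z j := by
  simp only [partialDet_eq hr]
  have hX : ∀ i, Continuous fun Z : Omega r U =>
      fderiv ℝ (evalField Z.1) 0 (EuclideanSpace.single j 1) i := fun i =>
    (continuous_coord i).comp ((continuous_fderiv_evalField hr _).comp continuous_fst)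
  have hY : ∀ i, Continuous fun Z : Omega r U =>
      fderiv ℝ (evalField Z.2) 0 (EuclideanSpace.single j 1) i := fun i =>
    (continuous_coord i).comp ((continuous_fderiv_evalField hr _).comp continuous_snd)
  exact (((continuous_coord_fieldX 0).mul (hY 1)).add ((continuous_coord_fieldY 1).mul (hX 0))).sub
    (((continuous_coord_fieldX 1).mul (hY 0)).add ((continuous_coord_fieldY 0).mul (hX 1)))

/-- At the origin, `X` has the signs `e`, `Y` has the opposite signs, and the partial derivatives of
`det Z` have the signs `c`. -/
structure HasSigns (Z : Omega r U) (e c : Fin 2 → ℝ) : Prop where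
  signX : ∀ i, 0 < e i * fieldX Z 0 i
  signY : ∀ i, 0 < -e i * fieldY Z 0 i
  sign_partial : ∀ j, 0 < c j * partialDet Z j

theorem HasSigns.eventually (hr : 1 ≤ r) {Z : Omega r U} {e c : Fin 2 → ℝ} (hZ : HasSigns Z e c) :
    ∀ᶠ Z' in 𝓝 Z, HasSigns Z' e c := by
  have h1 : ∀ i, ∀ᶠ Z' in 𝓝 Z, 0 < e i * fieldX Z' 0 i := fun i =>
    (((continuous_coord_fieldX i).const_mul (e i)).tendsto Z).eventually (lt_mem_nhds (hZ.signX i))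
  have h2 : ∀ i, ∀ᶠ Z' in 𝓝 Z, 0 < -e i * fieldY Z' 0 i := fun i =>
    (((continuous_coord_fieldY i).const_mul (-e i)).tendsto Z).eventually
      (lt_mem_nhds (hZ.signY i))
  have h3 : ∀ j, ∀ᶠ Z' in 𝓝 Z, 0 < c j * partialDet Z' j := fun j =>
    (((continuous_partialDet hr j).const_mul (c j)).tendsto Z).eventually
      (lt_mem_nhds (hZ.sign_partial j))
  filter_upwards [eventually_all.2 h1, eventually_all.2 h2, eventually_all.2 h3] with Z' a b c
  exact ⟨a, b, c⟩

/-- The direction of sliding on a half axis near the origin, in terms of the signs `e` of `X` and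
`c` of the partial derivatives of `det Z`, and of the sign `d` of `det Z` at the origin. -/
def slideDir (e c : Fin 2 → ℝ) (d : SignType) (i : Fin 2) (σ : SignType) : SignType :=
  (if i = 0 then SignType.sign (e 0) else -SignType.sign (e 1)) *
    if d = 0 then SignType.sign (c (1 - i)) * σ else d

theorem slideDir_ne_zero {e c : Fin 2 → ℝ} (he : ∀ i, e i ≠ 0) (hc : ∀ i, c i ≠ 0) (d : SignType)
    (i : Fin 2) {σ : SignType} (hσ : σ ≠ 0) : slideDir e c d i σ ≠ 0 := by
  refine mul_ne_zero ?_ ?_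
  · split_ifs
    · exact fun h => he 0 (sign_eq_zero_iff.1 h)
    · exact fun h => he 1 (sign_eq_zero_iff.1 (by simpa using h))
  · split_ifs with h
    · exact mul_ne_zero (fun h => hc _ (sign_eq_zero_iff.1 h)) hσ
    · exact h

theorem sign_eq_of_mul_pos {x y : ℝ} (h : 0 < x * y) : SignType.sign y = SignType.sign x := by
  rcases mul_pos_iff.1 h with ⟨h1, h2⟩ | ⟨h1, h2⟩
  · rw [sign_pos h1, sign_pos h2]
  · rw [sign_neg h1, sign_neg h2]

theorem hasDerivAt_detZ_axisPt (hr : 1 ≤ r) (Z : Omega r U) (i : Fin 2) :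
    HasDerivAt (fun x => detZ Z (axisPt i x)) (partialDet Z (1 - i)) 0 := by
  have hax : HasDerivAt (axisPt i) (EuclideanSpace.single (1 - i) (1 : ℝ)) 0 := by
    have : axisPt i = fun x => x • (EuclideanSpace.single (1 - i) (1 : ℝ) : Plane) := by
      funext x
      exact plane_ext' i (by simp [axisPt]) (by simp [axisPt])
    rw [this]
    simpa using (hasDerivAt_id (0 : ℝ)).smul_const (EuclideanSpace.single (1 - i) (1 : ℝ) : Plane)
  have h1 := (differentiableAt_detZ hr Z).hasFDerivAt
  rw [← axisPt_zero i] at h1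
  have h2 := h1.comp_hasDerivAt (0 : ℝ) hax
  rw [axisPt_zero] at h2
  exact h2

/-- On the axes near the origin, `det Z` has the sign of its value at the origin, or a simple zero
there. -/
theorem HasSigns.eventually_sign_det (hr : 1 ≤ r) {Z : Omega r U} {e c : Fin 2 → ℝ}
    (hZ : HasSigns Z e c) (i : Fin 2) : ∀ᶠ x in 𝓝 (0 : ℝ),
      SignType.sign (detZ Z (axisPt i x)) = if SignType.sign (detZ Z 0) = 0 then
        SignType.sign (c (1 - i)) * SignType.sign x else SignType.sign (detZ Z 0) := by
  have hd := hasDerivAt_detZ_axisPt hr Z i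
  by_cases h0 : detZ Z 0 = 0
  · have hp := hZ.sign_partial (1 - i)
    have hne : partialDet Z (1 - i) ≠ 0 := fun h => by rw [h, mul_zero] at hp; exact hp.false
    filter_upwards [eventually_sign_eq hd (by rw [axisPt_zero, h0]) hne] with x hx
    rw [hx, if_pos (by rw [h0, sign_zero]), sign_eq_of_mul_pos hp]
  · have hs : SignType.sign (detZ Z 0) ≠ 0 := fun h => h0 (sign_eq_zero_iff.1 h)
    simp only [if_neg hs]
    have h1 : ContinuousAt (fun x => detZ Z (axisPt i x)) 0 := hd.continuousAt
    have h2 : ContinuousAt SignType.sign (detZ Z (axisPt i 0)) := by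
      rw [axisPt_zero]
      exact continuousAt_sign_of_ne_zero h0
    have h3 := (ContinuousAt.comp (f := fun x => detZ Z (axisPt i x)) h2 h1).tendsto
    rw [nhds_discrete SignType] at h3
    filter_upwards [tendsto_pure.1 h3] with x hx
    simpa using hx

/-- A field with the signs of a double pseudo-equilibrium is regular near the origin. -/
theorem HasSigns.exists_regularNhd (hr : 1 ≤ r) {Z : Omega r U} {e c : Fin 2 → ℝ}
    (he : ∀ i, e i = 1 ∨ e i = -1) (hZ : HasSigns Z e c) :
    ∃ G f g, IsRegularNhd Z e (slideDir e c (SignType.sign (detZ Z 0))) G ∧ HasSlopes Z f g G ∧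
      IsSlopeField (fun t x => e 0 * e 1 * f t x) ∧
      IsSlopeField (fun t x => e 0 * e 1 * g t x) := by
  have hs : e 0 * e 1 = 1 ∨ e 0 * e 1 = -1 := by
    rcases he 0 with h | h <;> rcases he 1 with h' | h' <;> simp [h, h']
  have hX1 := fun {p} hp => evalField_contDiffAt (p := p) hr Z.1 hp
  have hY1 := fun {p} hp => evalField_contDiffAt (p := p) hr Z.2 hp
  have hslope : ∀ u v x y : ℝ, 0 < u * x → 0 < v * y → 0 < u * v * (y / x) := by
    intro u v x y h1 h2
    have hx : x ≠ 0 := fun h => by rw [h, mul_zero] at h1; exact h1.false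
    have h3 : u * v * (y / x) = (u * x) * (v * y) / x ^ 2 := by field_simp
    rw [h3]
    positivity
  obtain ⟨f, hf, hfs⟩ := exists_slopeField (hX1 U.zero_mem) hs
    (hslope _ _ _ _ (hZ.signX 0) (hZ.signX 1))
  obtain ⟨g, hg, hgs⟩ := exists_slopeField (hY1 U.zero_mem) hs (by
    have := hslope _ _ _ _ (hZ.signY 0) (hZ.signY 1)
    rwa [neg_mul_neg] at this)
  have hXc : ∀ i, ContinuousAt (fun p => fieldX Z p i) 0 := fun i =>
    (continuous_coord i).continuousAt.comp (hX1 U.zero_mem).continuousAt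
  have hYc : ∀ i, ContinuousAt (fun p => fieldY Z p i) 0 := fun i =>
    (continuous_coord i).continuousAt.comp (hY1 U.zero_mem).continuousAt
  have ev1 : ∀ i, ∀ᶠ p in 𝓝 (0 : Plane), 0 < e i * fieldX Z p i := fun i =>
    ((hXc i).const_mul (e i)).tendsto.eventually (lt_mem_nhds (hZ.signX i))
  have ev2 : ∀ i, ∀ᶠ p in 𝓝 (0 : Plane), 0 < -e i * fieldY Z p i := fun i =>
    ((hYc i).const_mul (-e i)).tendsto.eventually (lt_mem_nhds (hZ.signY i))
  have ev3 : ∀ i, ∀ᶠ p in 𝓝 (0 : Plane), p i = 0 → SignType.sign (detZ Z p) =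
      if SignType.sign (detZ Z 0) = 0 then SignType.sign (c (1 - i)) * SignType.sign (p (1 - i))
        else SignType.sign (detZ Z 0) := fun i => by
    have h1 : Tendsto (fun p : Plane => p (1 - i)) (𝓝 0) (𝓝 0) :=
      (continuous_coord (1 - i)).tendsto 0
    filter_upwards [h1.eventually (hZ.eventually_sign_det hr i)] with p hp hi
    rwa [← eq_axisPt hi] at hp
  have ev4 : ∀ᶠ p in 𝓝 (0 : Plane), |p 0| < 1 :=
    ((continuous_coord 0).abs.tendsto 0).eventually (gt_mem_nhds (by simp))
  have ev5 : ∀ᶠ p in 𝓝 (0 : Plane), |fieldX Z p 0| < |fieldX Z 0 0| + 1 :=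
    (hXc 0).abs.tendsto.eventually (gt_mem_nhds (by linarith))
  have ev6 : ∀ᶠ p in 𝓝 (0 : Plane), |fieldY Z p 0| < |fieldY Z 0 0| + 1 :=
    (hYc 0).abs.tendsto.eventually (gt_mem_nhds (by linarith))
  obtain ⟨G, hG, hGp⟩ := ((((((((eventually_all.2 ev1).and (eventually_all.2 ev2)).and
    (eventually_all.2 ev3)).and ev4).and ev5).and ev6).and hfs).and
    (hgs.and (U.isOpen.mem_nhds U.zero_mem))).exists_mem
  refine ⟨G, f, g, ⟨fun p hp => (hGp p hp).2.2, hG, fun p hp => ?_, fun p hp => ?_,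
    fun p hp => (hGp p hp).1.1.1.1.1.1.1, fun p hp => (hGp p hp).1.1.1.1.1.1.2,
    fun p hp i hi => ?_⟩, ?_, hf, hg⟩
  · exact (hX1 (hGp p hp).2.2).continuousAt.continuousWithinAt
  · exact (hY1 (hGp p hp).2.2).continuousAt.continuousWithinAt
  · have h1 := (hGp p hp).1.1.1.1.1.1.1 i
    have h2 := (hGp p hp).1.1.1.1.1.1.2 i
    have h3 := (hGp p hp).1.1.1.1.1.2 i hi
    rw [slideDir, ← h3]
    have h4 : 0 < e i * (fieldX Z p i - fieldY Z p i) := by linarith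
    have hinv : ∀ x : ℝ, SignType.sign x⁻¹ = SignType.sign x := fun x => by
      rcases lt_trichotomy x 0 with h | h | h
      · rw [sign_neg h, sign_neg (inv_lt_zero.2 h)]
      · simp [h]
      · rw [sign_pos h, sign_pos (inv_pos.2 h)]
    obtain rfl | rfl : i = 0 ∨ i = 1 := by omega
    · have : slidingField Z 0 p 1 = (fieldX Z p 0 - fieldY Z p 0)⁻¹ * detZ Z p := by
        simp only [slidingField, detZ, PiLp.smul_apply, PiLp.sub_apply, smul_eq_mul]
        rw [← neg_sub (fieldX Z p 0), inv_neg]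
        ring
      change SignType.sign (slidingField Z 0 p 1) = _
      rw [this, sign_mul, hinv, sign_eq_of_mul_pos h4]
      simp
    · have : slidingField Z 1 p 0 = -((fieldX Z p 1 - fieldY Z p 1)⁻¹ * detZ Z p) := by
        simp only [slidingField, detZ, PiLp.smul_apply, PiLp.sub_apply, smul_eq_mul]
        rw [← neg_sub (fieldX Z p 1), inv_neg]
        ring
      change SignType.sign (slidingField Z 1 p 0) = _
      rw [this, Left.sign_neg, sign_mul, hinv, sign_eq_of_mul_pos h4]
      simp
  · obtain ⟨Kf, hKf⟩ := hf.lip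
    obtain ⟨Kg, hKg⟩ := hg.lip
    have hss : e 0 * e 1 * (e 0 * e 1) = 1 := by rcases hs with h | h <;> rw [h] <;> norm_num
    have habs : |e 0 * e 1| = 1 := by rcases hs with h | h <;> rw [h] <;> norm_num
    have hl : ∀ {k : ℝ → ℝ → ℝ} {K}, (∀ t, LipschitzWith K fun x => e 0 * e 1 * k t x) →
        ∃ K, ∀ t, LipschitzWith K (k t) := fun {k K} hk =>
      ⟨K, fun t => LipschitzWith.of_dist_le_mul fun x y => by
        have := (hk t).dist_le_mul x y
        rwa [Real.dist_eq, ← mul_sub, abs_mul, habs, one_mul, ← Real.dist_eq] at this⟩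
    exact ⟨hl hKf, hl hKg, fun p hp => (hGp p hp).1.1.1.1.2, fun p hp => (hGp p hp).1.2,
      fun p hp => (hGp p hp).2.1, max (|fieldX Z 0 0| + 1) (|fieldY Z 0 0| + 1), fun p hp =>
      ⟨(hGp p hp).1.1.1.2.le.trans (le_max_left _ _), (hGp p hp).1.1.2.le.trans (le_max_right _ _)⟩⟩

theorem HasSigns.ne_zero {Z : Omega r U} {e c : Fin 2 → ℝ} (hZ : HasSigns Z e c) :
    (∀ i, e i ≠ 0) ∧ ∀ i, c i ≠ 0 := by
  refine ⟨fun i h => ?_, fun i h => ?_⟩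
  · have := hZ.signX i
    rw [h, zero_mul] at this
    exact this.false
  · have := hZ.sign_partial i
    rw [h, zero_mul] at this
    exact this.false

/-- Near a double pseudo-equilibrium, the sign of `det Z` at the origin determines the class of local
`Σ`-equivalence. -/
theorem HasSigns.locallySigmaEquivalent (hr : 1 ≤ r) {Z Z' : Omega r U} {e c : Fin 2 → ℝ}
    (he : ∀ i, e i = 1 ∨ e i = -1) (hZ : HasSigns Z e c) (hZ' : HasSigns Z' e c)
    (hdet : SignType.sign (detZ Z 0) = SignType.sign (detZ Z' 0)) : LocallySigmaEquivalent Z Z' := by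
  obtain ⟨G, f, g, hG, hs, hf, hg⟩ := hZ.exists_regularNhd hr he
  obtain ⟨G', f', g', hG', hs', hf', hg'⟩ := hZ'.exists_regularNhd hr he
  have hss : e 0 * e 1 = 1 ∨ e 0 * e 1 = -1 := by
    rcases he 0 with h | h <;> rcases he 1 with h' | h' <;> simp [h, h']
  obtain ⟨V, hV⟩ := exists_isCrossLabel hss hf hg
  obtain ⟨V', hV'⟩ := exists_isCrossLabel hss hf' hg'
  rw [← hdet] at hG'
  exact locallySigmaEquivalent_of_matches he
    (fun i σ hσ => slideDir_ne_zero hZ.ne_zero.1 hZ.ne_zero.2 _ i hσ) hG hG' hs hs' hV hV'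

end Field

/-! ### Invariants of local `Σ`-equivalence -/

/-- The unit vector at the angle `t`. -/
def unitVec (t : ℝ) : Plane := pt (Real.cos t) (Real.sin t)

theorem sin_two_mul_eq_zero_iff (t : ℝ) :
    Real.sin (2 * t) = 0 ↔ unitVec t 0 * unitVec t 1 = 0 := by
  rw [Real.sin_two_mul, unitVec, pt_zero, pt_one]
  constructor <;> intro h <;> linarith

/-- An orientation preserving local homeomorphism that preserves the cross `x₁ x₂ = 0` permutes its
four arms by a rotation: along a circle around the origin, the angle of the image point cannot skip
a multiple of `π / 2`, and four steps make up a full turn. -/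
theorem PreservesOrientation.exists_rotation {h : OpenPartialHomeomorph Plane Plane}
    (ho : PreservesOrientation h) (h00 : (0 : Plane) ∈ h.source) (h0 : h 0 = 0)
    (hcross : ∀ p ∈ h.source, h p 0 * h p 1 = 0 ↔ p 0 * p 1 = 0) :
    ∃ ρ > 0, Metric.closedBall (0 : Plane) ρ ⊆ h.source ∧ ∃ n : ℤ, ∀ k : ℕ, k ≤ 3 → ∃ R > (0 : ℝ),
      h (ρ • unitVec (k * (Real.pi / 2))) = R • unitVec ((n + k) * (Real.pi / 2)) := by
  obtain ⟨ρ, hρ, hball, θ, hθ, hθ4, hpolar⟩ := ho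
  have hpi := Real.pi_pos
  have hP : ∀ t, pt (ρ * Real.cos t) (ρ * Real.sin t) = ρ • unitVec t := fun t =>
    plane_ext (by simp [unitVec]) (by simp [unitVec])
  have hun : ∀ t, ‖unitVec t‖ = 1 := fun t => by
    rw [EuclideanSpace.norm_eq, Fin.sum_univ_two]
    simp [unitVec]
  simp only [hP] at hpolar
  have hsrc : ∀ t, ρ • unitVec t ∈ h.source := fun t => hball (by
    rw [mem_closedBall_zero_iff, norm_smul, hun, Real.norm_of_nonneg hρ.le, mul_one])
  have hne : ∀ t, 0 < ‖h (ρ • unitVec t)‖ := fun t => norm_pos_iff.2 fun h1 => by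
    have h2 := h.injOn (hsrc t) h00 (h1.trans h0.symm)
    rcases smul_eq_zero.1 h2 with h3 | h3
    · exact hρ.ne' h3
    · have := hun t
      rw [h3, norm_zero] at this
      exact zero_ne_one this
  have hzero : ∀ t, Real.sin (2 * θ t) = 0 ↔ Real.sin (2 * t) = 0 := fun t => by
    have h1 := hcross _ (hsrc t)
    rw [hpolar t] at h1
    simp only [PiLp.smul_apply, smul_eq_mul] at h1
    have e1 : ∀ c x y : ℝ, 0 < c → ((c * x) * (c * y) = 0 ↔ x * y = 0) := fun c x y hc => by
      rw [show (c * x) * (c * y) = c ^ 2 * (x * y) by ring, mul_eq_zero,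
        or_iff_right (pow_pos hc 2).ne']
    rw [e1 ρ _ _ hρ] at h1
    have h2 := e1 ‖h (ρ • unitVec t)‖ (unitVec (θ t) 0) (unitVec (θ t) 1) (hne t)
    rw [sin_two_mul_eq_zero_iff, sin_two_mul_eq_zero_iff, ← h1]
    exact h2.symm
  have hint : ∀ k : ℕ, ∃ n : ℤ, θ (k * (Real.pi / 2)) = n * (Real.pi / 2) := fun k => by
    have h1 : Real.sin (2 * (k * (Real.pi / 2))) = 0 := by
      rw [show 2 * (k * (Real.pi / 2)) = k * Real.pi by ring, Real.sin_nat_mul_pi]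
    obtain ⟨n, hn⟩ := Real.sin_eq_zero_iff.1 ((hzero _).2 h1)
    exact ⟨n, by linarith⟩
  choose n hn using hint
  -- otherwise `θ` would take the value `(n k + 1) π / 2` off the cross
  have hstep : ∀ k : ℕ, n (k + 1) ≤ n k + 1 := fun k => by
    by_contra! hlt
    have hlt' : ((n k : ℝ) + 1) < n (k + 1) := by exact_mod_cast hlt
    have hab : (k : ℝ) * (Real.pi / 2) ≤ ((k + 1 : ℕ) : ℝ) * (Real.pi / 2) := by
      push_cast
      linarith
    have hmem : ((n k : ℝ) + 1) * (Real.pi / 2) ∈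
        Ioo (θ (k * (Real.pi / 2))) (θ ((k + 1 : ℕ) * (Real.pi / 2))) := by
      rw [hn, hn]
      exact ⟨by nlinarith, by nlinarith⟩
    obtain ⟨t, ht, htθ⟩ := intermediate_value_Ioo hab hθ.continuousOn hmem
    have h1 : Real.sin (2 * t) = 0 := by
      rw [← hzero, htθ, Real.sin_eq_zero_iff]
      exact ⟨n k + 1, by push_cast; ring⟩
    obtain ⟨m, hm⟩ := Real.sin_eq_zero_iff.1 h1
    have h2 : (k : ℝ) < m := by
      have := ht.1
      by_contra! hle
      nlinarith
    have h3 : (m : ℝ) < k + 1 := by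
      have := ht.2
      push_cast at this
      by_contra! hle
      nlinarith
    have h2' : (k : ℤ) < m := by exact_mod_cast h2
    have h3' : m < (k : ℤ) + 1 := by exact_mod_cast h3
    omega
  have h4 : n 4 = n 0 + 4 := by
    have h1 := hn 4
    have h2 := hn 0
    rw [show ((4 : ℕ) : ℝ) * (Real.pi / 2) = 2 * Real.pi by push_cast; ring, hθ4] at h1
    rw [show ((0 : ℕ) : ℝ) * (Real.pi / 2) = 0 by simp] at h2
    rw [h2] at h1
    have h3 : (n 4 : ℝ) * (Real.pi / 2) = (n 0 + 4) * (Real.pi / 2) := by linarith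
    exact_mod_cast mul_right_cancel₀ (by positivity) h3
  have h5 : ∀ k : ℕ, k ≤ 3 → n k = n 0 + k := fun k hk => by
    have a0 := hstep 0
    have a1 := hstep 1
    have a2 := hstep 2
    have a3 := hstep 3
    norm_num at a0 a1 a2 a3
    interval_cases k <;> push_cast <;> omega
  refine ⟨ρ, hρ, hball, n 0, fun k hk => ⟨‖h (ρ • unitVec (k * (Real.pi / 2)))‖, hne _, ?_⟩⟩
  conv_lhs => rw [hpolar]
  have h6 := hn k
  rw [h5 k hk] at h6
  push_cast at h6
  rw [h6]
  rfl

/-- A curve on the cross `x₁ x₂ = 0` that avoids the origin stays on one arm. -/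
theorem sign_const_of_cross {u : ℝ → Plane} {S : Set ℝ} (hS : IsPreconnected S)
    (hu : ContinuousOn u S) (hne : ∀ x ∈ S, u x ≠ 0) (hcross : ∀ x ∈ S, u x 0 * u x 1 = 0)
    {x y : ℝ} (hx : x ∈ S) (hy : y ∈ S) (i : Fin 2) :
    SignType.sign (u x i) = SignType.sign (u y i) := by
  refine hS.constant (f := fun t => SignType.sign (u t i)) (fun t ht => ?_) hx hy
  have hc : ∀ j, ContinuousWithinAt (fun s => u s j) S t := fun j =>
    (continuous_coord j).continuousAt.comp_continuousWithinAt (hu t ht)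
  by_cases hi : u t i = 0
  · refine tendsto_nhds_of_eventually_eq ?_
    have h1 := other_ne_zero hi (hne t ht)
    filter_upwards [(hc (1 - i)).eventually_ne h1, self_mem_nhdsWithin] with s hs hsS
    have h2 : u s i * u s (1 - i) = 0 := by
      have := hcross s hsS
      obtain rfl | rfl : i = 0 ∨ i = 1 := by omega
      · exact this
      · rw [mul_comm]
        exact this
    rw [(mul_eq_zero.1 h2).resolve_right hs, hi]
  · exact ContinuousAt.comp_continuousWithinAt (f := fun s => u s i)
      (continuousAt_sign_of_ne_zero hi) (hc i)

section Field

variable {r : ℕ} {U : BoundedNhd} {Z Z' : Omega r U} {e : Fin 2 → ℝ}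
  {τ τ' : Fin 2 → SignType → SignType} {G G' : Set Plane}

/-- The linear form that is positive on the escaping half axes and negative on the sliding ones. -/
def escapeForm (e : Fin 2 → ℝ) (p : Plane) : ℝ := e 1 * p 0 + e 0 * p 1

theorem escapeForm_eq (e : Fin 2 → ℝ) {p : Plane} {i : Fin 2} (h : p i = 0) :
    escapeForm e p = e i * p (1 - i) := by
  obtain rfl | rfl : i = 0 ∨ i = 1 := by omega
  · simp [escapeForm, h]
  · simp [escapeForm, h]

theorem exists_coord_eq_zero {p : Plane} (h : p 0 * p 1 = 0) : ∃ i, p i = 0 := by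
  rcases mul_eq_zero.1 h with h | h
  exacts [⟨0, h⟩, ⟨1, h⟩]

theorem coord_mul_eq (p : Plane) (i : Fin 2) : p 0 * p 1 = p i * p (1 - i) := by
  obtain rfl | rfl : i = 0 ∨ i = 1 := by omega
  · rfl
  · exact mul_comm _ _

theorem mul_pos_of_mul_pos {u x y : ℝ} (hx : 0 < u * x) (hy : 0 < u * y) : 0 < x * y := by
  have h1 : 0 < u ^ 2 * (x * y) := by
    have := mul_pos hx hy
    linarith
  exact pos_of_mul_pos_right h1 (sq_nonneg u)

theorem mul_neg_of_mul {u x y : ℝ} (hx : 0 < u * x) (hy : u * y < 0) : x * y < 0 := by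
  have := mul_pos_of_mul_pos (u := u) hx (y := -y) (by linarith)
  linarith

/-- Escaping points are not mapped to sliding points: a trajectory leaves an escaping point into
a quadrant, and no trajectory in a quadrant starts from a sliding point. -/
theorem escapeForm_nonneg_of_pos (hr : 1 ≤ r) (hG : IsRegularNhd Z e τ G)
    (hG' : IsRegularNhd Z' e τ' G') {h : OpenPartialHomeomorph Plane Plane}
    (hmap : MapsTrajectories Z Z' h)
    (hcross : ∀ p ∈ h.source, h p 0 * h p 1 = 0 ↔ p 0 * p 1 = 0) {N : Set Plane} (hN : IsOpen N)
    (hNs : N ⊆ h.source) (hNG : N ⊆ G) (hNG' : ∀ p ∈ N, h p ∈ G') {p : Plane} (hp : p ∈ N)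
    (hpc : p 0 * p 1 = 0) (hpos : 0 < escapeForm e p) : 0 ≤ escapeForm e (h p) := by
  by_contra! hneg
  obtain ⟨j, hj⟩ := exists_coord_eq_zero hpc
  obtain ⟨i, hi⟩ := exists_coord_eq_zero ((hcross p (hNs hp)).2 hpc)
  rw [escapeForm_eq e hj] at hpos
  rw [escapeForm_eq e hi] at hneg
  -- the trajectory of `X` through `p` enters a quadrant of `X` for positive time
  obtain ⟨γ, hγ0, ε, hε, hγ⟩ :=
    (evalField_contDiffAt hr Z.1 (hG.subset (hNG hp)))
      |>.exists_forall_mem_closedBall_exists_eq_forall_mem_Ioo_hasDerivAt₀ 0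
  rw [zero_sub, zero_add] at hγ
  have hγd := hγ 0 ⟨by linarith, hε⟩
  have hγc : ContinuousAt γ 0 := hγd.continuousAt
  have hhc : ContinuousAt (fun t => h (γ t)) 0 :=
    ContinuousAt.comp (f := γ) (by rw [hγ0]; exact h.continuousAt (hNs hp)) hγc
  have ev1 : ∀ᶠ t in 𝓝[>] (0 : ℝ), 0 < γ t 0 * γ t 1 := by
    have hd : HasDerivAt (fun t => γ t j * γ t (1 - j)) (fieldX Z p j * p (1 - j)) 0 := by
      have h1 := (hasDerivAt_plane.1 hγd j).mul (hasDerivAt_plane.1 hγd (1 - j))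
      rw [hγ0, hj, zero_mul, add_zero] at h1
      exact h1
    have h2 := hasDerivAt_iff_tendsto_slope.1 hd
    have h3 := (h2.mono_left (nhdsGT_le_nhdsNE 0)).eventually
      (lt_mem_nhds (mul_pos_of_mul_pos (hG.signX p (hNG hp) j) hpos))
    filter_upwards [h3, self_mem_nhdsWithin] with t ht ht0
    have h4 : slope (fun t => γ t j * γ t (1 - j)) 0 t = (γ t j * γ t (1 - j)) / t := by
      rw [slope_def_field, hγ0, hj, zero_mul, sub_zero, sub_zero]
    rw [h4] at ht
    rw [coord_mul_eq (γ t) j]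
    exact (div_pos_iff_of_pos_right ht0).1 ht
  have ev2 : ∀ᶠ t in 𝓝 (0 : ℝ), γ t ∈ N :=
    hγc.eventually_mem (by rw [hγ0]; exact hN.mem_nhds hp)
  have ev3 : ∀ᶠ t in 𝓝 (0 : ℝ), e i * h (γ t) (1 - i) < 0 := by
    have h1 : ContinuousAt (fun t => e i * h (γ t) (1 - i)) 0 :=
      ((continuous_coord (1 - i)).continuousAt.comp hhc).const_mul (e i)
    exact h1.tendsto.eventually (gt_mem_nhds (by rw [hγ0]; exact hneg))
  have hlim : Tendsto (fun t => h (γ t) i ^ 2) (𝓝[>] 0) (𝓝 0) := by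
    have h1 : ContinuousAt (fun t => h (γ t) i ^ 2) 0 :=
      ((continuous_coord i).continuousAt.comp hhc).pow 2
    have h2 := h1.tendsto
    rw [hγ0, hi, zero_pow two_ne_zero] at h2
    exact h2.mono_left nhdsWithin_le_nhds
  obtain ⟨ε', hε', hall⟩ := mem_nhdsGT_iff_exists_Ioo_subset.1
    (ev1.and (mem_nhdsWithin_of_mem_nhds
      ((ev2.and ev3).and (Ioo_mem_nhds (neg_lt_zero.2 hε) hε))))
  have hε'0 : 0 < ε' := hε'
  have htraj : IsTrajectory Z (Ioo 0 ε') γ := by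
    have hne : ∀ t ∈ Ioo 0 ε', ∀ k, γ t k ≠ 0 := fun t ht k hk =>
      (hall ht).1.ne' (mul_eq_zero_of_coord hk)
    refine hG.isTrajectory isOpen_Ioo ordConnected_Ioo
      (HasDerivAt.continuousOn fun t ht => hγ t (hall ht).2.2)
      (fun t ht => hNG (hall ht).2.1.1) (fun t ht _ => hγ t (hall ht).2.2)
      (fun t ht h => absurd h (hall ht).1.not_gt) (fun t ht k hk => absurd hk (hne t ht k))
      (fun t ht h0 => absurd (by rw [h0]; rfl) (hne t ht 0))
  obtain ⟨J, σ, hσ, hσJ, htraj'⟩ := hmap _ γ htraj fun t ht => hNs (hall ht).2.1.1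
  have hσm : ∀ s ∈ J, σ s ∈ Ioo 0 ε' := fun s hs => hσJ ▸ mem_image_of_mem σ hs
  -- on its image, the distance to the axis through `h p` decreases, although it tends to `0` at the
  -- initial time
  have hder : ∀ s ∈ J, ∃ D, HasDerivAt (fun s => h (γ (σ s)) i) D s ∧ h (γ (σ s)) i * D < 0 := by
    intro s hs
    have hm := hall (hσm s hs)
    have hq := hNG' _ hm.2.1.1
    have hc : h (γ (σ s)) 0 * h (γ (σ s)) 1 ≠ 0 := fun h0 =>
      hm.1.ne' ((hcross _ (hNs hm.2.1.1)).1 h0)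
    have hneg' := hm.2.1.2
    rw [coord_mul_eq _ i] at hc
    rcases lt_or_gt_of_ne hc with hlt | hgt
    · have hd := htraj'.followY s hs (by rw [coord_mul_eq _ i]; exact hlt)
      refine ⟨_, hasDerivAt_plane.1 hd i, ?_⟩
      have h1 := hG'.signY _ hq i
      have h2 : 0 < e i * h (γ (σ s)) i := by
        by_contra! hle
        rcases hle.lt_or_eq with h3 | h3
        · have := mul_pos_of_mul_pos (u := -e i) (x := h (γ (σ s)) i)
            (y := h (γ (σ s)) (1 - i)) (by linarith) (by linarith)
          linarith
        · rcases mul_eq_zero.1 h3 with h4 | h4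
          · rw [h4] at hneg'
            simp at hneg'
          · exact hc (by rw [h4, zero_mul])
      exact mul_neg_of_mul h2 (by linarith)
    · have hd := htraj'.followX s hs (by rw [coord_mul_eq _ i]; exact hgt)
      refine ⟨_, hasDerivAt_plane.1 hd i, ?_⟩
      have h1 := hG'.signX _ hq i
      have h2 : e i * h (γ (σ s)) i < 0 := by
        by_contra! hle
        rcases hle.lt_or_eq with h3 | h3
        · have := mul_neg_of_mul h3 hneg'
          linarith
        · rcases mul_eq_zero.1 h3.symm with h4 | h4
          · rw [h4] at hneg'
            simp at hneg'
          · exact hc (by rw [h4, zero_mul])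
      rw [mul_comm]
      exact mul_neg_of_mul h1 h2
  choose! D hD hDneg using hder
  have hanti : StrictMonoOn (fun s => -(h (γ (σ s)) i ^ 2)) J := by
    refine strictMonoOn_of_hasDerivAt_pos htraj'.isOpen htraj'.ordConnected
      (q' := fun s => -(2 * (h (γ (σ s)) i * D s))) (fun s hs => ?_) fun s hs => ?_
    · refine (((hD s hs).pow 2).neg).congr_deriv ?_
      push_cast
      ring
    · have := hDneg s hs
      linarith
  have hmid : ε' / 2 ∈ Ioo 0 ε' := ⟨by linarith, by linarith⟩
  obtain ⟨s₂, hs₂, hs₂t⟩ := hσJ.symm ▸ hmid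
  have hκ : 0 < h (γ (ε' / 2)) i ^ 2 := by
    refine sq_pos_iff.2 fun h0 => ?_
    have hm := hall hmid
    exact hm.1.ne' ((hcross _ (hNs hm.2.1.1)).1 (mul_eq_zero_of_coord h0))
  have hev := hlim.eventually (gt_mem_nhds hκ)
  obtain ⟨t₁, ht₁, ht₁'⟩ := (hev.and (Ioo_mem_nhdsGT hmid.1)).exists
  have ht₁I : t₁ ∈ Ioo 0 ε' := ⟨ht₁'.1, ht₁'.2.trans hmid.2⟩
  obtain ⟨s₁, hs₁, hs₁t⟩ := hσJ.symm ▸ ht₁I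
  have hs : s₁ < s₂ := by
    rw [← hσ.lt_iff_lt hs₁ hs₂, hs₁t, hs₂t]
    exact ht₁'.2
  have := hanti hs₁ hs₂ hs
  simp only [hs₁t, hs₂t] at this
  linarith

end Field

/-- A rotation by a multiple of a right angle that maps the two half axes where a linear form with
coefficients `±1` is positive to such half axes is the identity. -/
theorem rotation_eq_one {a b : ℝ} (ha : a = 1 ∨ a = -1) (hb : b = 1 ∨ b = -1) {c s : ℝ}
    (hcs : c * s = 0) (h0 : 0 < b → 0 < b * c + a * s) (h1 : 0 < a → 0 < b * -s + a * c)
    (h2 : b < 0 → 0 < b * -c + a * -s) (h3 : a < 0 → 0 < b * s + a * -c) : 0 < c ∧ s = 0 := by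
  have hc : 0 < c := by
    rcases ha with rfl | rfl <;> rcases hb with rfl | rfl <;> norm_num at h0 h1 h2 h3 <;> linarith
  exact ⟨hc, (mul_eq_zero.1 hcs).resolve_left hc.ne'⟩

section Field

variable {r : ℕ} {U : BoundedNhd} {Z Z' : Omega r U} {e : Fin 2 → ℝ}
  {τ τ' : Fin 2 → SignType → SignType} {G G' : Set Plane}

theorem axisPt_one (x : ℝ) : axisPt 1 x = pt x 0 :=
  plane_ext (axisPt_other 1 x |>.trans (pt_zero x 0).symm)
    ((axisPt_self 1 x).trans (pt_one x 0).symm)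

/-- An equivalence that maps the `x₁`-axis to itself in an increasing way preserves the directions
of sliding on its two halves. -/
theorem slide_eq_of_increasing (hτ : ∀ i σ, σ ≠ 0 → τ i σ ≠ 0) (hτ' : ∀ i σ, σ ≠ 0 → τ' i σ ≠ 0)
    (hG : IsRegularNhd Z e τ G) (hG' : IsRegularNhd Z' e τ' G')
    {h : OpenPartialHomeomorph Plane Plane} (hmap : MapsTrajectories Z Z' h) {ε : ℝ} (hε : 0 < ε)
    (hN : ∀ x ∈ Ioo (-ε) ε, axisPt 1 x ∈ h.source ∧ axisPt 1 x ∈ G ∧ h (axisPt 1 x) ∈ G')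
    (hax : ∀ x ∈ Ioo (-ε) ε, h (axisPt 1 x) 1 = 0)
    (hsign : ∀ x ∈ Ioo (-ε) ε, SignType.sign (h (axisPt 1 x) 0) = SignType.sign x)
    (hmono : StrictMonoOn (fun x => h (axisPt 1 x) 0) (Ioo (-ε) ε)) {ς : SignType} (hς : ς ≠ 0) :
    τ 1 ς = τ' 1 ς := by
  have hτ0 := hτ 1 ς hς
  have hτ0' := hτ' 1 ς hς
  have he := sign_cast_of_ne_zero hτ0
  have he' := sign_cast_of_ne_zero hτ0'
  -- the given half of the axis, parametrized by `t ↦ τ t` so that its sliding direction is that of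
  -- increasing `t`
  set I : Set ℝ := (fun t => (τ 1 ς : ℝ) * t) ⁻¹' {x | x ∈ Ioo (-ε) ε ∧ SignType.sign x = ς}
    with hI
  have hset : IsOpen {x : ℝ | x ∈ Ioo (-ε) ε ∧ SignType.sign x = ς} ∧
      {x : ℝ | x ∈ Ioo (-ε) ε ∧ SignType.sign x = ς}.OrdConnected ∧
      {x : ℝ | x ∈ Ioo (-ε) ε ∧ SignType.sign x = ς}.Nonempty := by
    cases ς
    · exact absurd rfl hς
    · have : {x : ℝ | x ∈ Ioo (-ε) ε ∧ SignType.sign x = SignType.neg} = Ioo (-ε) 0 := by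
        ext x
        simp only [mem_ofPred_eq, mem_Ioo, SignType.neg_eq_neg_one, sign_eq_neg_one_iff]
        constructor
        · rintro ⟨⟨h1, h2⟩, h3⟩
          exact ⟨h1, h3⟩
        · rintro ⟨h1, h2⟩
          exact ⟨⟨h1, by linarith⟩, h2⟩
      rw [this]
      exact ⟨isOpen_Ioo, ordConnected_Ioo, -ε / 2, by linarith, by linarith⟩
    · have : {x : ℝ | x ∈ Ioo (-ε) ε ∧ SignType.sign x = SignType.pos} = Ioo 0 ε := by
        ext x
        simp only [mem_ofPred_eq, mem_Ioo, SignType.pos_eq_one, sign_eq_one_iff]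
        constructor
        · rintro ⟨⟨h1, h2⟩, h3⟩
          exact ⟨h3, h2⟩
        · rintro ⟨h1, h2⟩
          exact ⟨⟨by linarith, h2⟩, h1⟩
      rw [this]
      exact ⟨isOpen_Ioo, ordConnected_Ioo, ε / 2, by linarith, by linarith⟩
  have hee : ∀ x : ℝ, (τ 1 ς : ℝ) * ((τ 1 ς : ℝ) * x) = x := fun x => by
    rcases he with h | h <;> rw [h] <;> ring
  have hIo : IsOpen I := hset.1.preimage (continuous_const.mul continuous_id)
  have hIc : I.OrdConnected := by
    rcases he with h | h
    · rw [hI, h]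
      simpa using hset.2.1
    · rw [hI, h]
      exact hset.2.1.preimage_anti fun x y hxy => by linarith
  obtain ⟨x₀, hx₀⟩ := hset.2.2
  have hx₀I : (τ 1 ς : ℝ) * x₀ ∈ I := by
    simp only [hI, mem_preimage, hee]
    exact hx₀
  have hFc : ContinuousOn (fun x => slidingField Z 1 (axisPt 1 x) 0)
      ((fun t => (τ 1 ς : ℝ) * t) '' I) :=
    (continuous_coord 0).comp_continuousOn ((continuousOn_slidingField hG 1).comp
      (continuous_axisPt 1).continuousOn (by
        rintro _ ⟨t, ht, rfl⟩
        exact (hN _ ht.1).2.1))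
  have hFpos : ∀ t ∈ I, 0 < (τ 1 ς : ℝ) * slidingField Z 1 (axisPt 1 ((τ 1 ς : ℝ) * t)) 0 := by
    intro t ht
    refine pos_of_sign_eq hτ0 ?_
    have h1 := hG.slide _ (hN _ ht.1).2.1 1 (axisPt_self 1 _)
    rw [axisPt_other, ht.2] at h1
    exact h1
  obtain ⟨J, σ, hJo, hJc, hσ, hσJ, hσc, hσd⟩ := exists_reparametrization he hIo hIc
    (q := fun t => (τ 1 ς : ℝ) * t) (continuousOn_const.mul continuousOn_id)
    (fun s _ t _ hst => by simpa only [hee] using hst) hFc hFpos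
  have hσm : ∀ s ∈ J, σ s ∈ I := fun s hs => hσJ ▸ mem_image_of_mem σ hs
  have htraj : IsTrajectory Z J fun s => axisPt 1 ((τ 1 ς : ℝ) * σ s) := by
    have hne : ∀ s ∈ J, axisPt 1 ((τ 1 ς : ℝ) * σ s) 0 ≠ 0 := fun s hs h => hς (by
      have h1 : (τ 1 ς : ℝ) * σ s = 0 := (axisPt_other 1 _).symm.trans h
      exact (hσm s hs).2.symm.trans ((congrArg _ h1).trans sign_zero))
    have hz : ∀ s, axisPt 1 ((τ 1 ς : ℝ) * σ s) 0 * axisPt 1 ((τ 1 ς : ℝ) * σ s) 1 = 0 :=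
      fun s => mul_eq_zero_of_coord (axisPt_self 1 _)
    refine hG.isTrajectory hJo hJc ((continuous_axisPt 1).comp_continuousOn
      (continuousOn_const.mul hσc)) (fun s hs => (hN _ (hσm s hs).1).2.1)
      (fun s _ h => absurd (hz s) h.ne') (fun s _ h => absurd (hz s) h.ne)
      (fun s hs i hi _ => ?_) fun s hs h => absurd (by rw [h]; rfl) (hne s hs)
    obtain rfl | rfl : i = 0 ∨ i = 1 := by omega
    · exact absurd hi (hne s hs)
    · refine ⟨hasDerivAt_plane' 1 ?_ ?_, fun s' _ => axisPt_self 1 _⟩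
      · rw [slidingField_self]
        simp only [axisPt_self]
        exact hasDerivAt_const s 0
      · simp only [axisPt_other]
        exact hσd s hs
  obtain ⟨J', σ', hσ', hσJ', htraj'⟩ := hmap J _ htraj fun s hs => (hN _ (hσm s hs).1).1
  have hσm' : ∀ s ∈ J', σ' s ∈ J := fun s hs => hσJ' ▸ mem_image_of_mem σ' hs
  obtain ⟨t₀, ht₀, -⟩ := hσJ.symm ▸ hx₀I
  obtain ⟨s₀, hs₀, -⟩ := hσJ'.symm ▸ ht₀
  obtain ⟨u, w, hw, hws⟩ := mem_nhds_iff_exists_Ioo_subset.1 (htraj'.isOpen.mem_nhds hs₀)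
  obtain ⟨s₁, hs₁a, hs₁b⟩ := exists_between hw.2
  have hs₁ : s₁ ∈ J' := hws ⟨hw.1.trans hs₁a, hs₁b⟩
  have hsl : ∀ s ∈ J', HasDerivAt (fun s => h (axisPt 1 ((τ 1 ς : ℝ) * σ (σ' s))) 0)
      (slidingField Z' 1 (h (axisPt 1 ((τ 1 ς : ℝ) * σ (σ' s)))) 0) s ∧
      SignType.sign (slidingField Z' 1 (h (axisPt 1 ((τ 1 ς : ℝ) * σ (σ' s)))) 0) = τ' 1 ς := by
    intro s hs
    have hx := hσm _ (hσm' s hs)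
    have h1 := hax _ hx.1
    have h2 := (hsign _ hx.1).trans hx.2
    have h3 : h (axisPt 1 ((τ 1 ς : ℝ) * σ (σ' s))) ≠ 0 := fun h0 => hς (by
      rw [← h2, h0]
      exact sign_zero)
    have h4 := htraj'.slide s hs 1 (hG'.mem_slideEsc (hN _ hx.1).2.2 h1 h3)
    have h5 := hG'.slide _ (hN _ hx.1).2.2 1 h1
    refine ⟨hasDerivAt_plane.1 h4.1 0, h5.trans (congrArg _ h2)⟩
  -- two times on the image trajectory show whether it runs outwards or inwards
  have hm' := strictMonoOn_of_hasDerivAt_pos htraj'.isOpen htraj'.ordConnected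
    (fun s hs => ((hsl s hs).1.const_mul (τ' 1 ς : ℝ))) fun s hs => pos_of_sign_eq hτ0' (hsl s hs).2
  have k1 := hm' hs₀ hs₁ hs₁a
  have k2 := hσ (hσm' _ hs₀) (hσm' _ hs₁) (hσ' hs₀ hs₁ hs₁a)
  have k3 := (hσm _ (hσm' _ hs₀)).1
  have k4 := (hσm _ (hσm' _ hs₁)).1
  have hcast : (τ 1 ς : ℝ) = τ' 1 ς → τ 1 ς = τ' 1 ς := fun h => by
    generalize τ 1 ς = x at h
    generalize τ' 1 ς = y at h
    cases x <;> cases y <;> simp at h ⊢ <;> norm_num at h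
  rcases he with h1 | h1 <;> rcases he' with h2 | h2
  · exact hcast (h1.trans h2.symm)
  · simp only [h1, one_mul] at k3 k4
    have := hmono k3 k4 k2
    simp only [h1, h2] at k1
    simp only [one_mul] at k1
    linarith
  · simp only [h1] at k3 k4
    have := hmono k4 k3 (by linarith)
    simp only [h1, h2] at k1
    linarith
  · exact hcast (h1.trans h2.symm)

/-- Near a double pseudo-equilibrium, the sign of `det Z` at the origin is an invariant of local
`Σ`-equivalence. -/
theorem HasSigns.sign_det_eq (hr : 1 ≤ r) {c : Fin 2 → ℝ} (he : ∀ i, e i = 1 ∨ e i = -1)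
    (hZ : HasSigns Z e c) (hZ' : HasSigns Z' e c) (heq : LocallySigmaEquivalent Z Z') :
    SignType.sign (detZ Z 0) = SignType.sign (detZ Z' 0) := by
  obtain ⟨h, hsrc, htgt, -, h00, h0, ho, hsw, hmap, -⟩ := heq
  obtain ⟨G, -, -, hG, -⟩ := hZ.exists_regularNhd hr he
  obtain ⟨G', -, -, hG', -⟩ := hZ'.exists_regularNhd hr he
  have hcross : ∀ p ∈ h.source, h p 0 * h p 1 = 0 ↔ p 0 * p 1 = 0 := fun p hp =>
    ⟨fun h1 => ((hsw p hp).1 ⟨htgt (h.map_source hp), h1⟩).2,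
      fun h1 => ((hsw p hp).2 ⟨hsrc hp, h1⟩).2⟩
  have hNn : h.source ∩ G ∩ h ⁻¹' G' ∈ 𝓝 (0 : Plane) :=
    inter_mem (inter_mem (h.open_source.mem_nhds h00) hG.mem_nhds)
      ((h.continuousAt h00).preimage_mem_nhds (by rw [h0]; exact hG'.mem_nhds))
  obtain ⟨ε, hε, hball⟩ := Metric.mem_nhds_iff.1 hNn
  obtain ⟨ρ, hρ, hρs, n, hrot⟩ := ho.exists_rotation h00 h0 hcross
  have hun : ∀ t, ‖unitVec t‖ = 1 := fun t => by
    rw [EuclideanSpace.norm_eq, Fin.sum_univ_two]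
    simp [unitVec]
  have hcr : ∀ k : ℕ, unitVec (k * (Real.pi / 2)) 0 * unitVec (k * (Real.pi / 2)) 1 = 0 := fun k => by
    rw [← sin_two_mul_eq_zero_iff, show 2 * (k * (Real.pi / 2)) = k * Real.pi by ring,
      Real.sin_nat_mul_pi]
  have hxsrc : ∀ x ∈ Ioc 0 ρ, ∀ t, x • unitVec t ∈ h.source := fun x hx t => hρs (by
    rw [mem_closedBall_zero_iff, norm_smul, hun, mul_one, Real.norm_of_nonneg hx.1.le]
    exact hx.2)
  have hxcr : ∀ (x : ℝ) (k : ℕ), (x • unitVec (k * (Real.pi / 2))) 0 *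
      (x • unitVec (k * (Real.pi / 2))) 1 = 0 := fun x k => by
    simp only [PiLp.smul_apply, smul_eq_mul]
    linear_combination x ^ 2 * hcr k
  -- the arm at the angle `k π / 2` is mapped to the one at the angle `(n + k) π / 2`
  have harm : ∀ k : ℕ, k ≤ 3 → ∀ x ∈ Ioc 0 ρ, ∀ i,
      SignType.sign (h (x • unitVec (k * (Real.pi / 2))) i) =
        SignType.sign (unitVec ((n + k) * (Real.pi / 2)) i) := by
    intro k hk x hx i
    obtain ⟨R, hR, hRk⟩ := hrot k hk
    have h1 := sign_const_of_cross (u := fun x => h (x • unitVec (k * (Real.pi / 2))))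
      (S := Ioc 0 ρ) isPreconnected_Ioc
      (h.continuousOn.comp (continuous_id.smul continuous_const).continuousOn fun y hy =>
        hxsrc y hy _)
      (fun y hy hy0 => by
        have h2 := h.injOn (hxsrc y hy _) h00 (hy0.trans h0.symm)
        rcases smul_eq_zero.1 h2 with h3 | h3
        · exact hy.1.ne' h3
        · have := hun (k * (Real.pi / 2))
          rw [h3, norm_zero] at this
          exact zero_ne_one this)
      (fun y hy => (hcross _ (hxsrc y hy _)).2 (hxcr y k)) hx ⟨hρ, le_rfl⟩ i
    simp only at h1
    rw [h1, hRk, PiLp.smul_apply, smul_eq_mul, sign_mul, sign_pos hR, one_mul]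
  set x₀ := min ρ (ε / 2) with hx₀
  have hx₀I : x₀ ∈ Ioc 0 ρ := ⟨lt_min hρ (by linarith), min_le_left _ _⟩
  have hesc : ∀ k : ℕ, k ≤ 3 → 0 < escapeForm e (unitVec (k * (Real.pi / 2))) →
      0 < escapeForm e (unitVec ((n + k) * (Real.pi / 2))) := by
    intro k hk hpos
    have hb : x₀ • unitVec (k * (Real.pi / 2)) ∈ Metric.ball (0 : Plane) ε := by
      rw [mem_ball_zero_iff, norm_smul, hun, mul_one, Real.norm_of_nonneg hx₀I.1.le]
      exact (min_le_right _ _).trans_lt (by linarith)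
    have h1 := escapeForm_nonneg_of_pos hr hG hG' hmap hcross Metric.isOpen_ball
      (fun p hp => (hball hp).1.1) (fun p hp => (hball hp).1.2) (fun p hp => (hball hp).2) hb
      (hxcr x₀ k) (by
        have : escapeForm e (x₀ • unitVec (k * (Real.pi / 2))) =
            x₀ * escapeForm e (unitVec (k * (Real.pi / 2))) := by
          simp only [escapeForm, PiLp.smul_apply, smul_eq_mul]
          ring
        rw [this]
        exact mul_pos hx₀I.1 hpos)
    have h2 := harm k hk x₀ hx₀I
    obtain ⟨i, hi⟩ := exists_coord_eq_zero ((hcross _ (hxsrc x₀ hx₀I _)).2 (hxcr x₀ k))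
    have hwi : unitVec ((n + k) * (Real.pi / 2)) i = 0 := by
      rw [← sign_eq_zero_iff, ← h2, hi, sign_zero]
    have hw : unitVec ((n + k) * (Real.pi / 2)) ≠ 0 := fun h3 => by
      have := hun ((n + k) * (Real.pi / 2))
      rw [h3, norm_zero] at this
      exact zero_ne_one this
    rw [escapeForm_eq e hi] at h1
    rw [escapeForm_eq e hwi]
    have h3 : SignType.sign (e i * unitVec ((n + k) * (Real.pi / 2)) (1 - i)) =
        SignType.sign (e i * h (x₀ • unitVec (k * (Real.pi / 2))) (1 - i)) := by
      rw [sign_mul, sign_mul, h2]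
    refine lt_of_le_of_ne (sign_nonneg_iff.1 (h3 ▸ sign_nonneg_iff.2 h1)) ?_
    exact (mul_ne_zero (hZ.ne_zero.1 i) (other_ne_zero hwi hw)).symm
  have hcs : Real.cos (n * (Real.pi / 2)) * Real.sin (n * (Real.pi / 2)) = 0 := by
    have h1 : Real.sin (2 * (n * (Real.pi / 2))) = 0 := by
      rw [show 2 * (n * (Real.pi / 2)) = n * Real.pi by ring, Real.sin_int_mul_pi]
    rw [Real.sin_two_mul] at h1
    linarith
  have v0 := hesc 0 (by norm_num)
  have v1 := hesc 1 (by norm_num)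
  have v2 := hesc 2 (by norm_num)
  have v3 := hesc 3 (by norm_num)
  have e0 : ((0 : ℕ) : ℝ) * (Real.pi / 2) = 0 := by simp
  have e1 : ((1 : ℕ) : ℝ) * (Real.pi / 2) = Real.pi / 2 := by simp
  have e2 : ((2 : ℕ) : ℝ) * (Real.pi / 2) = Real.pi := by push_cast; ring
  have e3 : ((3 : ℕ) : ℝ) * (Real.pi / 2) = Real.pi + Real.pi / 2 := by push_cast; ring
  simp only [add_mul, e0, e1, e2, e3] at v0 v1 v2 v3
  simp only [← add_assoc] at v3
  simp only [escapeForm, unitVec, pt_zero, pt_one, add_zero, Real.cos_zero, Real.sin_zero,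
    Real.cos_pi, Real.sin_pi, Real.cos_pi_div_two, Real.sin_pi_div_two, Real.cos_add_pi,
    Real.sin_add_pi, Real.cos_add_pi_div_two, Real.sin_add_pi_div_two, mul_one, mul_zero,
    zero_add, mul_neg, neg_zero, neg_neg] at v0 v1 v2 v3
  obtain ⟨hc, hs⟩ := rotation_eq_one (he 0) (he 1) hcs v0 (fun h => by simpa using v1 h)
    (fun h => by simpa using v2 (by linarith)) (fun h => by simpa using v3 (by linarith))
  -- the rotation is trivial, so each half of the `x₁`-axis is mapped to itself
  set ε₁ := min ρ ε with hε₁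
  have hε₁0 : 0 < ε₁ := lt_min hρ hε
  have hbase : ∀ x ∈ Ioo (-ε₁) ε₁, h (axisPt 1 x) 1 = 0 ∧
      SignType.sign (h (axisPt 1 x) 0) = SignType.sign x := by
    intro x hx
    rcases lt_trichotomy x 0 with hx0 | rfl | hx0
    · have hv : axisPt 1 x = (-x) • unitVec ((2 : ℕ) * (Real.pi / 2)) := by
        rw [axisPt_one, e2]
        exact plane_ext (by simp [unitVec]) (by simp [unitVec])
      have hxI : -x ∈ Ioc 0 ρ := ⟨by linarith, by
        have := hx.1
        have := min_le_left ρ ε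
        linarith⟩
      have h1 := harm 2 (by norm_num) _ hxI 0
      have h2 := harm 2 (by norm_num) _ hxI 1
      rw [← hv, add_mul, e2, unitVec] at h1 h2
      rw [pt_zero, Real.cos_add_pi, sign_neg (neg_lt_zero.2 hc)] at h1
      rw [pt_one, Real.sin_add_pi, hs, neg_zero, sign_zero] at h2
      exact ⟨sign_eq_zero_iff.1 h2, by rw [h1, sign_neg hx0]⟩
    · rw [axisPt_zero, h0]
      exact ⟨rfl, rfl⟩
    · have hv : axisPt 1 x = x • unitVec ((0 : ℕ) * (Real.pi / 2)) := by
        rw [axisPt_one, e0]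
        exact plane_ext (by simp [unitVec]) (by simp [unitVec])
      have hxI : x ∈ Ioc 0 ρ := ⟨hx0, hx.2.le.trans (min_le_left _ _)⟩
      have h1 := harm 0 (by norm_num) _ hxI 0
      have h2 := harm 0 (by norm_num) _ hxI 1
      rw [← hv, add_mul, e0, add_zero, unitVec] at h1 h2
      rw [pt_zero, sign_pos hc] at h1
      rw [pt_one, hs, sign_zero] at h2
      exact ⟨sign_eq_zero_iff.1 h2, by rw [h1, sign_pos hx0]⟩
  have hNx : ∀ x ∈ Ioo (-ε₁) ε₁, axisPt 1 x ∈ h.source ∩ G ∩ h ⁻¹' G' := fun x hx => hball (by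
    rw [mem_ball_zero_iff, axisPt, PiLp.norm_single, Real.norm_eq_abs, abs_lt]
    have := min_le_right ρ ε
    exact ⟨by linarith [hx.1], by linarith [hx.2]⟩)
  have hmono : StrictMonoOn (fun x => h (axisPt 1 x) 0) (Ioo (-ε₁) ε₁) := by
    have hcont : ContinuousOn (fun x => h (axisPt 1 x) 0) (Ioo (-ε₁) ε₁) :=
      (continuous_coord 0).comp_continuousOn (h.continuousOn.comp
        (continuous_axisPt 1).continuousOn fun x hx => (hNx x hx).1.1)
    have hinj : InjOn (fun x => h (axisPt 1 x) 0) (Ioo (-ε₁) ε₁) := fun x hx y hy hxy => by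
      have h1 := h.injOn (hNx x hx).1.1 (hNx y hy).1.1
        (plane_ext hxy ((hbase x hx).1.trans (hbase y hy).1.symm))
      have h2 := congrArg (fun p : Plane => p (1 - 1)) h1
      simpa only [axisPt_other] using h2
    refine (hcont.strictMonoOn_of_injOn_Ioo (by linarith) hinj).resolve_right fun hanti => ?_
    have m0 : (0 : ℝ) ∈ Ioo (-ε₁) ε₁ := ⟨by linarith, hε₁0⟩
    have m1 : ε₁ / 2 ∈ Ioo (-ε₁) ε₁ := ⟨by linarith, by linarith⟩
    have h1 := hanti m0 m1 (by linarith)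
    have h2 := (hbase _ m1).2
    rw [sign_pos (by linarith : 0 < ε₁ / 2), sign_eq_one_iff] at h2
    simp only [axisPt_zero, h0] at h1
    exact h1.not_gt h2
  have key : ∀ ς : SignType, ς ≠ 0 → slideDir e c (SignType.sign (detZ Z 0)) 1 ς =
      slideDir e c (SignType.sign (detZ Z' 0)) 1 ς := fun ς hς =>
    slide_eq_of_increasing (fun i σ hσ => slideDir_ne_zero hZ.ne_zero.1 hZ.ne_zero.2 _ i hσ)
      (fun i σ hσ => slideDir_ne_zero hZ.ne_zero.1 hZ.ne_zero.2 _ i hσ) hG hG' hmap hε₁0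
      (fun x hx => ⟨(hNx x hx).1.1, (hNx x hx).1.2, (hNx x hx).2⟩) (fun x hx => (hbase x hx).1)
      (fun x hx => (hbase x hx).2) hmono hς
  have k1 := key 1 (by decide)
  have k2 := key (-1) (by decide)
  have he1 : SignType.sign (e 1) ≠ 0 := fun h => hZ.ne_zero.1 1 (sign_eq_zero_iff.1 h)
  have hc0 : SignType.sign (c (1 - 1)) ≠ 0 := fun h => hZ.ne_zero.2 _ (sign_eq_zero_iff.1 h)
  simp only [slideDir, one_ne_zero, if_false] at k1 k2
  generalize SignType.sign (detZ Z 0) = d at k1 k2 ⊢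
  generalize SignType.sign (detZ Z' 0) = d' at k1 k2 ⊢
  generalize SignType.sign (e 1) = a at k1 k2 he1
  generalize SignType.sign (c (1 - 1)) = b at k1 k2 hc0
  revert a b d d'
  decide

end Field

/-! ### Unfoldings -/

section Field

variable {r : ℕ} {U : BoundedNhd}

/-- The constant vector field `v`. -/
def constField (r : ℕ) (U : BoundedNhd) (v : Plane) : VectorField r U :=
  VectorField.ofContDiff U (fun _ => v) contDiff_const

theorem evalField_add_smul_constField (V : VectorField r U) (s : ℝ) (v : Plane) :
    evalField (V + s • constField r U v) 0 = evalField V 0 + s • v := by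
  have h := evalField_ofContDiff (r := r) U (fun _ => v) contDiff_const (zero_mem_closure U)
  rw [evalField_apply_zero] at h
  rw [evalField_apply_zero, evalField_apply_zero, ← h]
  rfl

theorem contDiff_affine {E : Type*} [NormedAddCommGroup E] [NormedSpace ℝ E] (Z W : E) :
    ContDiff ℝ ∞ fun α : Fin 1 → ℝ => Z + α 0 • W :=
  contDiff_const.add ((contDiff_apply ℝ ℝ (0 : Fin 1)).smul contDiff_const)

theorem isUnfolding_affine (Z W : Omega r U) :
    IsUnfolding Z fun α : Fin 1 → ℝ => Z + α 0 • W :=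
  ⟨le_rfl, by simp, 1, one_pos, (contDiff_affine Z W).contDiffOn⟩

theorem IsUnfolding.exists_continuousOn {m : ℕ} {Z : Omega r U} {γ : (Fin m → ℝ) → Omega r U}
    (h : IsUnfolding Z γ) : ∃ N ∈ 𝓝 (0 : Fin m → ℝ), ContinuousOn γ N := by
  obtain ⟨-, -, δ₀, hδ₀, hγ⟩ := h
  refine ⟨_, ?_, hγ.continuousOn⟩
  have h1 : ∀ i : Fin m, ∀ᶠ δ : Fin m → ℝ in 𝓝 0, δ i ∈ Ioo (-δ₀) δ₀ := fun i =>
    (continuous_apply i).continuousAt.eventually_mem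
      (Ioo_mem_nhds (by simpa using hδ₀) (by simpa using hδ₀))
  exact eventually_all.2 h1

theorem IsUnfolding.tendsto {m : ℕ} {Z : Omega r U} {γ : (Fin m → ℝ) → Omega r U}
    (h : IsUnfolding Z γ) : Tendsto γ (𝓝 0) (𝓝 Z) := by
  obtain ⟨N, hN, hγ⟩ := h.exists_continuousOn
  have h1 := (hγ.continuousAt hN).tendsto
  rwa [h.2.1] at h1

/-- If the sign of `det Z (0)` along a one-parameter unfolding of a double pseudo-equilibrium is that
of the parameter, up to a factor `±1`, then the unfolding is versal: an unfolding `γ'` is induced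
from it by the function `± det (γ' α) (0)`. -/
theorem isVersalUnfolding_of_sign (hr : 1 ≤ r) {Z : Omega r U} {e c : Fin 2 → ℝ}
    (he : ∀ i, e i = 1 ∨ e i = -1) (hZ : HasSigns Z e c) (h0 : detZ Z 0 = 0)
    {γ : (Fin 1 → ℝ) → Omega r U} (hγ : IsUnfolding Z γ) {s : SignType} (hs : s ≠ 0)
    (hsign : ∀ᶠ δ : ℝ in 𝓝 0,
      SignType.sign (detZ (γ fun _ => δ) 0) = s * SignType.sign δ) : IsVersalUnfolding Z γ := by
  refine ⟨hγ, fun m' γ' hγ' => ?_⟩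
  obtain ⟨N, hN, hγ'c⟩ := hγ'.exists_continuousOn
  set ν : (Fin m' → ℝ) → ℝ := fun α => (s : ℝ) * detZ (γ' α) 0 with hν
  have hν0 : Tendsto ν (𝓝 0) (𝓝 0) := by
    have h1 := ((continuous_detZ_zero.tendsto Z).comp hγ'.tendsto).const_mul (s : ℝ)
    rw [h0, mul_zero] at h1
    exact h1
  have hμ0 : Tendsto (fun α (_ : Fin 1) => ν α) (𝓝 0) (𝓝 0) := tendsto_pi_nhds.2 fun _ => hν0
  have ev1 := hγ'.tendsto.eventually (hZ.eventually hr)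
  have ev2 := (hγ.tendsto.comp hμ0).eventually (hZ.eventually hr)
  have ev3 := hν0.eventually hsign
  refine ⟨_, inter_mem hN (ev1.and (ev2.and ev3)), fun α _ => ν α, ?_, ?_, fun α hα => ?_⟩
  · exact continuousOn_pi.2 fun _ => ((continuous_detZ_zero.comp_continuousOn hγ'c).const_mul
      (s : ℝ)).mono inter_subset_left
  · funext i
    simp [hν, hγ'.2.1, h0]
  · obtain ⟨-, h1, h2, h3⟩ := hα
    refine h1.locallySigmaEquivalent hr he h2 (Eq.symm (h3.trans ?_))
    have h4 : ∀ s d : SignType, s ≠ 0 → s * (s * d) = d := by decide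
    have h5 : SignType.sign (s : ℝ) = s := by cases s <;> simp
    simp only [hν]
    rw [sign_mul, h5, h4 s _ hs]

/-- The positive case of `exists_sign_of_comp`: for `ν` to be onto a neighbourhood of `0`, it suffices
that `ν` has opposite signs at `± η / 2`, and equal signs would give `D` both signs at one point. -/
theorem exists_sign_of_comp_of_pos {D ν : ℝ → ℝ} {η : ℝ} (hη : 0 < η)
    (hν : ContinuousOn ν (Ioo (-η) η)) (hν0 : ν 0 = 0)
    (hD : ∀ t ∈ Ioo (-η) η, SignType.sign (D (ν t)) = SignType.sign t) (hpos : 0 < ν (η / 2)) :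
    ∀ᶠ δ in 𝓝 0, SignType.sign (D δ) = SignType.sign δ := by
  have m0 : (0 : ℝ) ∈ Ioo (-η) η := ⟨by linarith, hη⟩
  have hc1 : ContinuousOn ν (Icc 0 (η / 2)) :=
    hν.mono fun t ht => ⟨by linarith [ht.1], by linarith [ht.2]⟩
  have hc2 : ContinuousOn ν (Icc (-η / 2) 0) :=
    hν.mono fun t ht => ⟨by linarith [ht.1], by linarith [ht.2]⟩
  have hp : ∀ δ ∈ Ioo 0 (ν (η / 2)), 0 < D δ := fun δ hδ => by
    rw [← hν0] at hδ
    obtain ⟨t, ht, rfl⟩ := intermediate_value_Ioo (by linarith) hc1 hδ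
    rw [← sign_eq_one_iff, hD t ⟨by linarith [ht.1], by linarith [ht.2]⟩, sign_pos ht.1]
  have hne : ν (-η / 2) ≠ 0 := fun h => by
    have h1 := hD (-η / 2) ⟨by linarith, by linarith⟩
    rw [h, ← hν0, hD 0 m0, sign_zero, sign_neg (by linarith)] at h1
    exact absurd h1 (by decide)
  have hneg : ν (-η / 2) < 0 := by
    by_contra! hle
    have hlt := lt_of_le_of_ne hle hne.symm
    have hmin : 0 < min (ν (-η / 2)) (ν (η / 2)) := lt_min hlt hpos
    have h1 := hp (min (ν (-η / 2)) (ν (η / 2)) / 2)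
      ⟨by linarith, by linarith [min_le_right (ν (-η / 2)) (ν (η / 2))]⟩
    have h2 : min (ν (-η / 2)) (ν (η / 2)) / 2 ∈ Ioo (ν 0) (ν (-η / 2)) := by
      rw [hν0]
      exact ⟨by linarith, by linarith [min_le_left (ν (-η / 2)) (ν (η / 2))]⟩
    obtain ⟨t, ht, hte⟩ := intermediate_value_Ioo' (by linarith) hc2 h2
    have h3 := hD t ⟨by linarith [ht.1], by linarith [ht.2]⟩
    rw [hte, sign_pos h1, sign_neg ht.2] at h3
    exact absurd h3 (by decide)
  filter_upwards [Ioo_mem_nhds hneg hpos] with δ hδ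
  rcases lt_trichotomy δ 0 with h | rfl | h
  · have h1 : δ ∈ Ioo (ν (-η / 2)) (ν 0) := ⟨hδ.1, by rwa [hν0]⟩
    obtain ⟨t, ht, rfl⟩ := intermediate_value_Ioo (by linarith) hc2 h1
    rw [hD t ⟨by linarith [ht.1], by linarith [ht.2]⟩, sign_neg ht.2, sign_neg h]
  · have h1 := hD 0 m0
    rwa [hν0] at h1
  · rw [sign_pos (hp δ ⟨h, hδ.2⟩), sign_pos h]

/-- A function of one variable whose composition with some continuous function `ν`, `ν 0 = 0`, has
the sign of the identity, has this sign itself, up to a factor `±1`. -/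
theorem exists_sign_of_comp {D ν : ℝ → ℝ} {η : ℝ} (hη : 0 < η)
    (hν : ContinuousOn ν (Ioo (-η) η)) (hν0 : ν 0 = 0)
    (hD : ∀ t ∈ Ioo (-η) η, SignType.sign (D (ν t)) = SignType.sign t) :
    ∃ s : ℝ, (s = 1 ∨ s = -1) ∧
      ∀ᶠ δ in 𝓝 0, SignType.sign (D δ) = SignType.sign (s * δ) := by
  rcases lt_trichotomy (ν (η / 2)) 0 with h | h | h
  · refine ⟨-1, Or.inr rfl, ?_⟩
    have h1 := exists_sign_of_comp_of_pos (D := fun x => D (-x)) (ν := fun t => -ν t) hη hν.neg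
      (by simp [hν0]) (by simpa using hD) (by simpa using h)
    have h2 : Tendsto (fun x : ℝ => -x) (𝓝 0) (𝓝 0) := by
      simpa using (continuous_neg (G := ℝ)).tendsto 0
    filter_upwards [h2.eventually h1] with δ hδ
    simpa using hδ
  · exfalso
    have h1 := hD (η / 2) ⟨by linarith, by linarith⟩
    rw [h, ← hν0, hD 0 ⟨by linarith, hη⟩, sign_zero, sign_pos (by linarith)] at h1
    exact absurd h1 (by decide)
  · refine ⟨1, Or.inl rfl, ?_⟩
    simpa using exists_sign_of_comp_of_pos hη hν hν0 hD h

/-- Along a versal one-parameter unfolding of a double pseudo-equilibrium, the sign of `det Z (0)` is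
that of the parameter, up to a factor `±1`: this follows by comparison with a transverse unfolding,
since the sign of `det Z (0)` is an invariant. -/
theorem IsVersalUnfolding.exists_sign (hr : 1 ≤ r) {Z : Omega r U} {e c : Fin 2 → ℝ}
    (he : ∀ i, e i = 1 ∨ e i = -1) (hZ : HasSigns Z e c) (h0 : detZ Z 0 = 0)
    {γ : (Fin 1 → ℝ) → Omega r U} (hγ : IsVersalUnfolding Z γ) :
    ∃ s : ℝ, (s = 1 ∨ s = -1) ∧
      ∀ᶠ δ in 𝓝 0, SignType.sign (detZ (γ fun _ => δ) 0) = SignType.sign (s * δ) := by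
  set y := fieldY Z 0 0 with hy
  have hy0 : y ≠ 0 := fun h => by
    have := hZ.signY 0
    rw [← hy, h, mul_zero] at this
    exact this.false
  -- a transverse unfolding: its determinant at the origin is `α y ^ 2`
  set W : Omega r U := (constField r U (pt 0 (-y)), 0) with hW
  have hγ' := isUnfolding_affine Z W
  have hdet : ∀ α : Fin 1 → ℝ, detZ (Z + α 0 • W) 0 = α 0 * y ^ 2 := fun α => by
    have hX : fieldX (Z + α 0 • W) 0 = fieldX Z 0 + α 0 • pt 0 (-y) :=
      evalField_add_smul_constField _ _ _
    have hY : fieldY (Z + α 0 • W) 0 = fieldY Z 0 := by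
      simp [fieldY, hW]
    rw [detZ] at h0
    rw [detZ, hX, hY]
    simp only [PiLp.add_apply, PiLp.smul_apply, smul_eq_mul, pt_zero, pt_one, ← hy] at h0 ⊢
    linear_combination h0
  obtain ⟨N, hN, μ, hμ, hμ0, hμe⟩ := hγ.2 1 _ hγ'
  have hμt : Tendsto μ (𝓝 0) (𝓝 0) := by
    have := (hμ.continuousAt hN).tendsto
    rwa [hμ0] at this
  have hev : ∀ᶠ α in 𝓝 (0 : Fin 1 → ℝ),
      α ∈ N ∧ HasSigns (Z + α 0 • W) e c ∧ HasSigns (γ (μ α)) e c :=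
    Filter.Eventually.and hN ((hγ'.tendsto.eventually (hZ.eventually hr)).and
      ((hγ.1.tendsto.comp hμt).eventually (hZ.eventually hr)))
  have hdiag : Continuous fun (t : ℝ) (_ : Fin 1) => t := continuous_pi fun _ => continuous_id
  have hev2 := (hdiag.tendsto 0).eventually hev
  obtain ⟨η, hη, hηp⟩ := Metric.eventually_nhds_iff.1 hev2
  have hmem : ∀ t ∈ Ioo (-η) η, dist t 0 < η := fun t ht => by
    rw [dist_zero_right, Real.norm_eq_abs, abs_lt]
    exact ht
  refine exists_sign_of_comp (D := fun δ => detZ (γ fun _ => δ) 0)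
    (ν := fun t => μ (fun _ => t) 0) hη ?_ ?_ fun t ht => ?_
  · exact (continuous_apply 0).comp_continuousOn (hμ.comp hdiag.continuousOn fun t ht =>
      (hηp (hmem t ht)).1)
  · exact congrFun hμ0 0
  · obtain ⟨h1, h2, h3⟩ := hηp (hmem t ht)
    have h4 := h2.sign_det_eq hr he h3 (hμe _ h1)
    rw [hdet fun _ => t, sign_mul, sign_pos (a := y ^ 2) (by positivity), mul_one] at h4
    have h5 : (fun _ => μ (fun _ => t) 0) = μ fun _ => t := by
      funext i
      rw [Subsingleton.elim i 0]
    rw [h5, ← h4]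

/-! ### The model family -/

theorem modelFamily_eq (r : ℕ) (U : BoundedNhd) (a b c₁ c₂ : ℝ) (α : Fin 1 → ℝ) :
    modelFamily r U a b c₁ c₂ α = modelFamily r U a b c₁ c₂ 0 +
      α 0 • ((constField r U (pt 0 a), 0) : Omega r U) := by
  refine Prod.ext (Subtype.ext ?_) (by simp [modelFamily])
  funext k
  refine ContinuousMap.ext fun p => ?_
  have h1 : modelX a b c₂ (α 0) = modelX a b c₂ 0 + α 0 • fun _ => pt 0 a := by
    funext p
    refine plane_ext ?_ ?_
    · simp [modelX]
    · simp [modelX, mul_comm]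
  have hc : ContDiffAt ℝ ((k : ℕ) : WithTop ℕ∞) (fun _ : Plane => pt 0 a) (p : Plane) :=
    contDiffAt_const
  change iteratedFDeriv ℝ k (modelX a b c₂ (α 0)) p = iteratedFDeriv ℝ k (modelX a b c₂ 0) p +
    α 0 • iteratedFDeriv ℝ k (fun _ => pt 0 a) (p : Plane)
  have hc' : ContDiffAt ℝ ((k : ℕ) : WithTop ℕ∞) (α 0 • fun _ : Plane => pt 0 a) (p : Plane) :=
    hc.const_smul (α 0)
  rw [h1, iteratedFDeriv_add_apply (contDiff_modelX _ a b c₂ 0).contDiffAt hc',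
    iteratedFDeriv_const_smul_apply hc]

theorem detZ_modelFamily (r : ℕ) {U : BoundedNhd} (a b c₁ c₂ : ℝ) (α : Fin 1 → ℝ) {p : Plane}
    (hp : p ∈ U.carrier) : detZ (modelFamily r U a b c₁ c₂ α) p =
      (a - b * c₂ * p 0) * (-b + a * c₁ * p 1) + (b + a * α 0) * a := by
  rw [detZ, fieldX, fieldY, modelFamily, evalField_ofContDiff U _ _ (subset_closure hp),
    evalField_ofContDiff U _ _ (subset_closure hp)]
  simp only [modelX, modelY, pt_zero, pt_one]
  ring

theorem hasSigns_modelFamily (hr : 1 ≤ r) (U : BoundedNhd) {a b c₁ c₂ : ℝ} (ha : a = 1 ∨ a = -1)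
    (hb : b = 1 ∨ b = -1) (hc₁ : c₁ ≠ 0) (hc₂ : c₂ ≠ 0) {α : Fin 1 → ℝ} (hα : |α 0| < 1) :
    HasSigns (modelFamily r U a b c₁ c₂ α) ![a, b] ![c₂, c₁] := by
  have hX : fieldX (modelFamily r U a b c₁ c₂ α) 0 = modelX a b c₂ (α 0) 0 :=
    evalField_ofContDiff U _ (contDiff_modelX r a b c₂ (α 0)) (zero_mem_closure U)
  have hY : fieldY (modelFamily r U a b c₁ c₂ α) 0 = modelY a b c₁ 0 :=
    evalField_ofContDiff U _ (contDiff_modelY r a b c₁) (zero_mem_closure U)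
  have haa : a * a = 1 := by rcases ha with rfl | rfl <;> norm_num
  have hbb : b * b = 1 := by rcases hb with rfl | rfl <;> norm_num
  have hα' := abs_lt.1 hα
  have hpart : ∀ (i : Fin 2) (D : ℝ), HasDerivAt (fun x => (a - b * c₂ * axisPt i x 0) *
      (-b + a * c₁ * axisPt i x 1) + (b + a * α 0) * a) D 0 →
      partialDet (modelFamily r U a b c₁ c₂ α) (1 - i) = D := fun i D hD => by
    refine (hasDerivAt_detZ_axisPt hr _ i).unique (hD.congr_of_eventuallyEq ?_)
    have h1 : ∀ᶠ x in 𝓝 (0 : ℝ), axisPt i x ∈ U.carrier :=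
      (continuous_axisPt i).continuousAt.eventually_mem (by
        rw [axisPt_zero]
        exact U.isOpen.mem_nhds U.zero_mem)
    filter_upwards [h1] with x hx using detZ_modelFamily r a b c₁ c₂ α hx
  have hp0 : partialDet (modelFamily r U a b c₁ c₂ α) 0 = c₂ := by
    refine hpart 1 c₂ ?_
    have h0 : ∀ x, axisPt 1 x 0 = x := fun x => axisPt_other 1 x
    simp only [h0, axisPt_self]
    have h2 := ((((hasDerivAt_id (0 : ℝ)).const_mul (b * c₂)).const_sub a).mul_const
      (-b + a * c₁ * 0)).add_const ((b + a * α 0) * a)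
    refine h2.congr_deriv ?_
    linear_combination c₂ * hbb
  have hp1 : partialDet (modelFamily r U a b c₁ c₂ α) 1 = c₁ := by
    refine hpart 0 c₁ ?_
    have h1 : ∀ x, axisPt 0 x 1 = x := fun x => axisPt_other 0 x
    simp only [h1, axisPt_self]
    have h2 := ((((hasDerivAt_id (0 : ℝ)).const_mul (a * c₁)).const_add (-b)).const_mul
      (a - b * c₂ * 0)).add_const ((b + a * α 0) * a)
    refine h2.congr_deriv ?_
    linear_combination c₁ * haa
  refine ⟨fun i => ?_, fun i => ?_, fun j => ?_⟩
  · rw [hX]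
    fin_cases i
    · simp only [Fin.zero_eta, Matrix.cons_val_zero, modelX, pt_zero, PiLp.zero_apply, mul_zero,
        sub_zero, haa]
      exact one_pos
    · simp only [Fin.mk_one, Matrix.cons_val_one, Matrix.cons_val_fin_one, modelX, pt_one]
      rcases ha with rfl | rfl <;> rcases hb with rfl | rfl <;> linarith [hα'.1, hα'.2]
  · rw [hY]
    fin_cases i
    · simp only [Fin.zero_eta, Matrix.cons_val_zero, modelY, pt_zero, neg_mul_neg, haa]
      exact one_pos
    · simp only [Fin.mk_one, Matrix.cons_val_one, Matrix.cons_val_fin_one, modelY, pt_one,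
        PiLp.zero_apply, mul_zero, add_zero, neg_mul_neg, hbb]
      exact one_pos
  · fin_cases j
    · simp only [Fin.zero_eta, Matrix.cons_val_zero, hp0]
      exact mul_self_pos.2 hc₂
    · simp only [Fin.mk_one, Matrix.cons_val_one, Matrix.cons_val_fin_one, hp1]
      exact mul_self_pos.2 hc₁

theorem HasSigns.doublePseudoEquilibrium {Z : Omega r U} {e c : Fin 2 → ℝ} (hZ : HasSigns Z e c)
    (h0 : detZ Z 0 = 0) : DoublePseudoEquilibrium Z := by
  refine ⟨fun i => ?_, h0, fun j h => ?_⟩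
  · exact mul_neg_of_mul (hZ.signX i) (by linarith [hZ.signY i])
  · have := hZ.sign_partial j
    rw [h, mul_zero] at this
    exact this.false

theorem DoublePseudoEquilibrium.hasSigns {Z : Omega r U} (hZ : DoublePseudoEquilibrium Z) :
    HasSigns Z ![Real.sign (fieldX Z 0 0), Real.sign (fieldX Z 0 1)]
      ![Real.sign (partialDet Z 0), Real.sign (partialDet Z 1)] := by
  have hs : ∀ x : ℝ, x ≠ 0 → 0 < Real.sign x * x := fun x hx => by
    rcases hx.lt_or_gt with h | h
    · rw [Real.sign_of_neg h]; linarith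
    · rw [Real.sign_of_pos h]; linarith
  have hX : ∀ i, fieldX Z 0 i ≠ 0 := fun i h => by
    have := hZ.1 i
    rw [h, zero_mul] at this
    exact this.false
  have hXY : ∀ i, 0 < -Real.sign (fieldX Z 0 i) * fieldY Z 0 i := fun i => by
    have h1 := hs _ (hX i)
    have h2 : Real.sign (fieldX Z 0 i) * fieldY Z 0 i < 0 := by
      refine mul_neg_of_mul (u := fieldX Z 0 i) ?_ (hZ.1 i)
      rwa [mul_comm]
    linarith
  refine ⟨fun i => ?_, fun i => ?_, fun j => ?_⟩
  · fin_cases i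
    exacts [hs _ (hX 0), hs _ (hX 1)]
  · fin_cases i
    exacts [hXY 0, hXY 1]
  · fin_cases j
    exacts [hs _ (hZ.2.2 0), hs _ (hZ.2.2 1)]

/-- A versal unfolding is equivalent to the model family through `δ ↦ ± δ`. -/
theorem IsVersalUnfolding.locallyWeakEquivalent (hr : 1 ≤ r) {Z : Omega r U} {a b c₁ c₂ : ℝ}
    (ha : a = 1 ∨ a = -1) (hb : b = 1 ∨ b = -1) (hZ : HasSigns Z ![a, b] ![c₂, c₁])
    (h0 : detZ Z 0 = 0) {γ : (Fin 1 → ℝ) → Omega r U} (hγ : IsVersalUnfolding Z γ) :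
    LocallyWeakEquivalent γ (modelFamily r U a b c₁ c₂) := by
  have he : ∀ i, ![a, b] i = 1 ∨ ![a, b] i = -1 := fun i => by
    fin_cases i
    exacts [ha, hb]
  obtain ⟨s, hs, hsign⟩ := hγ.exists_sign hr he hZ h0
  obtain ⟨h, hh⟩ : ∃ h : (Fin 1 → ℝ) ≃ₜ (Fin 1 → ℝ), ∀ δ, h δ = s • δ := by
    rcases hs with rfl | rfl
    · exact ⟨Homeomorph.refl _, fun δ => by simp⟩
    · exact ⟨Homeomorph.neg _, fun δ => by simp⟩
  have habs : |s| = 1 := by rcases hs with rfl | rfl <;> simp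
  have haa : a * a = 1 := by rcases ha with rfl | rfl <;> norm_num
  have hc : Tendsto (fun δ : Fin 1 → ℝ => δ 0) (𝓝 0) (𝓝 0) :=
    (continuous_apply (0 : Fin 1)).tendsto 0
  have ev : ∀ᶠ δ in 𝓝 (0 : Fin 1 → ℝ), HasSigns (γ δ) ![a, b] ![c₂, c₁] ∧ |δ 0| < 1 ∧
      SignType.sign (detZ (γ fun _ => δ 0) 0) = SignType.sign (s * δ 0) :=
    (hγ.1.tendsto.eventually (hZ.eventually hr)).and
      ((hc.abs.eventually (gt_mem_nhds (by simp))).and (hc.eventually hsign))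
  obtain ⟨S, hS, hSo, hS0⟩ := mem_nhds_iff.1 ev
  refine ⟨h.toOpenPartialHomeomorphOfImageEq S hSo _ rfl, hS0, ?_, fun δ hδ => ?_⟩
  · change h 0 = 0
    rw [hh, smul_zero]
  · change LocallySigmaEquivalent (γ δ) (modelFamily r U a b c₁ c₂ (h δ))
    obtain ⟨h1, h2, h3⟩ := hS hδ
    have h4 : (fun _ => δ 0) = δ := by
      funext i
      rw [Subsingleton.elim i 0]
    rw [h4] at h3
    have h5 : h δ 0 = s * δ 0 := by rw [hh]; rfl
    refine h1.locallySigmaEquivalent hr he (hasSigns_modelFamily hr U ha hb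
      (hZ.ne_zero.2 1) (hZ.ne_zero.2 0) (by rw [h5, abs_mul, habs, one_mul]; exact h2)) ?_
    rw [h3, detZ_modelFamily r a b c₁ c₂ _ U.zero_mem, h5]
    congr 1
    simp only [PiLp.zero_apply]
    linear_combination -(s * δ 0) * haa

/-- A transverse unfolding of a double pseudo-equilibrium is versal. -/
theorem IsTransverseUnfolding.isVersalUnfolding (hr : 1 ≤ r) {Z : Omega r U} {e c : Fin 2 → ℝ}
    (he : ∀ i, e i = 1 ∨ e i = -1) (hZ : HasSigns Z e c) (h0 : detZ Z 0 = 0)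
    {γ : (Fin 1 → ℝ) → Omega r U} (hγ : IsUnfolding Z γ) (ht : IsTransverseUnfolding γ) :
    IsVersalUnfolding Z γ := by
  have hd := (differentiableAt_of_deriv_ne_zero ht).hasDerivAt
  refine isVersalUnfolding_of_sign hr he hZ h0 hγ (fun h => ht (sign_eq_zero_iff.1 h))
    (eventually_sign_eq hd ?_ ht)
  rw [show (fun _ : Fin 1 => (0 : ℝ)) = 0 from rfl, hγ.2.1, h0]

end Field

end CrossFilippov

end

theorem mainTheorem8 (r : ℕ) (hr : 1 ≤ r) (U : CrossFilippov.BoundedNhd)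
    (Z : CrossFilippov.Omega r U) (hZ : CrossFilippov.DoublePseudoEquilibrium Z)
    (a b c₁ c₂ : ℝ)
    (ha : a = Real.sign (CrossFilippov.fieldX Z 0 0))
    (hb : b = Real.sign (CrossFilippov.fieldX Z 0 1))
    (hc₁ : c₁ = Real.sign (CrossFilippov.partialDet Z 1))
    (hc₂ : c₂ = Real.sign (CrossFilippov.partialDet Z 0)) :
    -- the model family is an unfolding of a double pseudo-equilibrium
    (CrossFilippov.DoublePseudoEquilibrium (CrossFilippov.modelFamily r U a b c₁ c₂ 0) ∧
      CrossFilippov.IsUnfolding (CrossFilippov.modelFamily r U a b c₁ c₂ 0)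
        (CrossFilippov.modelFamily r U a b c₁ c₂)) ∧
    -- every versal one-parameter unfolding of `Z` is locally weak equivalent to it
    (∀ γ : (Fin 1 → ℝ) → CrossFilippov.Omega r U, CrossFilippov.IsVersalUnfolding Z γ →
      CrossFilippov.LocallyWeakEquivalent γ (CrossFilippov.modelFamily r U a b c₁ c₂)) ∧
    -- the transverse one-parameter unfoldings of `Z` are versal
    (∀ γ : (Fin 1 → ℝ) → CrossFilippov.Omega r U, CrossFilippov.IsUnfolding Z γ →
      CrossFilippov.IsTransverseUnfolding γ → CrossFilippov.IsVersalUnfolding Z γ) := by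
  open CrossFilippov in
  have hs : HasSigns Z ![a, b] ![c₂, c₁] := by
    rw [ha, hb, hc₁, hc₂]
    exact hZ.hasSigns
  have hsgn : ∀ x : ℝ, Real.sign x ≠ 0 → Real.sign x = 1 ∨ Real.sign x = -1 := fun x hx => by
    rcases Real.sign_apply_eq x with h | h | h
    exacts [Or.inr h, absurd h hx, Or.inl h]
  have ha1 : a = 1 ∨ a = -1 := by
    have := hs.ne_zero.1 0
    rw [ha]
    exact hsgn _ (ha ▸ this)
  have hb1 : b = 1 ∨ b = -1 := by
    have := hs.ne_zero.1 1
    rw [hb]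
    exact hsgn _ (hb ▸ this)
  have he : ∀ i, ![a, b] i = 1 ∨ ![a, b] i = -1 := fun i => by
    fin_cases i
    exacts [ha1, hb1]
  refine ⟨⟨?_, ?_⟩, fun γ hγ => hγ.locallyWeakEquivalent hr ha1 hb1 hs hZ.2.1,
    fun γ hγ ht => CrossFilippov.IsTransverseUnfolding.isVersalUnfolding hr he hs hZ.2.1 hγ ht⟩
  · refine (CrossFilippov.hasSigns_modelFamily hr U ha1 hb1 (hs.ne_zero.2 1) (hs.ne_zero.2 0)
      (α := 0) (by simp)).doublePseudoEquilibrium ?_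
    refine (CrossFilippov.detZ_modelFamily r a b c₁ c₂ 0 U.zero_mem).trans ?_
    simp only [PiLp.zero_apply, Pi.zero_apply]
    ring
  · have h1 := CrossFilippov.isUnfolding_affine (CrossFilippov.modelFamily r U a b c₁ c₂ 0)
      ((CrossFilippov.constField r U (CrossFilippov.pt 0 a), 0) : CrossFilippov.Omega r U)
    simp only [← CrossFilippov.modelFamily_eq] at h1
    exact h1
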